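/- A morphism of schemes $f\colon X\to S$ is called \emph{weakly strictly semi-stable of relative dimension $r$} if for every point $x\in X$ there exist an open neighborhood $U\subset X$ of $x$, an affine open neighborhood $\operatorname{Spec}R\subset S$ of $f(x)$, an integer $0<q\le r+1$, an element $a\in R$ and an étale morphism $U\to\operatorname{Spec}R[T_1,\dots,T_{r+1}]/(T_1\cdots T_q-a)$ over $S$. A weakly strictly semi-stable \emph{curve} is such a morphism with $r=1$. A scheme is \emph{regular} if it is locally noetherian and all its local rings are regular. A closed subscheme $D$ of a locally noetherian scheme $Y$ is a \emph{divisor with simple normal crossings} if for every point $y\in D$ the local ring $\mathcal O_{Y,y}$ is regular and has a regular system of parameters $t_1,\dots,t_d$ such that $D$ is defined at $y$ by $\prod_{j\in J}t_j$ for some $J\subset\{1,\dots,d\}$. A \emph{proper modification} is a proper morphism $X'\to X$ which is an isomorphism over a dense open subscheme of $X$ whose inverse image is dense in $X'$. \textbf{Lemma.} Let $S$ be a regular noetherian scheme and $D\subset S$ a divisor with simple normal crossings. Let $f\colon X\to S$ be a weakly strictly semi-stable curve such that the base change $X_W=X\times_S W\to W=S\setminus D$ is smooth. Then there exists a proper modification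 $X'\to X$ such that $X'_W\to X_W$ is an isomorphism, $X'$ is regular, $X'\to S$ is a weakly strictly semi-stable curve, and $X'\times_S D$ is a divisor on $X'$ with simple normal crossings. -/

import Mathlib

open CategoryTheory CategoryTheory.Limits AlgebraicGeometry

universe u

noncomputable section

namespace SemistableCurve

/-- A scheme is regular if it is locally noetherian and all its local rings are regular. -/
def IsRegularScheme (X : Scheme.{u}) : Prop :=
  IsLocallyNoetherian X ∧ ∀ x : X, IsRegularLocalRing (X.presheaf.stalk x)

/-- The stalk `I_x ⊆ 𝒪_{X,x}` of a quasi-coherent ideal sheaf `I`. It is generated by the sections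
of `I` on the affine open neighborhoods of `x`; any one such neighborhood suffices,
see `stalkIdeal_eq_map`. -/
def stalkIdeal {X : Scheme.{u}} (I : X.IdealSheafData) (x : X) : Ideal (X.presheaf.stalk x) :=
  ⨆ (U : X.affineOpens) (hx : x ∈ U.1), (I.ideal U).map (X.presheaf.germ U.1 x hx).hom

lemma stalkIdeal_eq_map {X : Scheme.{u}} (I : X.IdealSheafData) (x : X) (U : X.affineOpens)
    (hx : x ∈ U.1) :
    stalkIdeal I x = (I.ideal U).map (X.presheaf.germ U.1 x hx).hom := by
  have key : ∀ (A B : X.affineOpens) (hA : x ∈ A.1) (hB : x ∈ B.1), A ≤ B →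
      (I.ideal A).map (X.presheaf.germ A.1 x hA).hom =
        (I.ideal B).map (X.presheaf.germ B.1 x hB).hom := by
    intro A B hA hB hAB
    rw [← I.map_ideal hAB, Ideal.map_map, ← CommRingCat.hom_comp]
    congr 2
    exact X.presheaf.germ_res (homOfLE hAB) x hA
  refine le_antisymm (iSup₂_le fun V hV => ?_) (le_iSup₂_of_le U hx le_rfl)
  obtain ⟨W, hW, hxW, hWle⟩ := X.isBasis_affineOpens.exists_subset_of_mem_open
    (show x ∈ ((U.1 ⊓ V.1 : X.Opens) : Set X) from ⟨hx, hV⟩) (U.1 ⊓ V.1).isOpen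
  obtain ⟨W, hWa, rfl⟩ := hW
  have h1 := key ⟨W, hWa⟩ U hxW hx (fun y hy => (hWle hy).1)
  have h2 := key ⟨W, hWa⟩ V hxW hV (fun y hy => (hWle hy).2)
  exact (h2.symm.trans h1).le

/-- A closed subscheme `D` of `X`, given by its ideal sheaf, is a divisor with simple normal
crossings: `X` is locally noetherian, and at every point `x` of `D` the local ring `𝒪_{X,x}` is
regular and has a regular system of parameters `t₁, …, t_d` (`d = dim 𝒪_{X,x}`) such that `D` is
defined at `x` by the product of some of the `t_j`.  In particular `D` is an effective Cartier
divisor. The parameters are elements of the Zariski local ring, so that the irreducible components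
of `D` are regular. -/
def IsSNCDivisor {X : Scheme.{u}} (D : X.IdealSheafData) : Prop :=
  IsLocallyNoetherian X ∧
  ∀ x : X, x ∈ D.support →
    IsRegularLocalRing (X.presheaf.stalk x) ∧
    ∃ (d : ℕ) (t : Fin d → X.presheaf.stalk x) (J : Finset (Fin d)),
      ringKrullDim (X.presheaf.stalk x) = d ∧
      Ideal.span (Set.range t) = IsLocalRing.maximalIdeal (X.presheaf.stalk x) ∧
      stalkIdeal D x = Ideal.span {∏ j ∈ J, t j}

/-- The `R`-algebra `R[T₁, …, T_{r+1}] / (T₁ ⋯ T_q - a)`. -/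
abbrev StandardAlgebra (R : Type u) [CommRing R] (r q : ℕ) (a : R) : Type u :=
  MvPolynomial (Fin (r + 1)) R ⧸
    Ideal.span ({(∏ i : Fin (r + 1) with i.val < q, MvPolynomial.X i) - MvPolynomial.C a} :
      Set (MvPolynomial (Fin (r + 1)) R))

/-- `f : X ⟶ S` is weakly strictly semi-stable of relative dimension `r`: every `x : X` has an open
neighborhood `U` with an étale `S`-morphism to `Spec R[T₁, …, T_{r+1}] / (T₁ ⋯ T_q - a)`, where
`Spec R = V ⊆ S` is an affine open neighborhood of `f x`, `a ∈ R` and `0 < q ≤ r + 1`. -/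
def IsWeaklyStrictlySemistable (r : ℕ) {X S : Scheme.{u}} (f : X ⟶ S) : Prop :=
  ∀ x : X, ∃ (U : X.Opens) (V : S.Opens) (hV : IsAffineOpen V) (q : ℕ) (a : Γ(S, V))
    (g : U.toScheme ⟶ Spec (CommRingCat.of (StandardAlgebra Γ(S, V) r q a))),
    x ∈ U ∧ f x ∈ V ∧ 0 < q ∧ q ≤ r + 1 ∧ Etale g ∧
      g ≫ Spec.map (CommRingCat.ofHom (algebraMap Γ(S, V) (StandardAlgebra Γ(S, V) r q a))) ≫
        hV.fromSpec = U.ι ≫ f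

/-- A proper modification: a proper morphism which is an isomorphism over a dense open subscheme
of the target whose inverse image is dense in the source. -/
def IsProperModification {X' X : Scheme.{u}} (π : X' ⟶ X) : Prop :=
  IsProper π ∧ ∃ U : X.Opens, Dense (U : Set X) ∧ Dense ((π ⁻¹ᵁ U : X'.Opens) : Set X') ∧
    IsIso (π ∣_ U)

/-- The open complement of the closed subscheme defined by `D`. -/
def openCompl {S : Scheme.{u}} (D : S.IdealSheafData) : S.Opens :=
  D.support.compl

end SemistableCurve

end

/-! Near a point where `f` is not smooth, `X` is étale over a node `x y = a`. Such points lie over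
`D`, so the equation of `D` vanishes on the locus `x = y = 0`, whose trace on the base is `a = 0`.
Hence `a` divides a power of that equation, and since `S` is regular, `a` is a unit times a product
`τ₁ ⋯ τₙ` of parameters defining components of `D`, repetitions allowed. If `n = 1`, the local ring
is regular already, with `x`, `y` in place of the parameter `τ₁`. For `n > 1` one uses the toric
modification with charts `x = τ₁ ⋯ τₖ₋₁ u`, `y = τₖ₊₁ ⋯ τₙ v`, `u v = τₖ`. Each chart is again
nodal, now with a parameter as discriminant; so the total space is regular, and replacing the factor
`τₖ` by `u v` keeps the equation of `D` a product of distinct parameters (`IsNode.isRegularSystem`,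
`IsNode.isSNCHom`).

This modification depends on the order of the factors, and exchanging `x` and `y` reverses that
order, so a canonical ordering is needed. The branches are intrinsic: two presentations of a local
ring as a node agree up to units and exchange of the coordinates (`IsNode.associated_or`). After
fixing a linear order on the points of `X`, each component `τ` of the discriminant receives as key
the difference of the generic points of `x = τ = 0` and `y = τ = 0` in the lexicographically ordered
group `X →₀ ℤ` (`branchKey`). The key separates components, changes sign when the branches are
exchanged, and is locally constant, so charts with sorted factors exist at every node
(`NodalFamily.exists_sortedChart`) and the partial products of two sorted charts agree or are
complementary (`SortedChart.part_comparison`).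

For schemes flat over `S`, lifting locally to the `k`th chart amounts to the divisibilities `τ₁ ⋯
τₖ₋₁ ∣ x ∣ τ₁ ⋯ τₖ` (`NodeChart.exists_lift_of_dvd`). Thus the union of the charts is governed by
comparability of `x` with all partial products, which does not depend on the sorted chart
(`SortedChart.adapted_of_adapted`). The charts and the smooth locus therefore glue along their
largest overlaps over `X`. Properness follows from the valuative criterion, since elements of a
valuation ring are always comparable under divisibility; the smooth locus, which contains `X_W`, is
left unchanged. -/

noncomputable section

namespace SemistableCurve

/-! ### Regular local rings and regular systems of parameters. -/

section RegularLocalRings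

open IsLocalRing

/-- A regular system of parameters of a local ring, indexed by a finite type. -/
structure IsRegularSystem {R : Type*} [CommRing R] [IsLocalRing R] {ι : Type*} [Fintype ι]
    (t : ι → R) : Prop where
  span_range : Ideal.span (Set.range t) = maximalIdeal R
  dim : ringKrullDim R = Fintype.card ι

lemma IsRegularSystem.mem_maximalIdeal {R : Type*} [CommRing R] [IsLocalRing R] {ι : Type*}
    [Fintype ι] {t : ι → R} (h : IsRegularSystem t) (i : ι) : t i ∈ maximalIdeal R :=
  h.span_range ▸ Ideal.subset_span ⟨i, rfl⟩

lemma ringKrullDim_le_card {R : Type*} [CommRing R] [IsLocalRing R] [IsNoetherianRing R]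
    {ι : Type*} [Fintype ι] {t : ι → R} (h : Ideal.span (Set.range t) = maximalIdeal R) :
    ringKrullDim R ≤ Fintype.card ι := by
  have h1 : (maximalIdeal R).spanFinrank ≤ Fintype.card ι := by
    rw [← h]
    refine (Submodule.spanFinrank_span_le_ncard_of_finite (Set.finite_range t)).trans ?_
    rw [← Set.image_univ]
    refine (Set.ncard_image_le Set.finite_univ).trans ?_
    rw [Set.ncard_univ, Nat.card_eq_fintype_card]
  exact (ringKrullDim_le_spanFinrank_maximalIdeal R).trans (by exact_mod_cast h1)

lemma isRegularSystem_of_card_le {R : Type*} [CommRing R] [IsLocalRing R] [IsNoetherianRing R]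
    {ι : Type*} [Fintype ι] {t : ι → R} (h : Ideal.span (Set.range t) = maximalIdeal R)
    (hdim : (Fintype.card ι : WithBot ℕ∞) ≤ ringKrullDim R) : IsRegularSystem t :=
  ⟨h, le_antisymm (ringKrullDim_le_card h) hdim⟩

lemma IsRegularSystem.isRegularLocalRing {R : Type*} [CommRing R] [IsLocalRing R]
    [IsNoetherianRing R] {ι : Type*} [Fintype ι] {t : ι → R} (h : IsRegularSystem t) :
    IsRegularLocalRing R := by
  refine IsRegularLocalRing.of_spanFinrank_maximalIdeal_le R ?_
  rw [h.dim, ← h.span_range]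
  refine Nat.cast_le.mpr ((Submodule.spanFinrank_span_le_ncard_of_finite
    (Set.finite_range t)).trans ?_)
  rw [← Set.image_univ]
  refine (Set.ncard_image_le Set.finite_univ).trans ?_
  rw [Set.ncard_univ, Nat.card_eq_fintype_card]

lemma exists_isRegularSystem (R : Type*) [CommRing R] [IsRegularLocalRing R] :
    ∃ (d : ℕ) (t : Fin d → R), IsRegularSystem t := by
  have hfg := (maximalIdeal R).fg_of_isNoetherianRing
  have hfin := Submodule.FG.finite_generators hfg
  have := hfin.fintype
  let e := Fintype.equivFin (maximalIdeal R).generators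
  refine ⟨Fintype.card (maximalIdeal R).generators, fun i => (e.symm i : R), ?_, ?_⟩
  · have : Set.range (fun i => (e.symm i : R)) = (maximalIdeal R).generators := by
      change Set.range (Subtype.val ∘ e.symm) = _
      rw [EquivLike.range_comp, Subtype.range_coe]
    rw [this]
    exact (maximalIdeal R).span_generators
  · rw [← IsRegularLocalRing.spanFinrank_maximalIdeal, ← Submodule.FG.generators_ncard hfg,
      Fintype.card_fin, ← Nat.card_eq_fintype_card, Nat.card_coe_set_eq]

lemma IsRegularSystem.equiv {R : Type*} [CommRing R] [IsLocalRing R] {ι κ : Type*}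
    [Fintype ι] [Fintype κ] {t : ι → R} (h : IsRegularSystem t) (e : κ ≃ ι) :
    IsRegularSystem (t ∘ e) :=
  ⟨by rw [EquivLike.range_comp, h.span_range], by rw [h.dim, Fintype.card_congr e]⟩

lemma span_range_quotient {R : Type*} [CommRing R] [IsLocalRing R] {ι : Type*}
    {t : ι → R} (h : Ideal.span (Set.range t) = maximalIdeal R) (i : ι)
    [IsLocalRing (R ⧸ Ideal.span {t i})] :
    Ideal.span (Set.range fun j : {j // j ≠ i} => Ideal.Quotient.mk (Ideal.span {t i}) (t j)) =
      maximalIdeal (R ⧸ Ideal.span {t i}) := by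
  have hmap : (maximalIdeal R).map (Ideal.Quotient.mk (Ideal.span {t i})) =
      maximalIdeal (R ⧸ Ideal.span {t i}) :=
    IsLocalRing.map_maximalIdeal_of_surjective _ Ideal.Quotient.mk_surjective
  rw [← hmap, ← h, Ideal.map_span]
  refine le_antisymm (Ideal.span_mono ?_) (Ideal.span_le.mpr ?_)
  · rintro _ ⟨j, rfl⟩
    exact ⟨t j, ⟨j, rfl⟩, rfl⟩
  · rintro _ ⟨_, ⟨j, rfl⟩, rfl⟩
    by_cases hj : j = i
    · subst hj
      rw [SetLike.mem_coe, Ideal.Quotient.eq_zero_iff_mem.mpr (Ideal.mem_span_singleton_self _)]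
      exact zero_mem _
    · exact Ideal.subset_span ⟨⟨j, hj⟩, rfl⟩

lemma isLocalRing_quotient_span_singleton {R : Type*} [CommRing R] [IsLocalRing R] {x : R}
    (hx : x ∈ maximalIdeal R) : IsLocalRing (R ⧸ Ideal.span {x}) := by
  have : Nontrivial (R ⧸ Ideal.span {x}) := Ideal.Quotient.nontrivial_iff.mpr <|
    ne_top_of_le_ne_top (maximalIdeal.isMaximal R).ne_top ((Ideal.span_singleton_le_iff_mem _).mpr hx)
  exact IsLocalRing.of_surjective' _ Ideal.Quotient.mk_surjective

/-- Cutting by one element lowers the dimension by at most one, and the remaining parameters bound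
it from above; the two estimates meet. -/
lemma IsRegularSystem.quotient {R : Type*} [CommRing R] [IsLocalRing R] [IsNoetherianRing R]
    {ι : Type*} [Fintype ι] [DecidableEq ι] {t : ι → R} (h : IsRegularSystem t) (i : ι)
    [IsLocalRing (R ⧸ Ideal.span {t i})] :
    IsRegularSystem
      (fun j : {j // j ≠ i} => Ideal.Quotient.mk (Ideal.span {t i}) (t j)) := by
  refine isRegularSystem_of_card_le (span_range_quotient h.span_range i) ?_
  have h1 := ringKrullDim_le_ringKrullDim_quotient_add_card (R := R) {t i} (by
    simpa [IsLocalRing.ringJacobson_eq_maximalIdeal] using h.mem_maximalIdeal i)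
  rw [h.dim, Finset.coe_singleton, Finset.card_singleton] at h1
  have h2 : Fintype.card ι = Fintype.card {j // j ≠ i} + 1 := by
    have := Fintype.card_subtype_compl (fun j => j = i)
    have h3 : 0 < Fintype.card ι := Fintype.card_pos_iff.mpr ⟨i⟩
    simp only [Fintype.card_subtype_eq] at this
    simp only [ne_eq]
    omega
  rw [h2] at h1
  generalize ringKrullDim (R ⧸ Ideal.span {t i}) = D at h1
  induction D with
  | bot => simp at h1
  | coe D =>
    have : ((Fintype.card {j // j ≠ i} + 1 : ℕ) : ℕ∞) ≤ D + 1 := by exact_mod_cast h1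
    induction D with
    | top => exact_mod_cast le_top
    | coe D =>
      have : Fintype.card {j // j ≠ i} + 1 ≤ D + 1 := by exact_mod_cast this
      exact_mod_cast (by omega : Fintype.card {j // j ≠ i} ≤ D)

/-- Induction on the dimension. Prime avoidance gives `x` in the maximal ideal but outside its
square and outside all minimal primes. Then `x` is part of a regular system, so `(x)` is prime by
induction. A minimal prime `P` inside `(x)` does not contain `x`, so `P = x P`, and `P = 0` by
Nakayama. -/
lemma IsRegularSystem.isDomain {n : ℕ} : ∀ {R : Type u} [CommRing R] [IsLocalRing R]
    [IsNoetherianRing R] {ι : Type} [Fintype ι] {t : ι → R} (_ : IsRegularSystem t),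
    Fintype.card ι = n → IsDomain R := by
  classical
  induction n with
  | zero =>
    intro R _ _ _ ι _ t h hn
    have : IsEmpty ι := Fintype.card_eq_zero_iff.mp hn
    have hm : maximalIdeal R = ⊥ := by
      rw [← h.span_range, Set.range_eq_empty, Ideal.span_empty]
    exact (isField_iff_maximalIdeal_eq.mpr hm).isDomain
  | succ n ih =>
    intro R _ _ _ ι _ t h hn
    have hmin : (minimalPrimes R).Finite := minimalPrimes.finite_of_isNoetherianRing R
    have hne : ∀ P ∈ minimalPrimes R, ¬ maximalIdeal R ≤ P := by
      intro P hP hle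
      have hPp : P.IsPrime := hP.1.1
      have : P = maximalIdeal R := le_antisymm (le_maximalIdeal hPp.ne_top) hle
      have h0 : (maximalIdeal R).height = 0 := by
        rw [← this, Ideal.height_eq_zero_iff]; exact hP
      have := maximalIdeal_height_eq_ringKrullDim (R := R)
      rw [h0, h.dim, hn] at this
      have : (0 : ℕ) = n + 1 := by exact_mod_cast this
      omega
    have hpos : 0 < Fintype.card ι := by omega
    have hm2 : ¬ maximalIdeal R ≤ (maximalIdeal R) ^ 2 := by
      intro hle
      have h0 : maximalIdeal R = ⊥ := by
        refine Submodule.eq_bot_of_le_smul_of_le_jacobson_bot (maximalIdeal R) _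
          (IsNoetherian.noetherian _) ?_ ?_
        · rwa [smul_eq_mul, ← pow_two]
        · exact (jacobson_eq_maximalIdeal ⊥ bot_ne_top).ge
      have := maximalIdeal_height_eq_ringKrullDim (R := R)
      rw [h0, h.dim, hn] at this
      have hF : IsField R := isField_iff_maximalIdeal_eq.mpr h0
      have hdom := hF.isDomain
      rw [Ideal.height_bot] at this
      have : (0 : ℕ) = n + 1 := by exact_mod_cast this
      omega
    obtain ⟨x, hxm, hx⟩ : ∃ x ∈ maximalIdeal R, x ∉ (maximalIdeal R) ^ 2 ∧
        ∀ P ∈ minimalPrimes R, x ∉ P := by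
      by_contra! hcon
      have hsub : ((maximalIdeal R : Ideal R) : Set R) ⊆
          ⋃ i ∈ (↑(insert ((maximalIdeal R) ^ 2) hmin.toFinset) : Set (Ideal R)), (i : Set R) := by
        intro x hx
        by_cases hx2 : x ∈ (maximalIdeal R) ^ 2
        · exact Set.mem_biUnion (by simp) hx2
        · obtain ⟨P, hP, hxP⟩ := hcon x hx hx2
          exact Set.mem_biUnion (by simp [hP]) hxP
      -- Prime avoidance tolerates two ideals that need not be prime; the square of the maximal
      -- ideal is passed for both.
      obtain ⟨i, hi, hle⟩ := (Ideal.subset_union_prime (f := fun I : Ideal R => I)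
        ((maximalIdeal R) ^ 2) ((maximalIdeal R) ^ 2) (fun i hi h1 _ => by
          simp only [Finset.mem_insert, h1, false_or, Set.Finite.mem_toFinset] at hi
          exact hi.1.1)).mp hsub
      simp only [Finset.mem_insert, Set.Finite.mem_toFinset] at hi
      obtain rfl | hi := hi
      · exact hm2 hle
      · exact hne i hi hle
    obtain ⟨hx2, hxP⟩ := hx
    obtain ⟨r, hr⟩ := (Ideal.mem_span_range_iff_exists_fun).mp (h.span_range ▸ hxm)
    obtain ⟨i, hi⟩ : ∃ i, IsUnit (r i) := by
      by_contra! hcon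
      refine hx2 (hr ▸ Ideal.sum_mem _ fun i _ => ?_)
      rw [pow_two]
      exact Ideal.mul_mem_mul ((IsLocalRing.mem_maximalIdeal _).mpr (hcon i)) (h.mem_maximalIdeal i)
    -- Exchange: the coefficient of `t i` in `x` is a unit, so `x` may replace `t i`.
    let t' : ι → R := Function.update t i x
    have ht'i : t' i = x := Function.update_self ..
    have ht' : IsRegularSystem t' := by
      refine isRegularSystem_of_card_le (le_antisymm (Ideal.span_le.mpr ?_) ?_) h.dim.ge
      · rintro _ ⟨j, rfl⟩
        by_cases hj : j = i
        · subst hj; simpa [ht'i] using hxm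
        · simpa [t', hj] using h.mem_maximalIdeal j
      · rw [← h.span_range]
        refine Ideal.span_le.mpr ?_
        have hmem : ∀ j, j ≠ i → t j ∈ Ideal.span (Set.range t') := fun j hj =>
          Ideal.subset_span ⟨j, by simp [t', hj]⟩
        rintro _ ⟨j, rfl⟩
        by_cases hj : j = i
        · subst hj
          have hx' : x ∈ Ideal.span (Set.range t') := Ideal.subset_span ⟨j, ht'i⟩
          rw [← Finset.add_sum_erase _ _ (Finset.mem_univ j)] at hr
          have : r j * t j ∈ Ideal.span (Set.range t') := by
            rw [← eq_sub_iff_add_eq] at hr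
            rw [hr]
            exact sub_mem hx' (Ideal.sum_mem _ fun k hk =>
              Ideal.mul_mem_left _ _ (hmem k (Finset.ne_of_mem_erase hk)))
          exact (Ideal.unit_mul_mem_iff_mem _ hi).mp this
        · exact hmem j hj
    have hloc : IsLocalRing (R ⧸ Ideal.span {t' i}) :=
      isLocalRing_quotient_span_singleton (ht'.mem_maximalIdeal i)
    have hdom := ih (ht'.quotient i) (by
      have := Fintype.card_subtype_compl (fun j => j = i)
      simp only [Fintype.card_subtype_eq] at this
      simp only [ne_eq]
      omega)
    rw [ht'i] at hdom
    have hprime : (Ideal.span {x}).IsPrime := (Ideal.Quotient.isDomain_iff_prime _).mp hdom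
    obtain ⟨P, hP, hPle⟩ := Ideal.exists_minimalPrimes_le (bot_le (a := Ideal.span {x}))
    have hPp : P.IsPrime := hP.1.1
    have hbot : P = ⊥ := by
      refine Submodule.eq_bot_of_le_smul_of_le_jacobson_bot (maximalIdeal R) _
        (IsNoetherian.noetherian _) ?_ (jacobson_eq_maximalIdeal ⊥ bot_ne_top).ge
      intro y hy
      obtain ⟨z, rfl⟩ := Ideal.mem_span_singleton'.mp (hPle hy)
      rw [mul_comm, smul_eq_mul]
      exact Ideal.mul_mem_mul hxm ((hPp.mem_or_mem hy).resolve_right (hxP P hP))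
    subst hbot
    exact IsDomain.of_bot_isPrime R

lemma IsRegularLocalRing.isDomain (R : Type u) [CommRing R] [IsRegularLocalRing R] :
    IsDomain R := by
  obtain ⟨d, t, ht⟩ := exists_isRegularSystem R
  exact ht.isDomain rfl

/-- The quotient by `t i` is again regular, hence a domain; and `t i ≠ 0`, since otherwise the
dimension could not drop. -/
lemma IsRegularSystem.prime {R : Type u} [CommRing R] [IsLocalRing R] [IsNoetherianRing R]
    {ι : Type} [Fintype ι] {t : ι → R} (h : IsRegularSystem t) (i : ι) : Prime (t i) := by
  classical
  have hloc := isLocalRing_quotient_span_singleton (h.mem_maximalIdeal i)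
  have hdom := (h.quotient i).isDomain rfl
  have hprime := (Ideal.Quotient.isDomain_iff_prime _).mp hdom
  have hR := h.isDomain rfl
  refine (Ideal.span_singleton_prime ?_).mp hprime
  intro h0
  have h1 := (h.quotient i).dim
  rw [h0, Ideal.span_singleton_zero, ringKrullDim_eq_of_ringEquiv (RingEquiv.quotientBot R),
    h.dim] at h1
  have h2 : Fintype.card ι = Fintype.card {j // j ≠ i} := by exact_mod_cast h1
  have := Fintype.card_subtype_compl (fun j => j = i)
  have h3 : 0 < Fintype.card ι := Fintype.card_pos_iff.mpr ⟨i⟩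
  simp only [Fintype.card_subtype_eq] at this
  simp only [ne_eq] at h2
  omega

/-- Going down for flat extensions makes the height of the contraction a summand of the height
upstairs. This is the source of all lower bounds for dimensions of étale-local rings. -/
lemma height_comap_maximalIdeal_le {A O : Type*} [CommRing A] [CommRing O] [IsLocalRing O]
    [Algebra A O] [Module.Flat A O] [IsNoetherianRing A] [IsNoetherianRing O] (q : Ideal A)
    [q.IsPrime] (h : (maximalIdeal O).comap (algebraMap A O) = q) :
    (q.height : WithBot ℕ∞) ≤ ringKrullDim O := by
  have : (maximalIdeal O).LiesOver q := ⟨h.symm⟩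
  rw [← maximalIdeal_height_eq_ringKrullDim,
    Ideal.height_eq_height_add_of_liesOver_of_hasGoingDown q (maximalIdeal O)]
  exact_mod_cast le_self_add

end RegularLocalRings

/-! ### The node algebra: universal property and flatness. -/

section NodeAlgebra

/-- The node algebra `R[x, y] / (x y - a)`. -/
abbrev NodeAlgebra (R : Type u) [CommRing R] (a : R) : Type u := StandardAlgebra R 1 2 a

namespace NodeAlgebra

variable {R : Type u} [CommRing R] {a : R}

/-- The first coordinate. -/
def x (a : R) : NodeAlgebra R a := Ideal.Quotient.mk _ (MvPolynomial.X 0)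

/-- The second coordinate. -/
def y (a : R) : NodeAlgebra R a := Ideal.Quotient.mk _ (MvPolynomial.X 1)

lemma prod_X_two {R : Type*} [CommRing R] :
    (∏ i : Fin (1 + 1) with i.val < 2, (MvPolynomial.X i : MvPolynomial (Fin (1 + 1)) R)) =
      MvPolynomial.X 0 * MvPolynomial.X 1 := by
  rw [Finset.filter_true_of_mem (by intro i _; exact i.2), Fin.prod_univ_two]

lemma x_mul_y : x a * y a = algebraMap R (NodeAlgebra R a) a := by
  refine (Ideal.Quotient.mk_eq_mk_iff_sub_mem (MvPolynomial.X 0 * MvPolynomial.X 1)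
    (MvPolynomial.C a)).mpr (Ideal.subset_span ?_)
  rw [prod_X_two]
  rfl

variable {B : Type*} [CommRing B]

/-- The universal property of the node algebra. -/
def lift (φ : R →+* B) (s t : B) (h : s * t = φ a) : NodeAlgebra R a →+* B :=
  Ideal.Quotient.lift _ (MvPolynomial.eval₂Hom φ ![s, t]) (by
    intro p hp
    rw [← RingHom.mem_ker]
    refine (Ideal.span_le (I := RingHom.ker (MvPolynomial.eval₂Hom φ ![s, t]))).mpr ?_ hp
    rintro _ rfl
    rw [SetLike.mem_coe, RingHom.mem_ker, prod_X_two]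
    simp [h])

@[simp] lemma lift_x (φ : R →+* B) (s t : B) (h : s * t = φ a) : lift φ s t h (x a) = s := by
  simp [lift, x]

@[simp] lemma lift_y (φ : R →+* B) (s t : B) (h : s * t = φ a) : lift φ s t h (y a) = t := by
  simp [lift, y]

@[simp] lemma lift_algebraMap (φ : R →+* B) (s t : B) (h : s * t = φ a) (r : R) :
    lift φ s t h (algebraMap R _ r) = φ r := by
  change lift φ s t h (Ideal.Quotient.mk _ (MvPolynomial.C r)) = _
  simp [lift]

lemma lift_comp_algebraMap (φ : R →+* B) (s t : B) (h : s * t = φ a) :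
    (lift φ s t h).comp (algebraMap R _) = φ := RingHom.ext fun r => lift_algebraMap φ s t h r

lemma hom_ext {f g : NodeAlgebra R a →+* B}
    (h : f.comp (algebraMap R _) = g.comp (algebraMap R _)) (hx : f (x a) = g (x a))
    (hy : f (y a) = g (y a)) : f = g := by
  refine Ideal.Quotient.ringHom_ext (MvPolynomial.ringHom_ext (fun r => ?_) fun i => ?_)
  · exact RingHom.congr_fun h r
  · fin_cases i
    · exact hx
    · exact hy

/-- Every element is congruent to a constant modulo the two coordinates. -/
lemma exists_sub_algebraMap_mem (p : NodeAlgebra R a) :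
    ∃ r : R, p - algebraMap R _ r ∈ Ideal.span {x a, y a} := by
  obtain ⟨p, rfl⟩ := Ideal.Quotient.mk_surjective p
  induction p using MvPolynomial.induction_on with
  | C r => exact ⟨r, by
      change algebraMap R (NodeAlgebra R a) r - algebraMap R _ r ∈ _
      rw [sub_self]; exact zero_mem _⟩
  | add p q hp hq =>
    obtain ⟨r, hr⟩ := hp
    obtain ⟨s, hs⟩ := hq
    refine ⟨r + s, ?_⟩
    rw [map_add, map_add, add_sub_add_comm]
    exact add_mem hr hs
  | mul_X p i _ =>
    refine ⟨0, ?_⟩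
    rw [map_zero, sub_zero, map_mul]
    refine Ideal.mul_mem_left _ _ (Ideal.subset_span ?_)
    fin_cases i
    · exact Or.inl rfl
    · exact Or.inr rfl

/-- Setting `x = 0` identifies `R[x, y] / (x y - a, x, t)` with `(R/t)[y]` when `t ∣ a`. -/
def evalX (t : R) (h : t ∣ a) : NodeAlgebra R a →+* Polynomial (R ⧸ Ideal.span {t}) :=
  lift (Polynomial.C.comp (Ideal.Quotient.mk _)) 0 Polynomial.X (by
    rw [zero_mul, RingHom.comp_apply,
      Ideal.Quotient.eq_zero_iff_mem.mpr (Ideal.mem_span_singleton.mpr h), map_zero])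

lemma evalX_surjective (t : R) (h : t ∣ a) : Function.Surjective (evalX t h) := by
  intro p
  induction p using Polynomial.induction_on' with
  | add p q hp hq =>
    obtain ⟨p, rfl⟩ := hp
    obtain ⟨q, rfl⟩ := hq
    exact ⟨p + q, map_add _ _ _⟩
  | monomial n c =>
    obtain ⟨c, rfl⟩ := Ideal.Quotient.mk_surjective c
    refine ⟨algebraMap R _ c * y a ^ n, ?_⟩
    simp [evalX, Polynomial.C_mul_X_pow_eq_monomial]

lemma ker_evalX (t : R) (h : t ∣ a) :
    RingHom.ker (evalX t h) = Ideal.span {x a, algebraMap R _ t} := by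
  refine le_antisymm (fun p hp => ?_) (Ideal.span_le.mpr ?_)
  · let e : Polynomial (R ⧸ Ideal.span {t}) →+*
        NodeAlgebra R a ⧸ Ideal.span {x a, algebraMap R _ t} :=
      Polynomial.eval₂RingHom (Ideal.Quotient.lift (Ideal.span {t})
        ((Ideal.Quotient.mk _).comp (algebraMap R _)) (by
          intro r hr
          obtain ⟨s, rfl⟩ := Ideal.mem_span_singleton'.mp hr
          rw [RingHom.comp_apply, map_mul, Ideal.Quotient.eq_zero_iff_mem]
          exact Ideal.mul_mem_left _ _ (Ideal.subset_span (by simp))))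
        (Ideal.Quotient.mk _ (y a))
    have he : e.comp (evalX t h) = Ideal.Quotient.mk (Ideal.span {x a, algebraMap R _ t}) := by
      refine hom_ext (B := NodeAlgebra R a ⧸ Ideal.span {x a, algebraMap R _ t}) ?_ ?_ ?_
      · ext r; simp [e, evalX]
      · simp only [RingHom.comp_apply, evalX, lift_x, map_zero]
        exact (Ideal.Quotient.eq_zero_iff_mem.mpr (Ideal.subset_span (by simp))).symm
      · simp [e, evalX]
    rw [← Ideal.Quotient.eq_zero_iff_mem, ← he, RingHom.comp_apply, (RingHom.mem_ker).mp hp,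
      map_zero]
  · rintro _ (rfl | rfl)
    · simp [evalX]
    · simp [evalX]

/-- `y` is a nonzerodivisor modulo `x`. -/
lemma mem_span_x_of_mul_y_mem {p q : NodeAlgebra R a} (h : p * y a + q * x a = 0) :
    p ∈ Ideal.span {x a} := by
  -- Modulo `x` the algebra is a polynomial ring in `y` over `R / a`, where the variable is regular.
  have h1 : evalX a dvd_rfl p * Polynomial.X = 0 := by
    have := congr(evalX a dvd_rfl $h)
    simpa [evalX] using this
  have h2 : evalX a dvd_rfl p = 0 := by
    exact Polynomial.isRegular_X.right (by simpa using h1)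
  have h3 : p ∈ Ideal.span {x a, algebraMap R _ a} := by
    rw [← ker_evalX a dvd_rfl]
    exact h2
  refine (Ideal.span_le.mpr ?_) h3
  rintro _ (rfl | rfl)
  · exact Ideal.mem_span_singleton_self _
  · rw [SetLike.mem_coe, ← x_mul_y]
    exact Ideal.mul_mem_right _ _ (Ideal.mem_span_singleton_self _)

/-- Exchanging the two coordinates. -/
def swap (a : R) : NodeAlgebra R a ≃+* NodeAlgebra R a :=
  RingEquiv.ofRingHom (lift (algebraMap R _) (y a) (x a) (by rw [mul_comm, x_mul_y]))
    (lift (algebraMap R _) (y a) (x a) (by rw [mul_comm, x_mul_y]))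
    (hom_ext (by ext; simp) (by simp) (by simp)) (hom_ext (by ext; simp) (by simp) (by simp))

@[simp] lemma swap_x : swap a (x a) = y a := by simp [swap]
@[simp] lemma swap_y : swap a (y a) = x a := by simp [swap]
@[simp] lemma swap_algebraMap (r : R) : swap a (algebraMap R _ r) = algebraMap R _ r := by
  simp [swap]

/-- The basis element `x ^ n` or `y ^ (-n)`. -/
def basisElem (a : R) (n : ℤ) : NodeAlgebra R a := x a ^ n.toNat * y a ^ (-n).toNat

/-- Coordinates of the monomials with respect to the elements `basisElem`. -/
def coordsPoly (a : R) : MvPolynomial (Fin 2) R →ₗ[R] (ℤ →₀ R) :=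
  (MvPolynomial.basisMonomials (Fin 2) R).constr R
    (fun m => Finsupp.single ((m 0 : ℤ) - m 1) (a ^ (min (m 0) (m 1))))

lemma coordsPoly_monomial (m : Fin 2 →₀ ℕ) (r : R) :
    coordsPoly a (MvPolynomial.monomial m r) =
      Finsupp.single ((m 0 : ℤ) - m 1) (r * a ^ (min (m 0) (m 1))) := by
  have : MvPolynomial.monomial m r = r • (MvPolynomial.basisMonomials (Fin 2) R) m := by
    rw [MvPolynomial.coe_basisMonomials, MvPolynomial.smul_monomial, smul_eq_mul, mul_one]
  rw [this, map_smul, coordsPoly, Module.Basis.constr_basis]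
  simp

/-- The relation rewrites `x ^ i * y ^ j` as `a ^ min i j` times a pure power of `x` or of `y`,
indexed by `i - j`. Recording these coordinates exhibits the algebra as a retract of the free module
`ℤ →₀ R`. -/
instance flat (a : R) : Module.Flat R (NodeAlgebra R a) := by
  let I : Ideal (MvPolynomial (Fin (1 + 1)) R) :=
    Ideal.span {(∏ i : Fin (1 + 1) with i.val < 2, MvPolynomial.X i) - MvPolynomial.C a}
  have hker : ∀ p ∈ I, coordsPoly a p = 0 := by
    intro p hp
    obtain ⟨q, rfl⟩ := Ideal.mem_span_singleton'.mp hp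
    rw [prod_X_two]
    induction q using MvPolynomial.induction_on' with
    | add q₁ q₂ h₁ h₂ =>
      rw [add_mul, map_add, h₁ (Ideal.mul_mem_left _ _ (Ideal.subset_span (by rw [prod_X_two]; rfl))),
        h₂ (Ideal.mul_mem_left _ _ (Ideal.subset_span (by rw [prod_X_two]; rfl))), add_zero]
    | monomial m r =>
      have h1 : MvPolynomial.monomial m r * (MvPolynomial.X 0 * MvPolynomial.X 1 - MvPolynomial.C a)
          = MvPolynomial.monomial (m + (Finsupp.single 0 1 + Finsupp.single 1 1)) r
            - MvPolynomial.monomial m (r * a) := by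
        rw [mul_sub, MvPolynomial.X, MvPolynomial.X, MvPolynomial.monomial_mul,
          MvPolynomial.monomial_mul, MvPolynomial.C_apply, MvPolynomial.monomial_mul]
        simp
      rw [h1, map_sub, coordsPoly_monomial, coordsPoly_monomial, sub_eq_zero]
      have h2 : (m + (Finsupp.single 0 1 + Finsupp.single 1 1) : Fin 2 →₀ ℕ) 0 = m 0 + 1 := by simp
      have h3 : (m + (Finsupp.single 0 1 + Finsupp.single 1 1) : Fin 2 →₀ ℕ) 1 = m 1 + 1 := by simp
      rw [h2, h3, Nat.add_min_add_right, pow_succ]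
      congr 1
      · push_cast; ring
      · ring
  let ψ : NodeAlgebra R a →ₗ[R] (ℤ →₀ R) :=
    (I.restrictScalars R).liftQ (coordsPoly a) (fun p hp => hker p hp)
  let χ : (ℤ →₀ R) →ₗ[R] NodeAlgebra R a := Finsupp.linearCombination R (basisElem a)
  have hχψ : χ ∘ₗ ψ = LinearMap.id := by
    refine LinearMap.ext fun p => ?_
    obtain ⟨p, rfl⟩ := Ideal.Quotient.mk_surjective p
    change χ (coordsPoly a p) = Ideal.Quotient.mk _ p
    induction p using MvPolynomial.induction_on' with
    | add q₁ q₂ h₁ h₂ => rw [map_add, map_add, h₁, h₂, map_add]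
    | monomial m r =>
      rw [coordsPoly_monomial]
      simp only [χ, Finsupp.linearCombination_single]
      have h1 : Ideal.Quotient.mk I (MvPolynomial.monomial m r) =
          algebraMap R (NodeAlgebra R a) r * (x a ^ m 0 * y a ^ m 1) := by
        have : MvPolynomial.monomial m r =
            MvPolynomial.C r * (MvPolynomial.X 0 ^ m 0 * MvPolynomial.X 1 ^ m 1) := by
          rw [MvPolynomial.monomial_eq, Finsupp.prod_fintype _ _ (by simp), Fin.prod_univ_two]
        rw [this, map_mul, map_mul, map_pow, map_pow]
        rfl
      refine Eq.trans ?_ h1.symm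
      rw [Algebra.smul_def (A := NodeAlgebra R a), map_mul, map_pow, mul_assoc, ← x_mul_y, mul_pow]
      congr 1
      rw [basisElem, mul_mul_mul_comm, ← pow_add, ← pow_add]
      congr 2 <;> omega
  exact Module.Flat.of_retract ψ χ hχψ

end NodeAlgebra

end NodeAlgebra

/-! ### Localization of node algebras; the locus `x ≠ 0`; the case `q = 1`. -/

section NodeAlgebraLocalization

namespace NodeAlgebra

variable {R R' : Type u} [CommRing R] [CommRing R'] [Algebra R R'] {a : R} {a' c : R'}

/-- Base change of node algebras along `R → R'`, with the first coordinate rescaled by `c`. -/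
def baseChange (h : algebraMap R R' a = c * a') : NodeAlgebra R a →+* NodeAlgebra R' a' :=
  lift ((algebraMap R' _).comp (algebraMap R R')) (algebraMap R' _ c * x a') (y a') (by
    rw [mul_assoc, x_mul_y, RingHom.comp_apply, h, map_mul])

/-- An abstract localization has the same universal property, and the unit `c` is absorbed by
rescaling the first coordinate. With `c = 1` this passes to local rings of the base; general `c`
changes the discriminant by a unit. -/
lemma isLocalization_baseChange (M : Submonoid R) [IsLocalization M R'] (hc : IsUnit c)
    (h : algebraMap R R' a = c * a') :
    letI := (baseChange h).toAlgebra
    IsLocalization (M.map (algebraMap R (NodeAlgebra R a))) (NodeAlgebra R' a') := by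
  let := (baseChange h).toAlgebra
  let N := M.map (algebraMap R (NodeAlgebra R a))
  obtain ⟨L, _, _, _⟩ : ∃ (L : Type u) (_ : CommRing L) (_ : Algebra (NodeAlgebra R a) L),
      IsLocalization N L := ⟨Localization N, inferInstance, inferInstance, inferInstance⟩
  have hunits : ∀ r : M, IsUnit
      ((algebraMap (NodeAlgebra R a) L).comp (algebraMap R (NodeAlgebra R a)) r) := fun r =>
    IsLocalization.map_units L (⟨_, Submonoid.mem_map_of_mem _ r.2⟩ : N)
  let φ : R' →+* L := IsLocalization.lift (M := M) hunits
  have hφ : φ.comp (algebraMap R R') =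
      (algebraMap (NodeAlgebra R a) L).comp (algebraMap R (NodeAlgebra R a)) :=
    IsLocalization.lift_comp _
  have hφ' (r : R) : φ (algebraMap R R' r) =
      algebraMap (NodeAlgebra R a) L (algebraMap R (NodeAlgebra R a) r) := RingHom.congr_fun hφ r
  obtain ⟨d, hd⟩ := hc.exists_left_inv
  let θ : NodeAlgebra R' a' →+* L :=
    lift φ (φ d * algebraMap (NodeAlgebra R a) L (x a)) (algebraMap (NodeAlgebra R a) L (y a)) (by
      rw [mul_assoc, ← map_mul, x_mul_y, ← hφ', h, ← map_mul, ← mul_assoc, hd, one_mul])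
  have hunit : ∀ n : N, IsUnit (baseChange h n) := by
    rintro ⟨_, r, hr, rfl⟩
    have : baseChange h (algebraMap R _ r) = algebraMap R' _ (algebraMap R R' r) := by
      simp [baseChange]
    change IsUnit (baseChange h (algebraMap R _ r))
    rw [this]
    exact (IsLocalization.map_units R' (⟨r, hr⟩ : M)).map _
  let ψ : L →+* NodeAlgebra R' a' := IsLocalization.lift (M := N) (g := baseChange h) hunit
  have hψ : ∀ p, ψ (algebraMap _ L p) = baseChange h p := fun p => IsLocalization.lift_eq _ p
  have hψφ : ψ.comp φ = algebraMap R' _ := by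
    refine IsLocalization.ringHom_ext M ?_
    rw [RingHom.comp_assoc, hφ]
    ext r
    simp [hψ, baseChange]
  have h1 : ψ.comp θ = RingHom.id _ := by
    refine hom_ext ?_ ?_ ?_
    · ext r
      have := RingHom.congr_fun hψφ r
      simpa [θ] using this
    · have h2 : ψ (φ d) = algebraMap R' _ d := RingHom.congr_fun hψφ d
      simp only [RingHom.comp_apply, θ, lift_x, map_mul, hψ, h2, RingHom.id_apply]
      simp only [baseChange, lift_x]
      rw [← mul_assoc, ← map_mul, hd, map_one, one_mul]
    · simp [θ, hψ, baseChange]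
  have h2 : θ.comp ψ = RingHom.id _ := by
    refine IsLocalization.ringHom_ext N ?_
    refine hom_ext ?_ ?_ ?_
    · ext r
      simp [hψ, baseChange, θ, hφ']
    · simp only [RingHom.comp_apply, hψ, baseChange, lift_x, map_mul, lift_algebraMap, θ,
        RingHom.id_apply]
      rw [← mul_assoc, ← map_mul, mul_comm c, hd, map_one, one_mul]
    · simp [hψ, baseChange, θ]
  let e : L ≃ₐ[NodeAlgebra R a] NodeAlgebra R' a' :=
    AlgEquiv.ofRingEquiv (f := RingEquiv.ofRingHom ψ θ h1 h2) (fun p => hψ p)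
  exact IsLocalization.isLocalization_of_algEquiv N e

/-- Where `x` is invertible, `y = a / x` is redundant and the ring is `R[x, x⁻¹]`, a localization of
the polynomial ring. -/
lemma exists_etale_away_x (a : R) :
    ∃ ψ : Polynomial R →+* Localization.Away (x a), ψ.Etale ∧
      ψ.comp Polynomial.C = (algebraMap _ _).comp (algebraMap R (NodeAlgebra R a)) ∧
      ψ Polynomial.X = algebraMap _ _ (x a) := by
  let L := Localization.Away (x a)
  let P := Localization.Away (Polynomial.X : Polynomial R)
  have hX : IsUnit (algebraMap (Polynomial R) P Polynomial.X) :=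
    IsLocalization.Away.algebraMap_isUnit _
  have hx : IsUnit (algebraMap (NodeAlgebra R a) L (x a)) :=
    IsLocalization.Away.algebraMap_isUnit _
  obtain ⟨w, hw⟩ := hX.exists_right_inv
  let f : P →+* L := IsLocalization.Away.lift (Polynomial.X : Polynomial R)
    (g := Polynomial.eval₂RingHom (algebraMap R L) (algebraMap _ L (x a))) (by simpa using hx)
  let g₀ : NodeAlgebra R a →+* P :=
    lift (algebraMap R P) (algebraMap _ P Polynomial.X) (w * algebraMap R P a) (by
      rw [← mul_assoc, hw, one_mul])
  let g : L →+* P := IsLocalization.Away.lift (x a) (g := g₀) (by simpa [g₀] using hX)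
  have hf : ∀ p, f (algebraMap _ P p) =
    Polynomial.eval₂RingHom (algebraMap R L) (algebraMap _ L (x a)) p :=
      fun p => IsLocalization.Away.lift_eq _ _ p
  have hg : ∀ p, g (algebraMap _ L p) = g₀ p := fun p => IsLocalization.Away.lift_eq _ _ p
  have hfR : ∀ r, f (algebraMap R P r) = algebraMap R L r := fun r => by
    rw [IsScalarTower.algebraMap_apply R (Polynomial R) P, hf]
    simp
  have h1 : f.comp g = RingHom.id _ := by
    refine IsLocalization.ringHom_ext (Submonoid.powers (x a)) (hom_ext ?_ ?_ ?_)
    · ext r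
      simp only [RingHom.comp_apply, hg, g₀, lift_algebraMap, hfR, RingHom.id_apply]
      rfl
    · simp [hg, g₀, hf]
    · simp only [RingHom.comp_apply, hg, g₀, lift_y, map_mul, hfR, RingHom.id_apply]
      have h3 := congr(f $hw)
      rw [map_mul, hf, map_one] at h3
      simp only [Polynomial.coe_eval₂RingHom, Polynomial.eval₂_X] at h3
      rw [IsScalarTower.algebraMap_apply R (NodeAlgebra R a) L, ← x_mul_y, map_mul, ← mul_assoc,
        mul_comm (f w), h3, one_mul]
  have h2 : g.comp f = RingHom.id _ := by
    refine IsLocalization.ringHom_ext (Submonoid.powers (Polynomial.X : Polynomial R)) ?_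
    refine Polynomial.ringHom_ext (fun r => ?_) ?_
    · simp only [RingHom.comp_apply, hf, RingHom.id_apply]
      simp only [Polynomial.coe_eval₂RingHom, Polynomial.eval₂_C]
      rw [IsScalarTower.algebraMap_apply R (NodeAlgebra R a) L, hg]
      simp only [g₀, lift_algebraMap]
      rw [IsScalarTower.algebraMap_apply R (Polynomial R) P]
      rfl
    · simp [hf, hg, g₀]
  refine ⟨f.comp (algebraMap _ _), ?_, ?_, ?_⟩
  · have hP : (algebraMap (Polynomial R) P).Etale := RingHom.etale_algebraMap.mpr
      (Algebra.Etale.of_isLocalizationAway (Polynomial.X : Polynomial R))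
    exact RingHom.Etale.stableUnderComposition _ _ hP
      (RingHom.Etale.of_bijective (RingEquiv.ofRingHom f g h1 h2).bijective)
  · ext r
    simp only [RingHom.comp_apply, hf]
    simp
    rfl
  · simp [hf]
    rfl

end NodeAlgebra

/-- The standard algebra with `q = 1` is a polynomial ring in one variable. -/
lemma StandardAlgebra.nonempty_equiv_polynomial (R : Type u) [CommRing R] (a : R) :
    Nonempty (Polynomial R ≃ₐ[R] StandardAlgebra R 1 1 a) := by
  have hprod : (∏ i : Fin (1 + 1) with i.val < 1, (MvPolynomial.X i : MvPolynomial (Fin (1 + 1)) R))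
      = MvPolynomial.X 0 := by
    rw [Finset.prod_filter, Fin.prod_univ_two]
    simp
  let f : Polynomial R →ₐ[R] StandardAlgebra R 1 1 a :=
    Polynomial.aeval (Ideal.Quotient.mk _ (MvPolynomial.X 1))
  let g : StandardAlgebra R 1 1 a →ₐ[R] Polynomial R :=
    Ideal.Quotient.liftₐ _ (MvPolynomial.aeval ![Polynomial.C a, Polynomial.X]) (by
      intro p hp
      rw [← AlgHom.coe_toRingHom, ← RingHom.mem_ker]
      refine (Ideal.span_le (I := RingHom.ker _)).mpr ?_ hp
      rintro _ rfl
      rw [SetLike.mem_coe, RingHom.mem_ker, hprod]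
      simp)
  refine ⟨AlgEquiv.ofAlgHom f g ?_ ?_⟩
  · refine Ideal.Quotient.algHom_ext _ (MvPolynomial.algHom_ext fun i => ?_)
    fin_cases i
    · have : f (Polynomial.C a) = algebraMap R _ a := by
        rw [← Polynomial.algebraMap_eq]; exact f.commutes a
      simp only [Fin.zero_eta, AlgHom.comp_apply, AlgHom.id_apply, g]
      change f (MvPolynomial.aeval ![Polynomial.C a, Polynomial.X] (MvPolynomial.X 0)) =
        Ideal.Quotient.mk _ (MvPolynomial.X 0)
      rw [MvPolynomial.aeval_X]
      refine this.trans (Eq.symm ?_)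
      refine (Ideal.Quotient.mk_eq_mk_iff_sub_mem (MvPolynomial.X 0)
        (MvPolynomial.C a)).mpr (Ideal.subset_span ?_)
      rw [hprod]
      rfl
    · change f (MvPolynomial.aeval ![Polynomial.C a, Polynomial.X] (MvPolynomial.X 1)) =
        Ideal.Quotient.mk _ (MvPolynomial.X 1)
      rw [MvPolynomial.aeval_X]
      simp [f]
  · refine Polynomial.algHom_ext ?_
    simp only [AlgHom.comp_apply, AlgHom.id_apply, f, Polynomial.aeval_X]
    change MvPolynomial.aeval ![Polynomial.C a, Polynomial.X] (MvPolynomial.X 1) = _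
    rw [MvPolynomial.aeval_X]
    rfl

end NodeAlgebraLocalization

/-! ### Local rings of étale algebras. -/

section EtaleLocal

open IsLocalRing

/-- Local structure of an étale algebra: at a prime of `B` it is formally étale and flat over `A`,
and the maximal ideal is generated by elements of `A`. -/
lemma etale_localization {A B O : Type u} [CommRing A] [CommRing B] [CommRing O] [IsLocalRing O]
    [Algebra A B] [Algebra B O] [Algebra A O] [IsScalarTower A B O] [Algebra.Etale A B]
    (p : Ideal B) [p.IsPrime] [IsLocalization.AtPrime O p] :
    Algebra.FormallyEtale A O ∧ Module.Flat A O ∧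
      ((maximalIdeal O).comap (algebraMap A O)).map (algebraMap A O) = maximalIdeal O := by
  have h1 : Algebra.FormallyEtale B O := Algebra.FormallyEtale.of_isLocalization p.primeCompl
  have h2 : Algebra.FormallyEtale A O := Algebra.FormallyEtale.comp A B O
  have h3 : Module.Flat A B := inferInstance
  have h4 : Module.Flat B O := IsLocalization.flat O p.primeCompl
  have h5 : Module.Flat A O := Module.Flat.trans A B O
  refine ⟨h2, h5, ?_⟩
  let q := (maximalIdeal O).comap (algebraMap A O)
  have hq : q.IsPrime := Ideal.IsPrime.comap _
  -- Localizing the base at the contracted prime makes the map local, formally unramified and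
  -- essentially of finite type; such a map carries the maximal ideal onto generators of the maximal
  -- ideal.
  let L := Localization.AtPrime q
  let f : L →+* O := IsLocalization.lift (M := q.primeCompl) (g := algebraMap A O) (by
    rintro ⟨r, hr⟩
    exact not_not.mp hr)
  let := f.toAlgebra
  have h6 : IsScalarTower A L O := IsScalarTower.of_algebraMap_eq fun r =>
    (IsLocalization.lift_eq _ r).symm
  have h7 : Algebra.FormallyEtale L O := Algebra.FormallyEtale.localization_base q.primeCompl
  have h8 : Algebra.EssFiniteType B O := Algebra.EssFiniteType.of_isLocalization O p.primeCompl
  have h9 : Algebra.EssFiniteType A O := Algebra.EssFiniteType.comp A B O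
  have h10 : Algebra.EssFiniteType L O := Algebra.EssFiniteType.of_comp A L O
  have h11 : IsLocalHom (algebraMap L O) := by
    refine ((local_hom_TFAE (algebraMap L O)).out 0 2 rfl rfl).mpr ?_
    rw [← Localization.AtPrime.map_eq_maximalIdeal, Ideal.map_map, ← IsScalarTower.algebraMap_eq]
    exact Ideal.map_comap_le
  have h12 : q.map (algebraMap A O) = maximalIdeal O := by
    rw [← Algebra.FormallyUnramified.map_maximalIdeal (R := L) (S := O),
      ← Localization.AtPrime.map_eq_maximalIdeal, Ideal.map_map, ← IsScalarTower.algebraMap_eq]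
  exact h12

end EtaleLocal

/-! ### Nodes as local rings, and consequences of flatness over the node algebra. -/

section LocalNodes

open IsLocalRing NodeAlgebra

/-- The equational criterion of flatness in unbundled form. It transports computations in the node
algebra to the local ring of a node. -/
lemma flat_exists_of_sum_eq_zero {A O : Type u} [CommRing A] [CommRing O] {f : A →+* O}
    (hf : f.Flat) {ι : Type} [Fintype ι] {c : ι → A} {x : ι → O} (h : ∑ i, f (c i) * x i = 0) :
    ∃ (k : ℕ) (b : ι → Fin k → A) (z : Fin k → O), (∀ i, x i = ∑ j, f (b i j) * z j) ∧
      ∀ j, ∑ i, c i * b i j = 0 := by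
  algebraize [f]
  obtain ⟨k, b, z, hz, hb⟩ := Module.Flat.isTrivialRelation_of_sum_smul_eq_zero (R := A) (M := O)
    (f := c) (x := x) (by simpa [Algebra.smul_def, RingHom.algebraMap_toAlgebra] using h)
  exact ⟨k, b, z, fun i => by simpa [Algebra.smul_def, RingHom.algebraMap_toAlgebra] using hz i, hb⟩

lemma flat_of_forall_exists {A O : Type u} [CommRing A] [CommRing O] {f : A →+* O}
    (H : ∀ (n : ℕ) (c : Fin n → A) (x : Fin n → O), ∑ i, f (c i) * x i = 0 →
      ∃ (k : ℕ) (b : Fin n → Fin k → A) (z : Fin k → O), (∀ i, x i = ∑ j, f (b i j) * z j) ∧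
        ∀ j, ∑ i, c i * b i j = 0) : f.Flat := by
  algebraize [f]
  refine (Module.Flat.of_forall_isTrivialRelation fun {l} {c} {x} h => ?_ : Module.Flat A O)
  obtain ⟨k, b, z, hz, hb⟩ := H l c x (by simpa [Algebra.smul_def, RingHom.algebraMap_toAlgebra] using h)
  exact ⟨k, b, z, fun i => by simpa [Algebra.smul_def, RingHom.algebraMap_toAlgebra] using hz i, hb⟩

/-- Flatness is preserved by passing to quotients of base and total space. -/
lemma flat_quotient {A A' O : Type u} [CommRing A] [CommRing A'] [CommRing O] {f : A →+* O}
    (hf : f.Flat) {π : A →+* A'} (hπ : Function.Surjective π) {J : Ideal O}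
    (hJ : J = (RingHom.ker π).map f) {g : A' →+* O ⧸ J}
    (hg : g.comp π = (Ideal.Quotient.mk J).comp f) : g.Flat := by
  have hg' (a : A) : g (π a) = Ideal.Quotient.mk J (f a) := RingHom.congr_fun hg a
  refine flat_of_forall_exists fun l c x h => ?_
  choose c' hc' using fun i => hπ (c i)
  choose x' hx' using fun i => Ideal.Quotient.mk_surjective (x i)
  have h1 : ∑ i, f (c' i) * x' i ∈ (RingHom.ker π).map f := by
    rw [← hJ, ← Ideal.Quotient.eq_zero_iff_mem, map_sum, ← h]
    refine Finset.sum_congr rfl fun i _ => ?_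
    rw [map_mul, ← hg', hc', hx']
  rw [Ideal.map] at h1
  obtain ⟨n, e, s, hs⟩ := (Submodule.mem_span_set').mp h1
  choose b hb hb' using fun i => (s i).2
  -- A relation modulo `J` becomes an honest relation in `O` once the combination of kernel elements
  -- is moved to the left; the added coefficients disappear again under `π`.
  have h2 : ∑ i : Fin l ⊕ Fin n, f (Sum.elim c' (fun k => - b k) i) * (Sum.elim x' e i) = 0 := by
    rw [Fintype.sum_sum_type]
    simp only [Sum.elim_inl, Sum.elim_inr, map_neg, neg_mul, Finset.sum_neg_distrib]
    rw [← sub_eq_add_neg, sub_eq_zero, ← hs]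
    refine Finset.sum_congr rfl fun i _ => ?_
    rw [hb', smul_eq_mul, mul_comm]
  obtain ⟨k, a, y, hy, ha⟩ := flat_exists_of_sum_eq_zero hf h2
  refine ⟨k, fun i j => π (a (Sum.inl i) j), fun j => Ideal.Quotient.mk J (y j), fun i => ?_,
    fun j => ?_⟩
  · rw [← hx', show x' i = _ from hy (Sum.inl i), map_sum]
    refine Finset.sum_congr rfl fun j _ => ?_
    rw [map_mul, hg']
  · have := congr(π $(ha j))
    rw [Fintype.sum_sum_type, map_add, map_sum, map_sum, map_zero] at this
    have h3 : ∑ i, π (Sum.elim c' (fun k => - b k) (Sum.inr i) * a (Sum.inr i) j) = 0 :=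
      Finset.sum_eq_zero fun i _ => by
        rw [Sum.elim_inr, map_mul, map_neg, (RingHom.mem_ker).mp (hb i), neg_zero, zero_mul]
    rw [h3, add_zero] at this
    rw [← this]
    refine Finset.sum_congr rfl fun i _ => ?_
    rw [map_mul, Sum.elim_inl, hc']

lemma formallyEtale_of_ringEquiv {A B : Type u} [CommRing A] [CommRing B] (e : A ≃+* B) :
    (e : A →+* B).FormallyEtale := by
  algebraize [(e : A →+* B)]
  exact Algebra.FormallyEtale.of_equiv
    (AlgEquiv.ofRingEquiv (f := e) (fun r => rfl) : A ≃ₐ[A] B)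

lemma exists_ringHom_lift {A O P Q : Type u} [CommRing A] [CommRing O] [CommRing P] [CommRing Q]
    {f : A →+* O} (hf : f.FormallySmooth) {α : O →+* Q} {β : P →+* Q} {u : A →+* P}
    (hβ : Function.Surjective β) (hnil : IsNilpotent (RingHom.ker β))
    (h : β.comp u = α.comp f) : ∃ g : O →+* P, β.comp g = α ∧ g.comp f = u := by
  algebraize [f, u, α.comp f]
  let α' : O →ₐ[A] Q := ⟨α, fun _ => rfl⟩
  let β' : P →ₐ[A] Q := ⟨β, fun r => RingHom.congr_fun h r⟩
  let g := Algebra.FormallySmooth.liftOfSurjective α' β' hβ hnil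
  refine ⟨g, ?_, ?_⟩
  · ext o
    exact Algebra.FormallySmooth.liftOfSurjective_apply α' β' hβ hnil o
  · exact g.comp_algebraMap

/-- The ring `k[e₁, e₂]` with `e₁² = e₂² = 0`. -/
lemma exists_two_dual_numbers (k : Type u) [Field k] :
    ∃ (P : Type u) (_ : CommRing P) (ι : k →+* P) (π : P →+* k) (e₁ e₂ : P),
      π.comp ι = RingHom.id k ∧ e₁ * e₁ = 0 ∧ e₂ * e₂ = 0 ∧ e₁ * e₂ ≠ 0 ∧
      RingHom.ker π = Ideal.span {e₁, e₂} := by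
  let e₁ : DualNumber (DualNumber k) := TrivSqZeroExt.inl (TrivSqZeroExt.inr 1)
  let e₂ : DualNumber (DualNumber k) := TrivSqZeroExt.inr 1
  refine ⟨DualNumber (DualNumber k), inferInstance,
    (TrivSqZeroExt.inlHom (DualNumber k) (DualNumber k)).comp (TrivSqZeroExt.inlHom k k),
    (TrivSqZeroExt.fstHom k k k).toRingHom.comp
    (TrivSqZeroExt.fstHom (DualNumber k) (DualNumber k) (DualNumber k)).toRingHom,
    e₁, e₂, ?_, ?_, ?_, ?_, ?_⟩
  · ext; rfl
  · change TrivSqZeroExt.inl (TrivSqZeroExt.inr 1) * TrivSqZeroExt.inl (TrivSqZeroExt.inr 1) = _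
    rw [← TrivSqZeroExt.inl_mul, TrivSqZeroExt.inr_mul_inr, TrivSqZeroExt.inl_zero]
  · exact TrivSqZeroExt.inr_mul_inr _ _ _
  · intro h
    have h1 := congr(TrivSqZeroExt.snd (TrivSqZeroExt.snd $h))
    simp [e₁, e₂, TrivSqZeroExt.snd_mul] at h1
  · refine le_antisymm (fun p hp => ?_) (Ideal.span_le.mpr ?_)
    · have hp' : p.fst.fst = 0 := hp
      rw [Ideal.mem_span_pair]
      refine ⟨TrivSqZeroExt.inl (TrivSqZeroExt.inl p.fst.snd), TrivSqZeroExt.inl p.snd, ?_⟩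
      refine TrivSqZeroExt.ext (TrivSqZeroExt.ext ?_ ?_) (TrivSqZeroExt.ext ?_ ?_) <;>
        simp [e₁, e₂, hp', TrivSqZeroExt.snd_mul]
    · rintro _ (rfl | rfl)
      · change (TrivSqZeroExt.fst (TrivSqZeroExt.fst e₁)) = 0
        simp [e₁]
      · change (TrivSqZeroExt.fst (TrivSqZeroExt.fst e₂)) = 0
        simp [e₂]

lemma formallySmooth_of_formallyEtale {A B : Type u} [CommRing A] [CommRing B] {f : A →+* B}
    (hf : f.FormallyEtale) : f.FormallySmooth := by
  algebraize [f]
  rw [RingHom.FormallySmooth]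
  infer_instance

variable {R O : Type u} [CommRing R] [IsLocalRing R] [CommRing O] [IsLocalRing O]

/-- The local ring `O` over the local ring `R` is a node `s t = a`. -/
structure IsNode (φ : R →+* O) (a : R) (s t : O) : Prop where
  mul : s * t = φ a
  s_mem : s ∈ maximalIdeal O
  t_mem : t ∈ maximalIdeal O
  formallyEtale : (lift φ s t mul).FormallyEtale
  flat : (lift φ s t mul).Flat
  max : maximalIdeal O = (maximalIdeal R).map φ ⊔ Ideal.span {s, t}

namespace IsNode

variable {φ : R →+* O} {a : R} {s t : O}

lemma symm (h : IsNode φ a s t) : IsNode φ a t s := by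
  have h1 : lift φ t s (by rw [mul_comm, h.mul]) =
      (lift φ s t h.mul).comp (swap a : NodeAlgebra R a →+* NodeAlgebra R a) := by
    refine hom_ext ?_ ?_ ?_
    · ext r; simp
    · simp
    · simp
  refine ⟨by rw [mul_comm, h.mul], h.t_mem, h.s_mem, ?_, ?_, ?_⟩
  · rw [h1]
    exact (formallyEtale_of_ringEquiv (swap a)).comp h.formallyEtale
  · rw [h1]
    exact (RingHom.Flat.of_bijective (swap a).bijective).comp h.flat
  · rw [h.max, Set.pair_comm]

lemma flat_base (h : IsNode φ a s t) : φ.Flat := by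
  have : (algebraMap R (NodeAlgebra R a)).Flat :=
    RingHom.flat_algebraMap_iff.mpr (NodeAlgebra.flat a)
  have := this.comp h.flat
  rwa [lift_comp_algebraMap] at this

lemma isLocalHom (h : IsNode φ a s t) : IsLocalHom φ := by
  refine ((local_hom_TFAE φ).out 0 2 rfl rfl).mpr ?_
  rw [h.max]
  exact le_sup_left

/-- `t` is a nonzerodivisor modulo `s`. -/
lemma mem_span_s (h : IsNode φ a s t) {p q : O} (hpq : p * t + q * s = 0) : p ∈ Ideal.span {s} := by
  -- A relation with coefficients `y`, `x` from the node algebra: flatness reduces the claim to the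
  -- regularity of `y` modulo `x` there.
  have h1 : ∑ i : Fin 2, lift φ s t h.mul (![y a, x a] i) * (![p, q] i) = 0 := by
    rw [Fin.sum_univ_two]
    simpa [mul_comm] using hpq
  obtain ⟨k, b, z, hz, hb⟩ := flat_exists_of_sum_eq_zero h.flat h1
  have h2 : p = ∑ j, lift φ s t h.mul (b 0 j) * z j := hz 0
  rw [h2]
  refine Ideal.sum_mem _ fun j _ => ?_
  refine Ideal.mul_mem_right _ _ ?_
  have h3 := hb j
  rw [Fin.sum_univ_two] at h3
  have h4 : b 0 j ∈ Ideal.span {x a} :=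
    mem_span_x_of_mul_y_mem (q := b 1 j) (by simpa [mul_comm] using h3)
  have h5 := Ideal.mem_map_of_mem (lift φ s t h.mul) h4
  rwa [Ideal.map_span, Set.image_singleton, lift_x] at h5

lemma exists_isUnit_of_one_eq_sum {k : ℕ} {b z : Fin k → O} (h : 1 = ∑ j, b j * z j) :
    ∃ j, IsUnit (b j) := by
  by_contra! hcon
  refine (Ideal.ne_top_iff_one (maximalIdeal O)).mp (maximalIdeal.isMaximal O).ne_top ?_
  rw [h]
  exact Ideal.sum_mem _ fun j _ => Ideal.mul_mem_right _ _ (hcon j)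

lemma map_span_le (h : IsNode φ a s t) :
    (Ideal.span {x a, y a}).map (lift φ s t h.mul) ≤ maximalIdeal O := by
  rw [Ideal.map_span, Set.image_pair, lift_x, lift_y, Ideal.span_le]
  rintro _ (rfl | rfl)
  exacts [h.s_mem, h.t_mem]

/-- The ideal `(s, t, τ)` contracts to `(a, τ)` in the base. -/
lemma mem_span_pair (h : IsNode φ a s t) {r τ : R} (hr : φ r ∈ Ideal.span {s, t, φ τ}) :
    r ∈ Ideal.span {a, τ} := by
  have hloc := h.isLocalHom
  obtain ⟨p, w', hw', hp⟩ := Ideal.mem_span_insert.mp hr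
  obtain ⟨q, w, rfl⟩ := Ideal.mem_span_pair.mp hw'
  -- Membership is read as a relation with coefficients `r, x, y, τ` and solution `1, -p, -q, -w`.
  -- After flatness resolves it, the entry `1` forces one of the `b 0 j` to become a unit in `O`.
  have h1 : ∑ i : Fin 4, lift φ s t h.mul
      (![algebraMap R _ r, x a, y a, algebraMap R _ τ] i) * (![1, -p, -q, -w] i) = 0 := by
    rw [Fin.sum_univ_four]
    simp [hp]
    ring
  obtain ⟨k, b, z, hz, hb⟩ := flat_exists_of_sum_eq_zero h.flat h1
  have h2 : 1 = ∑ j, lift φ s t h.mul (b 0 j) * z j := hz 0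
  obtain ⟨j, hj⟩ := exists_isUnit_of_one_eq_sum h2
  obtain ⟨ρ, hρ⟩ := exists_sub_algebraMap_mem (b 0 j)
  have hρu : IsUnit ρ := by
    refine isUnit_of_map_unit φ _ (not_not.mp fun hn => ?_)
    have h3 := h.map_span_le (Ideal.mem_map_of_mem (lift φ s t h.mul) hρ)
    rw [map_sub, lift_algebraMap] at h3
    have h5 : φ ρ ∈ maximalIdeal O := hn
    have := add_mem h3 h5
    rw [sub_add_cancel] at this
    exact this hj
  -- Setting `x = y = 0` modulo `(a, τ)` leaves `r ρ = 0`, where `ρ` is the constant term of `b 0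
  -- j`, a unit because `φ` is local.
  let ev : NodeAlgebra R a →+* R ⧸ Ideal.span {a, τ} :=
    lift (Ideal.Quotient.mk (Ideal.span {a, τ})) 0 0 (by
      rw [mul_zero, eq_comm, Ideal.Quotient.eq_zero_iff_mem]
      exact Ideal.subset_span (by simp))
  have h6 : ev (b 0 j) = Ideal.Quotient.mk _ ρ := by
    have h7 := Ideal.mem_map_of_mem ev hρ
    rw [Ideal.map_span, Set.image_pair] at h7
    simp only [ev, lift_x, lift_y, map_sub, lift_algebraMap, Set.pair_eq_singleton,
      Ideal.span_singleton_zero] at h7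
    exact sub_eq_zero.mp h7
  have hτ : Ideal.Quotient.mk (Ideal.span {a, τ}) τ = 0 :=
    Ideal.Quotient.eq_zero_iff_mem.mpr (Ideal.subset_span (by simp))
  have h8 := congr(ev $(hb j))
  rw [Fin.sum_univ_four] at h8
  simp only [Matrix.cons_val_zero, Matrix.cons_val_one, map_add, map_mul,
    map_zero, h6, Matrix.cons_val] at h8
  simp only [ev, lift_x, lift_y, lift_algebraMap, zero_mul, add_zero, hτ, ← map_mul] at h8
  rw [Ideal.Quotient.eq_zero_iff_mem] at h8
  exact (Ideal.mul_unit_mem_iff_mem _ hρu).mp h8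

/-- The ideal `(s, t)` contracts to `(a)` in the base. -/
lemma mem_span_a (h : IsNode φ a s t) {r : R} (hr : φ r ∈ Ideal.span {s, t}) :
    r ∈ Ideal.span {a} := by
  have := h.mem_span_pair (r := r) (τ := 0) (Ideal.span_mono (by
    rintro _ (rfl | rfl) <;> simp) hr)
  rwa [Ideal.span_pair_zero] at this

/-- Over a component `τ` of the discriminant, the two branches are different. -/
lemma t_notMem (h : IsNode φ a s t) {τ : R} (hτ : τ ∣ a) (hm : τ ∈ maximalIdeal R) :
    t ∉ Ideal.span {s, φ τ} := by
  intro ht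
  have hloc := h.isLocalHom
  obtain ⟨p, q, hpq⟩ := Ideal.mem_span_pair.mp ht
  have h1 : ∑ i : Fin 3,
      lift φ s t h.mul (![y a, x a, algebraMap R _ τ] i) * (![1, -p, -q] i) = 0 := by
    rw [Fin.sum_univ_three]
    simp only [Matrix.cons_val_zero, Matrix.cons_val_one, Matrix.cons_val, lift_x, lift_y,
      lift_algebraMap]
    linear_combination - hpq
  obtain ⟨k, b, z, hz, hb⟩ := flat_exists_of_sum_eq_zero h.flat h1
  have h2 : 1 = ∑ j, lift φ s t h.mul (b 0 j) * z j := hz 0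
  obtain ⟨j, hj⟩ := exists_isUnit_of_one_eq_sum h2
  -- Modulo `x` and `τ` the relation says that the variable kills `b 0 j`. So `b 0 j` lies in `(x,
  -- τ)` and cannot become a unit.
  have h8 := congr(evalX τ hτ $(hb j))
  rw [Fin.sum_univ_three] at h8
  have hτ0 : Ideal.Quotient.mk (Ideal.span {τ}) τ = 0 :=
    Ideal.Quotient.eq_zero_iff_mem.mpr (Ideal.mem_span_singleton_self _)
  simp only [Matrix.cons_val_zero, Matrix.cons_val_one, map_add, map_mul,
    map_zero, Matrix.cons_val] at h8
  simp only [evalX, lift_x, lift_y, lift_algebraMap, zero_mul, add_zero, RingHom.comp_apply, hτ0,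
    map_zero] at h8
  have h9 : b 0 j ∈ RingHom.ker (evalX τ hτ) := by
    rw [RingHom.mem_ker]
    ext n
    have := congr(Polynomial.coeff $h8 (n + 1))
    rwa [Polynomial.coeff_X_mul] at this
  rw [ker_evalX] at h9
  have h10 := Ideal.mem_map_of_mem (lift φ s t h.mul) h9
  rw [Ideal.map_span, Set.image_pair, lift_x, lift_algebraMap] at h10
  refine (?_ : Ideal.span {s, φ τ} ≤ maximalIdeal O) h10 hj
  rw [Ideal.span_le]
  rintro _ (rfl | rfl)
  exacts [h.s_mem, fun hu => hm (isUnit_of_map_unit φ _ hu)]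

/-- A node is not formally smooth over the base. -/
lemma not_formallySmooth (h : IsNode φ a s t) (hφ : φ.FormallySmooth) : False := by
  obtain ⟨P, _, ι, π, e₁, e₂, hπι, he₁, he₂, hne, hker⟩ := exists_two_dual_numbers (ResidueField O)
  have hπι' (c) : π (ι c) = c := RingHom.congr_fun hπι c
  have hπ₁ : π e₁ = 0 := by rw [← RingHom.mem_ker, hker]; exact Ideal.subset_span (by simp)
  have hπ₂ : π e₂ = 0 := by rw [← RingHom.mem_ker, hker]; exact Ideal.subset_span (by simp)
  let j : R →+* P := ι.comp ((residue O).comp φ)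
  have hja : j a = 0 := by
    have h1 : residue O (φ a) = 0 := by
      rw [residue_eq_zero_iff, ← h.mul]; exact Ideal.mul_mem_right _ _ h.s_mem
    simp [j, h1]
  -- Modulo `e₁ e₂` the rule `s ↦ e₁`, `t ↦ e₂` respects `s t = a ↦ 0`. A lift to `P` would still
  -- send `s t` to `0`, although the product of any lifts of the two classes is `e₁ e₂ ≠ 0`.
  let I : Ideal P := Ideal.span {e₁ * e₂}
  have hprod : Ideal.Quotient.mk I e₁ * Ideal.Quotient.mk I e₂ =
      ((Ideal.Quotient.mk I).comp j) a := by
    rw [← map_mul, RingHom.comp_apply, hja, map_zero, Ideal.Quotient.eq_zero_iff_mem]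
    exact Ideal.mem_span_singleton_self _
  let πQ : P ⧸ I →+* ResidueField O := Ideal.Quotient.lift I π (by
    intro p hp
    obtain ⟨c, rfl⟩ := Ideal.mem_span_singleton'.mp hp
    simp [hπ₁])
  have hπQ (p : P) : πQ (Ideal.Quotient.mk I p) = π p := Ideal.Quotient.lift_mk _ _ _
  obtain ⟨g, hg₁, hg₂⟩ := exists_ringHom_lift (formallySmooth_of_formallyEtale h.formallyEtale)
    (α := residue O) (β := πQ) (u := lift ((Ideal.Quotient.mk I).comp j) _ _ hprod)
    (fun c => ⟨Ideal.Quotient.mk I (ι c), by rw [hπQ, hπι']⟩)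
    ⟨2, by
      have h1 : RingHom.ker πQ = (Ideal.span {e₁, e₂}).map (Ideal.Quotient.mk I) := by
        rw [← hker]
        refine le_antisymm (fun p hp => ?_) (Ideal.map_le_iff_le_comap.mpr fun p hp => ?_)
        · obtain ⟨p, rfl⟩ := Ideal.Quotient.mk_surjective p
          rw [RingHom.mem_ker, hπQ] at hp
          exact Ideal.mem_map_of_mem _ hp
        · rw [Ideal.mem_comap, RingHom.mem_ker, hπQ]; exact hp
      have h2 : Ideal.span {e₁, e₂} * Ideal.span {e₁, e₂} ≤ I := by
        rw [Ideal.span_pair_mul_span_pair, he₁, he₂, mul_comm e₂ e₁]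
        refine Ideal.span_le.mpr ?_
        rintro _ (rfl | rfl | rfl | rfl)
        · exact zero_mem _
        · exact Ideal.mem_span_singleton_self _
        · exact Ideal.mem_span_singleton_self _
        · exact zero_mem _
      rw [h1, pow_two, ← Ideal.map_mul, Ideal.zero_eq_bot, Ideal.map_eq_bot_iff_le_ker,
        Ideal.mk_ker]
      exact h2⟩
    (by
      refine hom_ext ?_ ?_ ?_
      · ext r
        simp [hπQ, j, hπι']
      · simp [hπQ, hπ₁, (residue_eq_zero_iff s).mpr h.s_mem]
      · simp [hπQ, hπ₂, (residue_eq_zero_iff t).mpr h.t_mem])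
  have hgs : g s = Ideal.Quotient.mk I e₁ := by
    have := RingHom.congr_fun hg₂ (x a)
    simpa using this
  have hgt : g t = Ideal.Quotient.mk I e₂ := by
    have := RingHom.congr_fun hg₂ (y a)
    simpa using this
  have hgR (r : R) : g (φ r) = Ideal.Quotient.mk I (j r) := by
    have := RingHom.congr_fun hg₂ (algebraMap R _ r)
    simpa using this
  obtain ⟨G, hG₁, hG₂⟩ := exists_ringHom_lift hφ (α := g) (β := Ideal.Quotient.mk I) (u := j)
    Ideal.Quotient.mk_surjective
    ⟨2, by
      rw [Ideal.mk_ker, pow_two, Ideal.span_singleton_mul_span_singleton,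
        show e₁ * e₂ * (e₁ * e₂) = (e₁ * e₁) * (e₂ * e₂) by ring, he₁, zero_mul,
        Ideal.span_singleton_zero, Ideal.zero_eq_bot]⟩
    (by ext r; simp [hgR])
  have hGs : G s - e₁ ∈ I := by
    rw [← Ideal.Quotient.mk_eq_mk_iff_sub_mem, ← hgs, ← hG₁]; rfl
  have hGt : G t - e₂ ∈ I := by
    rw [← Ideal.Quotient.mk_eq_mk_iff_sub_mem, ← hgt, ← hG₁]; rfl
  obtain ⟨c, hc⟩ := Ideal.mem_span_singleton'.mp hGs
  obtain ⟨d, hd⟩ := Ideal.mem_span_singleton'.mp hGt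
  have h1 : G s * G t = 0 := by
    rw [← map_mul, h.mul, ← RingHom.comp_apply, hG₂, hja]
  refine hne ?_
  have h2 : G s = e₁ + c * (e₁ * e₂) := by rw [hc]; ring
  have h3 : G t = e₂ + d * (e₁ * e₂) := by rw [hd]; ring
  rw [h2, h3] at h1
  linear_combination h1 - (d * e₂ + c * d * e₂ * e₂) * he₁ - c * e₁ * he₂

end IsNode

end LocalNodes

/-! ### First order deformations and uniqueness of the branches of a node. -/

section NodeUniqueness

open IsLocalRing NodeAlgebra

lemma ringHom_eq_of_comp_eq {A O P Q : Type u} [CommRing A] [CommRing O] [CommRing P] [CommRing Q]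
    {f : A →+* O} (hf : f.FormallyEtale) {β : P →+* Q} (hnil : IsNilpotent (RingHom.ker β))
    {g₁ g₂ : O →+* P} (hβ : β.comp g₁ = β.comp g₂) (h : g₁.comp f = g₂.comp f) : g₁ = g₂ := by
  have h' : (g₁.comp f) = g₁.comp f := rfl
  algebraize [f, g₁.comp f]
  let G₁ : O →ₐ[A] P := ⟨g₁, fun _ => rfl⟩
  let G₂ : O →ₐ[A] P := ⟨g₂, fun r => (RingHom.congr_fun h r).symm⟩
  have : G₁ = G₂ := Algebra.FormallyUnramified.lift_unique (RingHom.ker β) hnil G₁ G₂ (by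
    ext o
    have h1 : β (g₁ o) = β (g₂ o) := RingHom.congr_fun hβ o
    change Ideal.Quotient.mk _ (g₁ o) = Ideal.Quotient.mk _ (g₂ o)
    rw [Ideal.Quotient.mk_eq_mk_iff_sub_mem, RingHom.mem_ker, map_sub, h1, sub_self])
  exact congr(AlgHom.toRingHom $this)

lemma isNilpotent_ker_fstHom (B : Type u) [CommRing B] :
    IsNilpotent (RingHom.ker (TrivSqZeroExt.fstHom B B B).toRingHom) := by
  refine ⟨2, ?_⟩
  change (RingHom.ker (TrivSqZeroExt.fstHom B B B).toRingHom : Ideal (DualNumber B)) ^ 2 = 0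
  rw [pow_two (M := Ideal (DualNumber B)), Ideal.zero_eq_bot, eq_bot_iff, Ideal.mul_le]
  intro p hp q hq
  have hp' : p.fst = 0 := hp
  have hq' : q.fst = 0 := hq
  rw [Ideal.mem_bot]
  refine TrivSqZeroExt.ext ?_ ?_ <;> simp [hp', hq']

variable {R O : Type u} [CommRing R] [IsLocalRing R] [CommRing O] [IsLocalRing O]

namespace IsNode

variable {φ : R →+* O} {a a' : R} {s t s' t' : O}

/-- First order deformations along `s`, `t` modulo an ideal containing `s` and `t`. -/
lemma exists_deformation (h : IsNode φ a s t) {B : Type u} [CommRing B] (q : O →+* B)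
    (hs : q s = 0) (ht : q t = 0) (l m : B) :
    ∃ g : O →+* DualNumber B, (∀ o, (g o).fst = q o) ∧ (∀ r, g (φ r) = TrivSqZeroExt.inl (q (φ r)))
      ∧ (g s).snd = l ∧ (g t).snd = m := by
  have hprod : (TrivSqZeroExt.inr l : DualNumber B) * TrivSqZeroExt.inr m =
      ((TrivSqZeroExt.inlHom B B).comp (q.comp φ)) a := by
    have : q (φ a) = 0 := by rw [← h.mul, map_mul, hs, zero_mul]
    rw [TrivSqZeroExt.inr_mul_inr]
    simp [this]
  obtain ⟨g, hg₁, hg₂⟩ := exists_ringHom_lift (formallySmooth_of_formallyEtale h.formallyEtale)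
    (α := q) (β := (TrivSqZeroExt.fstHom B B B).toRingHom)
    (u := lift ((TrivSqZeroExt.inlHom B B).comp (q.comp φ)) _ _ hprod)
    (fun b => ⟨TrivSqZeroExt.inl b, rfl⟩) (isNilpotent_ker_fstHom B) (by
      refine hom_ext ?_ ?_ ?_
      · ext r; simp
      · simp [hs]
      · simp [ht])
  refine ⟨g, fun o => RingHom.congr_fun hg₁ o, fun r => ?_, ?_, ?_⟩
  · simpa using RingHom.congr_fun hg₂ (algebraMap R _ r)
  · have := RingHom.congr_fun hg₂ (x a)
    rw [RingHom.comp_apply, lift_x, lift_x] at this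
    rw [this, TrivSqZeroExt.snd_inr]
  · have := RingHom.congr_fun hg₂ (y a)
    rw [RingHom.comp_apply, lift_y, lift_y] at this
    rw [this, TrivSqZeroExt.snd_inr]

/-- Formal étaleness over the node algebra leaves no freedom beyond the values on the base and on
the two coordinates. -/
lemma deformation_ext (h : IsNode φ a s t) {B : Type u} [CommRing B] {g₁ g₂ : O →+* DualNumber B}
    (hf : ∀ o, (g₁ o).fst = (g₂ o).fst) (hφ : ∀ r, g₁ (φ r) = g₂ (φ r))
    (hs : (g₁ s).snd = (g₂ s).snd) (ht : (g₁ t).snd = (g₂ t).snd) : g₁ = g₂ := by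
  refine ringHom_eq_of_comp_eq h.formallyEtale (isNilpotent_ker_fstHom B) (RingHom.ext hf) ?_
  refine hom_ext ?_ ?_ ?_
  · ext r
    all_goals simp [hφ]
  · simp only [RingHom.comp_apply, lift_x]
    exact TrivSqZeroExt.ext (hf s) hs
  · simp only [RingHom.comp_apply, lift_y]
    exact TrivSqZeroExt.ext (hf t) ht

omit [IsLocalRing O] in
lemma snd_mul_add {B : Type u} [CommRing B] (g : O →+* DualNumber B) (p q : O) :
    (g (p * q)).snd = (g p).fst * (g q).snd + (g q).fst * (g p).snd := by
  rw [map_mul, TrivSqZeroExt.snd_mul]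
  simp [mul_comm]

/-- The ideal of the nodal locus is intrinsic. Over `O / (s, t)` there are deformations moving only
`s` and only `t`. Differentiating `s' t' = a'` along them gives two homogeneous linear equations for
the classes of `s'`, `t'`, with the derivatives of `t'`, `s'` as coefficients. The determinant is a
unit, so both classes vanish. -/
lemma mem_span_pair_of_isNode (h : IsNode φ a s t) (h' : IsNode φ a' s' t') :
    s' ∈ Ideal.span {s, t} ∧ t' ∈ Ideal.span {s, t} := by
  let I : Ideal O := Ideal.span {s, t}
  let q := Ideal.Quotient.mk I
  have hs : q s = 0 := Ideal.Quotient.eq_zero_iff_mem.mpr (Ideal.subset_span (by simp))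
  have ht : q t = 0 := Ideal.Quotient.eq_zero_iff_mem.mpr (Ideal.subset_span (by simp))
  have hI : I ≤ maximalIdeal O := Ideal.span_le.mpr (by
    rintro _ (rfl | rfl)
    exacts [h.s_mem, h.t_mem])
  obtain ⟨g₁, h₁f, h₁φ, h₁s, h₁t⟩ := h.exists_deformation q hs ht 1 0
  obtain ⟨g₂, h₂f, h₂φ, h₂s, h₂t⟩ := h.exists_deformation q hs ht 0 1
  have rel (g : O →+* DualNumber (O ⧸ I)) (hgf : ∀ o, (g o).fst = q o)
      (hgφ : ∀ r, g (φ r) = TrivSqZeroExt.inl (q (φ r))) :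
      q s' * (g t').snd + q t' * (g s').snd = 0 := by
    have := snd_mul_add g s' t'
    rw [h'.mul, hgφ, TrivSqZeroExt.snd_inl, hgf, hgf] at this
    exact this.symm
  have r₁ := rel g₁ h₁f h₁φ
  have r₂ := rel g₂ h₂f h₂φ
  have : Nontrivial (O ⧸ I) := Ideal.Quotient.nontrivial_iff.mpr
    (fun h => (maximalIdeal.isMaximal O).ne_top (top_le_iff.mp (h ▸ hI)))
  have : IsLocalRing (O ⧸ I) := IsLocalRing.of_surjective' q Ideal.Quotient.mk_surjective
  have hdet : IsUnit ((g₁ s').snd * (g₂ t').snd - (g₂ s').snd * (g₁ t').snd) := by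
    by_contra hcon
    let ρ := residue (O ⧸ I)
    have hd : ρ ((g₁ s').snd) * ρ ((g₂ t').snd) - ρ ((g₂ s').snd) * ρ ((g₁ t').snd) = 0 := by
      rw [← map_mul, ← map_mul, ← map_sub, residue_eq_zero_iff]
      exact hcon
    -- A combination of the two deformations over the residue field which does not move `s'`, `t'`
    -- is trivial by uniqueness for the second node, whereas `l`, `m` are its values on `s`, `t`.
    have key (l m : ResidueField (O ⧸ I)) (e₁ : l * ρ (g₁ s').snd + m * ρ (g₂ s').snd = 0)
        (e₂ : l * ρ (g₁ t').snd + m * ρ (g₂ t').snd = 0) : l = 0 ∧ m = 0 := by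
      let G : O →+* DualNumber (ResidueField (O ⧸ I)) :=
        { toFun := fun o => TrivSqZeroExt.inl (ρ (q o)) +
            TrivSqZeroExt.inr (l * ρ (g₁ o).snd + m * ρ (g₂ o).snd)
          map_one' := by simp
          map_zero' := by simp
          map_add' := fun o o' => by
            ext
            · simp
            · simp; ring
          map_mul' := fun o o' => by
            ext
            · simp
            · rw [snd_mul_add, snd_mul_add, h₁f, h₁f, h₂f, h₂f]
              simp
              ring }
      have hG : G = (TrivSqZeroExt.inlHom _ _).comp (ρ.comp q) := by
        refine h'.deformation_ext (fun o => ?_) (fun r => ?_) ?_ ?_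
        · simp [G]
        · simp [G, h₁φ, h₂φ]
        · simpa [G] using e₁
        · simpa [G] using e₂
      constructor
      · simpa [G, h₁s, h₂s] using congr(TrivSqZeroExt.snd ($hG s))
      · simpa [G, h₁t, h₂t] using congr(TrivSqZeroExt.snd ($hG t))
    -- If the determinant vanishes, the cofactors solve the system, so all entries of the matrix are
    -- zero; then `(1, 0)` is a solution as well.
    have k₁ := key (ρ (g₂ s').snd) (- ρ (g₁ s').snd) (by ring) (by linear_combination -hd)
    have k₂ := key (ρ (g₂ t').snd) (- ρ (g₁ t').snd) (by linear_combination hd) (by ring)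
    have k₃ := key 1 0 (by rw [neg_eq_zero.mp k₁.2]; ring) (by rw [neg_eq_zero.mp k₂.2]; ring)
    exact one_ne_zero k₃.1
  constructor
  · rw [← Ideal.Quotient.eq_zero_iff_mem, ← hdet.mul_right_eq_zero]
    linear_combination (g₁ s').snd * r₂ - (g₂ s').snd * r₁
  · rw [← Ideal.Quotient.eq_zero_iff_mem, ← hdet.mul_right_eq_zero]
    linear_combination (g₂ t').snd * r₁ - (g₁ t').snd * r₂

/-- The branches of a node are unique up to units and exchange. -/
theorem associated_or (h : IsNode φ a s t) (h' : IsNode φ a' s' t') :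
    (Associated s s' ∧ Associated t t') ∨ (Associated t s' ∧ Associated s t') := by
  obtain ⟨hs', ht'⟩ := h.mem_span_pair_of_isNode h'
  obtain ⟨hs, ht⟩ := h'.mem_span_pair_of_isNode h
  obtain ⟨α, β, h1⟩ := Ideal.mem_span_pair.mp hs'
  obtain ⟨γ, δ, h2⟩ := Ideal.mem_span_pair.mp ht'
  obtain ⟨α', β', h3⟩ := Ideal.mem_span_pair.mp hs
  obtain ⟨γ', δ', h4⟩ := Ideal.mem_span_pair.mp ht
  -- Each of `s`, `t` is regular modulo the other, so a linear relation between them has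
  -- coefficients in the maximal ideal.
  have small {p q : O} (hpq : p * s + q * t = 0) :
      p ∈ maximalIdeal O ∧ q ∈ maximalIdeal O := by
    constructor
    · exact (Ideal.span_singleton_le_iff_mem _).mpr h.t_mem (h.symm.mem_span_s hpq)
    · exact (Ideal.span_singleton_le_iff_mem _).mpr h.s_mem
        (h.mem_span_s (p := q) (q := p) (by rw [add_comm]; exact hpq))
  have e1 := small (p := α' * α + β' * γ - 1) (q := α' * β + β' * δ)
    (by linear_combination h3 + α' * h1 + β' * h2)
  have e2 := small (p := γ' * α + δ' * γ) (q := γ' * β + δ' * δ - 1)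
    (by linear_combination h4 + γ' * h1 + δ' * h2)
  -- The two transition matrices multiply to the identity modulo the maximal ideal.
  have hdet : IsUnit (α * δ - β * γ) := by
    by_contra hcon
    have hcon' : α * δ - β * γ ∈ maximalIdeal O := hcon
    rw [← residue_eq_zero_iff] at hcon'
    simp only [← residue_eq_zero_iff, map_sub, map_add, map_mul, map_one] at e1 e2 hcon'
    refine one_ne_zero (α := ResidueField O) ?_
    linear_combination (residue O α' * residue O δ' - residue O β' * residue O γ') * hcon' -
      e1.1 * (residue O γ' * residue O β + residue O δ' * residue O δ) - e2.2 +
      e2.1 * (residue O α' * residue O β + residue O β' * residue O δ)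
  obtain ⟨w, hw⟩ := Ideal.mem_span_singleton'.mp (h.mem_span_a (r := a') (by
    rw [← h'.mul]; exact Ideal.mul_mem_right _ _ hs'))
  -- Expanding `s' t' = w s t` gives a vanishing binary quadratic form in `s`, `t`. Regularity,
  -- applied twice, yields `s ∣ β δ` and `t ∣ α γ`; with a unit determinant, either `α`, `δ` or `β`,
  -- `γ` are units.
  have e3 : α * γ * s * s + (α * δ + β * γ - φ w) * (s * t) + β * δ * t * t = 0 := by
    have h5 := h'.mul
    rw [← hw, map_mul, ← h.mul, ← h1, ← h2] at h5
    linear_combination h5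
  have hβδ : β * δ ∈ Ideal.span {s} := by
    obtain ⟨e, he⟩ := Ideal.mem_span_singleton'.mp (h.mem_span_s (p := β * δ * t)
      (q := α * γ * s + (α * δ + β * γ - φ w) * t) (by linear_combination e3))
    exact h.mem_span_s (q := -e) (by linear_combination -he)
  have hαγ : α * γ ∈ Ideal.span {t} := by
    obtain ⟨e, he⟩ := Ideal.mem_span_singleton'.mp (h.symm.mem_span_s (p := α * γ * s)
      (q := β * δ * t + (α * δ + β * γ - φ w) * s) (by linear_combination e3))
    exact h.symm.mem_span_s (q := -e) (by linear_combination -he)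
  have hsm := (Ideal.span_singleton_le_iff_mem _).mpr h.s_mem
  have htm := (Ideal.span_singleton_le_iff_mem _).mpr h.t_mem
  have assoc {u v c : O} (hu : IsUnit u) (hv : v ∈ maximalIdeal O) : Associated c ((u + v) * c) := by
    have : IsUnit (u + v) := by
      by_contra hcon
      have : u + v ∈ maximalIdeal O := hcon
      exact (sub_mem this hv : u + v - v ∈ maximalIdeal O) (by simpa using hu)
    exact (associated_unit_mul_left c _ this).symm
  have fact {p q m : O} (hp : IsUnit p) (h : p * q ∈ Ideal.span {m}) : ∃ e, q = e * m := by
    obtain ⟨e, he⟩ := Ideal.mem_span_singleton'.mp ((Ideal.unit_mul_mem_iff_mem _ hp).mp h)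
    exact ⟨e, he.symm⟩
  by_cases hα : IsUnit α
  · obtain ⟨e, rfl⟩ := fact hα hαγ
    have hδ : IsUnit δ := by
      by_contra hcon
      exact (sub_mem (Ideal.mul_mem_left _ _ hcon : α * δ ∈ maximalIdeal O)
        (Ideal.mul_mem_left _ _ (Ideal.mul_mem_left _ _ h.t_mem))) hdet
    obtain ⟨f, rfl⟩ := fact hδ (by rwa [mul_comm])
    refine Or.inl ⟨?_, ?_⟩
    · rw [← h1, show α * s + f * s * t = (α + f * t) * s by ring]
      exact assoc hα (Ideal.mul_mem_left _ _ h.t_mem)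
    · rw [← h2, show e * t * s + δ * t = (δ + e * s) * t by ring]
      exact assoc hδ (Ideal.mul_mem_left _ _ h.s_mem)
  · have hβγ : IsUnit (β * γ) := by
      by_contra hcon
      exact (sub_mem (Ideal.mul_mem_right _ _ hα : α * δ ∈ maximalIdeal O) hcon) hdet
    obtain ⟨hβ, hγ⟩ := IsUnit.mul_iff.mp hβγ
    obtain ⟨e, rfl⟩ := fact hγ (by rwa [mul_comm])
    obtain ⟨f, rfl⟩ := fact hβ hβδ
    refine Or.inr ⟨?_, ?_⟩
    · rw [← h1, show e * t * s + β * t = (β + e * s) * t by ring]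
      exact assoc hβ (Ideal.mul_mem_left _ _ h.s_mem)
    · rw [← h2, show γ * s + f * s * t = (γ + f * t) * s by ring]
      exact assoc hγ (Ideal.mul_mem_left _ _ h.t_mem)

end IsNode

end NodeUniqueness

/-! ### Regular systems of parameters at curve points and at nodes. -/

section RegularityOfPoints

open IsLocalRing NodeAlgebra

variable {R O : Type u} [CommRing R] [IsLocalRing R] [IsNoetherianRing R] [CommRing O]
  [IsLocalRing O] [IsNoetherianRing O]

omit [IsNoetherianRing R] [IsNoetherianRing O] in
lemma comap_maximalIdeal_comp_C {θ : Polynomial R →+* O}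
    (hloc : IsLocalHom (θ.comp Polynomial.C)) :
    (maximalIdeal R).map Polynomial.C ≤ (maximalIdeal O).comap θ := by
  rw [Ideal.map_le_iff_le_comap, Ideal.comap_comap]
  exact (((local_hom_TFAE (θ.comp Polynomial.C)).out 0 4 rfl rfl).mp hloc).ge

/-- The contraction of the maximal ideal contains the extension of the maximal ideal of `R`, whose
height is the dimension of `R`; going down does the rest. -/
lemma ringKrullDim_le_of_flat_polynomial {θ : Polynomial R →+* O} (hθ : θ.Flat)
    (hloc : IsLocalHom (θ.comp Polynomial.C)) : ringKrullDim R ≤ ringKrullDim O := by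
  algebraize [θ]
  have hle := comap_maximalIdeal_comp_C hloc
  have := height_comap_maximalIdeal_le (A := Polynomial R) (O := O) _ rfl
  refine le_trans ?_ this
  rw [← maximalIdeal_height_eq_ringKrullDim, ← Polynomial.height_map_C]
  exact_mod_cast Ideal.height_mono hle

/-- The polynomial `p` makes the contracted prime strictly larger than the extended one, which
raises the height by one. -/
lemma ringKrullDim_add_one_le_of_flat_polynomial {θ : Polynomial R →+* O} (hθ : θ.Flat)
    (hloc : IsLocalHom (θ.comp Polynomial.C)) {p : Polynomial R} (hp : θ p ∈ maximalIdeal O)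
    (hp' : p ∉ (maximalIdeal R).map Polynomial.C) : ringKrullDim R + 1 ≤ ringKrullDim O := by
  algebraize [θ]
  have hle := comap_maximalIdeal_comp_C hloc
  have := height_comap_maximalIdeal_le (A := Polynomial R) (O := O) _ rfl
  refine le_trans ?_ this
  have hprime : ((maximalIdeal R).map (Polynomial.C : R →+* Polynomial R)).IsPrime :=
    Ideal.isPrime_map_C_of_isPrime
  rw [← maximalIdeal_height_eq_ringKrullDim, ← Polynomial.height_map_C]
  have hlt : (maximalIdeal R).map Polynomial.C < (maximalIdeal O).comap θ :=
    lt_of_le_of_ne hle fun h => hp' (h ▸ hp)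
  exact_mod_cast Ideal.height_add_one_le_of_lt_of_isPrime hlt

lemma eq_zero_of_flat {A B : Type u} [CommRing A] [CommRing B] {φ : A →+* B} (hφ : φ.Flat) {a : A}
    (ha : a ∈ nonZeroDivisors A) {p : B} (hp : φ a * p = 0) : p = 0 := by
  algebraize [φ]
  refine Module.Flat.isSMulRegular_of_nonZeroDivisors (M := B) ha ?_
  simpa [Algebra.smul_def, RingHom.algebraMap_toAlgebra] using hp

/-- The local ring `O` over `R` is, étale locally, a local ring of an affine line. -/
def IsCurvePoint {R O : Type u} [CommRing R] [CommRing O] [IsLocalRing O] (φ : R →+* O) : Prop :=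
  ∃ θ : Polynomial R →+* O, θ.comp Polynomial.C = φ ∧ θ.FormallyEtale ∧ θ.Flat ∧
    ((maximalIdeal O).comap θ).map θ = maximalIdeal O

omit [IsLocalRing R] [IsNoetherianRing R] [IsNoetherianRing O] in
lemma IsCurvePoint.formallySmooth {φ : R →+* O} (h : IsCurvePoint φ) : φ.FormallySmooth := by
  obtain ⟨θ, rfl, hθ, -⟩ := h
  refine RingHom.FormallySmooth.comp ?_ (formallySmooth_of_formallyEtale hθ)
  have : Algebra.FormallySmooth R (Polynomial R) := inferInstance
  exact RingHom.formallySmooth_algebraMap.mpr this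

omit [IsLocalRing R] [IsNoetherianRing R] [IsNoetherianRing O] in
lemma IsCurvePoint.flat {φ : R →+* O} (h : IsCurvePoint φ) : φ.Flat := by
  obtain ⟨θ, rfl, -, hθ, -⟩ := h
  refine RingHom.Flat.comp ?_ hθ
  exact RingHom.flat_algebraMap_iff.mpr (inferInstanceAs (Module.Flat R (Polynomial R)))

/-- Modulo the maximal ideal of `R`, the contracted prime is an ideal of a polynomial ring over a
field, hence principal. Either it is zero and no parameter is added, or a lift of its generator is
one further parameter. The dimension bounds match these counts. -/
lemma IsCurvePoint.exists_extend {φ : R →+* O} (h : IsCurvePoint φ) (hloc : IsLocalHom φ)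
    {ι : Type} [Fintype ι] {t : ι → R} (ht : IsRegularSystem t) :
    ∃ (n : ℕ) (g : Fin n → O), IsRegularSystem (Sum.elim (φ ∘ t) g) := by
  obtain ⟨θ, rfl, -, hflat, hmax⟩ := h
  have hle := comap_maximalIdeal_comp_C hloc
  let P := (maximalIdeal O).comap θ
  have hspan : Ideal.span (Set.range ((θ.comp Polynomial.C) ∘ t)) =
      ((maximalIdeal R).map Polynomial.C).map θ := by
    rw [Set.range_comp, ← Ideal.map_span, ht.span_range, Ideal.map_map]
  by_cases hP : P ≤ (maximalIdeal R).map Polynomial.C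
  · refine ⟨0, Fin.elim0, isRegularSystem_of_card_le ?_ ?_⟩
    · rw [Set.Sum.elim_range, Set.range_eq_empty (f := (Fin.elim0 : Fin 0 → O)), Set.union_empty,
        hspan, ← hmax, le_antisymm hle hP]
    · rw [Fintype.card_sum, Fintype.card_fin, add_zero, ← ht.dim]
      exact ringKrullDim_le_of_flat_polynomial hflat hloc
  · let red := Polynomial.mapRingHom (residue R)
    have hred : Function.Surjective red := Polynomial.map_surjective _ residue_surjective
    have hprin := (IsPrincipalIdealRing.principal (P.map red))
    obtain ⟨g₀, hg₀⟩ := hprin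
    have hg₀' : g₀ ∈ P.map red := by rw [hg₀]; exact Ideal.mem_span_singleton_self _
    obtain ⟨g, hgP, rfl⟩ := (Ideal.mem_map_iff_of_surjective _ hred).mp hg₀'
    have hker : RingHom.ker red = (maximalIdeal R).map Polynomial.C := by
      rw [Polynomial.ker_mapRingHom, ker_residue]
    have hPg : P = (maximalIdeal R).map Polynomial.C ⊔ Ideal.span {g} := by
      refine le_antisymm (fun p hp => ?_)
        (sup_le hle ((Ideal.span_singleton_le_iff_mem _).mpr hgP))
      have h1 := Ideal.mem_map_of_mem red hp
      rw [hg₀] at h1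
      obtain ⟨c, hc⟩ := Ideal.mem_span_singleton'.mp h1
      obtain ⟨c, rfl⟩ := hred c
      have h2 : p - c * g ∈ (maximalIdeal R).map Polynomial.C := by
        rw [← hker, RingHom.mem_ker, map_sub, map_mul, hc, sub_self]
      rw [← sub_add_cancel p (c * g)]
      exact Ideal.add_mem _ (Ideal.mem_sup_left h2)
        (Ideal.mem_sup_right (Ideal.mul_mem_left _ _ (Ideal.mem_span_singleton_self _)))
    refine ⟨1, fun _ => θ g, isRegularSystem_of_card_le ?_ ?_⟩
    · rw [Set.Sum.elim_range, Ideal.span_union, hspan, Set.range_const, ← hmax]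
      change _ = P.map θ
      rw [hPg, Ideal.map_sup, Ideal.map_span _ {g}, Set.image_singleton]
    · rw [Fintype.card_sum, Fintype.card_fin, Nat.cast_add, ← ht.dim]
      refine ringKrullDim_add_one_le_of_flat_polynomial hflat hloc (p := g) hgP fun hg => hP ?_
      rw [hPg, sup_le_iff]
      exact ⟨le_rfl, (Ideal.span_singleton_le_iff_mem _).mpr hg⟩

namespace IsNode

variable {φ : R →+* O} {a : R} {s t : O}

/-- Modulo `s` and `τ i` the node becomes flat over the affine line over `R / τ i`, with `t` as
coordinate. That coordinate lies in the maximal ideal but not in the one extended from the base, so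
the dimension is at least `dim R / τ i + 1`. -/
lemma isRegularSystem_quotient (h : IsNode φ a s t) {ι : Type} [Fintype ι] [DecidableEq ι]
    {τ : ι → R} (hτ : IsRegularSystem τ) (i : ι) (hi : τ i ∣ a)
    [IsLocalRing (O ⧸ Ideal.span {s, φ (τ i)})] :
    IsRegularSystem (fun j : {j // j ≠ i} ⊕ Unit =>
      Ideal.Quotient.mk (Ideal.span {s, φ (τ i)}) (Sum.elim (fun j : {j // j ≠ i} => φ (τ j)) (fun _ => t) j)) := by
  let J := Ideal.span {s, φ (τ i)}
  let q := Ideal.Quotient.mk J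
  have hlocφ := h.isLocalHom
  have hJs : q s = 0 := Ideal.Quotient.eq_zero_iff_mem.mpr (Ideal.subset_span (by simp))
  have hJτ : q (φ (τ i)) = 0 := Ideal.Quotient.eq_zero_iff_mem.mpr (Ideal.subset_span (by simp))
  have hlocR := isLocalRing_quotient_span_singleton (hτ.mem_maximalIdeal i)
  let θ₀ : R ⧸ Ideal.span {τ i} →+* O ⧸ J := Ideal.Quotient.lift _ (q.comp φ) (by
    intro r hr
    obtain ⟨c, rfl⟩ := Ideal.mem_span_singleton'.mp hr
    rw [RingHom.comp_apply, map_mul, map_mul, hJτ, mul_zero])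
  let θ : Polynomial (R ⧸ Ideal.span {τ i}) →+* O ⧸ J := Polynomial.eval₂RingHom θ₀ (q t)
  have hflat : θ.Flat := by
    refine flat_quotient h.flat (evalX_surjective (τ i) hi) (J := J) ?_ ?_
    · rw [ker_evalX, Ideal.map_span, Set.image_pair, lift_x, lift_algebraMap]
    · refine hom_ext ?_ ?_ ?_
      · ext r
        simp [θ, θ₀, evalX, q]
      · simpa [θ, evalX] using hJs.symm
      · simp [θ, evalX, q]
  have hC : θ.comp Polynomial.C = θ₀ := by ext r; simp [θ]
  have hlocq : IsLocalHom q := Ideal.Quotient.mk_surjective.isLocalHom q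
  have hloc : IsLocalHom (θ.comp Polynomial.C) := by
    rw [hC]
    have : IsLocalHom (θ₀.comp (Ideal.Quotient.mk (Ideal.span {τ i}))) := by
      have : θ₀.comp (Ideal.Quotient.mk (Ideal.span {τ i})) = q.comp φ := by
        ext r; simp [θ₀]
      rw [this]
      infer_instance
    refine ⟨fun r hr => ?_⟩
    obtain ⟨r, rfl⟩ := Ideal.Quotient.mk_surjective r
    exact (isUnit_of_map_unit (θ₀.comp (Ideal.Quotient.mk (Ideal.span {τ i}))) r hr).map _
  refine isRegularSystem_of_card_le ?_ ?_
  · have hmap := map_maximalIdeal_of_surjective q Ideal.Quotient.mk_surjective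
    rw [← hmap, h.max, ← hτ.span_range, Ideal.map_span φ, ← Ideal.span_union, Ideal.map_span]
    refine le_antisymm (Ideal.span_mono ?_) (Ideal.span_le.mpr ?_)
    · rintro _ ⟨j | j, rfl⟩
      · exact ⟨_, Or.inl ⟨_, ⟨j, rfl⟩, rfl⟩, rfl⟩
      · exact ⟨_, Or.inr (Or.inr rfl), rfl⟩
    · rintro _ ⟨_, ⟨_, ⟨j, rfl⟩, rfl⟩ | rfl | rfl, rfl⟩
      · by_cases hj : j = i
        · subst hj
          rw [SetLike.mem_coe, hJτ]
          exact zero_mem _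
        · exact Ideal.subset_span ⟨Sum.inl ⟨j, hj⟩, rfl⟩
      · rw [SetLike.mem_coe, hJs]
        exact zero_mem _
      · exact Ideal.subset_span ⟨Sum.inr (), rfl⟩
  · rw [Fintype.card_sum, Fintype.card_unit, Nat.cast_add, ← (hτ.quotient i).dim]
    refine ringKrullDim_add_one_le_of_flat_polynomial hflat hloc (p := Polynomial.X) ?_ ?_
    · have h1 : q t ∈ (maximalIdeal O).map q := Ideal.mem_map_of_mem _ h.t_mem
      rw [map_maximalIdeal_of_surjective q Ideal.Quotient.mk_surjective] at h1
      simpa [θ] using h1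
    · rw [Ideal.mem_map_C_iff]
      push Not
      refine ⟨1, ?_⟩
      rw [Polynomial.coeff_X_one]
      exact fun h1 => h1 isUnit_one

omit [IsNoetherianRing R] [IsNoetherianRing O] in
lemma isLocalRing_quotient (h : IsNode φ a s t) {τ : R} (hτ : τ ∈ maximalIdeal R) :
    IsLocalRing (O ⧸ Ideal.span {s, φ τ}) := by
  have := h.isLocalHom
  have : Nontrivial (O ⧸ Ideal.span {s, φ τ}) := Ideal.Quotient.nontrivial_iff.mpr
    (ne_top_of_le_ne_top (maximalIdeal.isMaximal O).ne_top (Ideal.span_le.mpr (by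
      rintro _ (rfl | rfl)
      exacts [h.s_mem, fun hu => hτ (isUnit_of_map_unit φ _ hu)])))
  exact IsLocalRing.of_surjective' _ Ideal.Quotient.mk_surjective

/-- The branches of a node over the components of the discriminant are irreducible. -/
lemma isPrime_span (h : IsNode φ a s t) {ι : Type} [Fintype ι]
    {τ : ι → R} (hτ : IsRegularSystem τ) (i : ι) (hi : τ i ∣ a) :
    (Ideal.span {s, φ (τ i)}).IsPrime := by
  classical
  have := h.isLocalRing_quotient (hτ.mem_maximalIdeal i)
  have := (h.isRegularSystem_quotient hτ i hi).isDomain rfl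
  exact (Ideal.Quotient.isDomain_iff_prime _).mp this

/-- If the discriminant of the node is part of a regular system of parameters, then so are the
branches. -/
lemma isRegularSystem (h : IsNode φ a s t) {ι : Type} [Fintype ι] [DecidableEq ι]
    {τ : ι → R} (hτ : IsRegularSystem τ) (i : ι) (hi : Associated (τ i) a) :
    IsRegularSystem (Sum.elim (fun j : {j // j ≠ i} => φ (τ j)) ![s, t]) := by
  have hloc := h.isLocalRing_quotient (hτ.mem_maximalIdeal i)
  have hsys := h.isRegularSystem_quotient hτ i hi.dvd
  have hs : s ∣ φ (τ i) := (Dvd.intro _ h.mul).trans (map_dvd φ hi.dvd')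
  -- As `s` divides `a`, which is `τ i` up to a unit, the branch is cut out by `s` alone.
  have hspan : Ideal.span {s, φ (τ i)} = Ideal.span {s} := by
    refine le_antisymm (Ideal.span_le.mpr ?_) (Ideal.span_mono (by simp))
    rintro _ (rfl | rfl)
    exacts [Ideal.mem_span_singleton_self _, Ideal.mem_span_singleton.mpr hs]
  have hstτ : φ (τ i) ∈ Ideal.span {s, t} := by
    obtain ⟨c, hc⟩ := hs
    rw [hc]
    exact Ideal.mul_mem_right _ _ (Ideal.subset_span (by simp))
  refine isRegularSystem_of_card_le ?_ ?_
  · rw [h.max, ← hτ.span_range, Ideal.map_span φ, Set.Sum.elim_range, Ideal.span_union,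
      Matrix.range_cons, Matrix.range_cons, Matrix.range_empty, Set.union_empty,
      Set.singleton_union]
    refine le_antisymm (sup_le_sup_right (Ideal.span_mono ?_) _) (sup_le (Ideal.span_le.mpr ?_)
      le_sup_right)
    · rintro _ ⟨j, rfl⟩
      exact ⟨_, ⟨j, rfl⟩, rfl⟩
    · rintro _ ⟨_, ⟨j, rfl⟩, rfl⟩
      by_cases hj : j = i
      · subst hj
        exact Ideal.mem_sup_right hstτ
      · exact Ideal.mem_sup_left (Ideal.subset_span ⟨⟨j, hj⟩, rfl⟩)
  -- `s` is regular because it divides the image of the nonzero `a` under a flat map; hence `dim O`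
  -- exceeds `dim O / s` by at least one.
  · have hnzd : s ∈ nonZeroDivisors O := by
      rw [mem_nonZeroDivisors_iff_right]
      intro p hp
      have hR := hτ.isDomain rfl
      have ha : a ∈ nonZeroDivisors R := mem_nonZeroDivisors_of_ne_zero fun h0 =>
        (hτ.prime i).ne_zero (hi.eq_zero_iff.mpr h0)
      refine eq_zero_of_flat h.flat_base ha ?_
      rw [← h.mul]
      linear_combination t * hp
    have h1 := ringKrullDim_quotient_succ_le_of_nonZeroDivisor hnzd
    rw [← hspan, hsys.dim] at h1
    refine le_trans (le_of_eq ?_) h1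
    simp only [Fintype.card_sum, Fintype.card_unit, Fintype.card_fin]
    norm_cast

end IsNode

end RegularityOfPoints

/-! ### Gluing schemes over `X` along their largest overlaps. -/

section Gluing

/-- Schemes `B i` over `X`, to be glued along the largest open subschemes which map to each other
over `X`. -/
structure GluingPieces (X : Scheme.{u}) where
  J : Type u
  B : J → Scheme.{u}
  h : ∀ i, B i ⟶ X
  uniq : ∀ (i j : J) {T : Scheme.{u}} (k : T ⟶ B i) [IsOpenImmersion k] (g g' : T ⟶ B j),
    g ≫ h j = k ≫ h i → g' ≫ h j = k ≫ h i → g = g'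
  rev : ∀ (i j : J) (N : (B i).Opens) (g : N.toScheme ⟶ B j), g ≫ h j = N.ι ≫ h i →
    ∀ q : N.toScheme, ∃ (N' : (B j).Opens) (g' : N'.toScheme ⟶ B i), g' ≫ h i = N'.ι ≫ h j ∧ g q ∈ N'

lemma exists_glued_hom {T Y : Scheme.{u}} {I : Type u} (U : I → T.Opens) (hU : ∀ x, ∃ i, x ∈ U i)
    (f : ∀ i, (U i).toScheme ⟶ Y)
    (hf : ∀ i j, pullback.fst (U i).ι (U j).ι ≫ f i = pullback.snd (U i).ι (U j).ι ≫ f j) :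
    ∃ F : T ⟶ Y, ∀ i, (U i).ι ≫ F = f i := by
  let 𝒰 : T.OpenCover := {
    I₀ := I, X i := (U i), f i := (U i).ι,
    mem₀ := by
      rw [Scheme.presieve₀_mem_precoverage_iff]
      refine ⟨fun x => ?_, inferInstance⟩
      obtain ⟨i, hi⟩ := hU x
      exact ⟨i, by simpa⟩ }
  exact ⟨𝒰.glueMorphisms f hf, fun i => 𝒰.ι_glueMorphisms f hf i⟩

namespace GluingPieces

variable {X : Scheme.{u}} (G : GluingPieces X)

/-- The open subschemes of `B i` mapping to `B j`. -/
def patches (i j : G.J) : Set (G.B i).Opens :=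
  {N | ∃ g : N.toScheme ⟶ G.B j, g ≫ G.h j = N.ι ≫ G.h i}

/-- The largest open subscheme of `B i` mapping to `B j`. -/
def overlap (i j : G.J) : (G.B i).Opens := sSup (G.patches i j)

/-- By `uniq` the local morphisms over `X` agree wherever two of them are defined, so they glue. -/
lemma exists_transition (i j : G.J) :
    ∃ g : (G.overlap i j).toScheme ⟶ G.B j, g ≫ G.h j = (G.overlap i j).ι ≫ G.h i := by
  let W := G.overlap i j
  choose g hg using fun N : G.patches i j => N.2
  have hle (N : G.patches i j) : N.1 ≤ W := le_sSup N.2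
  let e (N : G.patches i j) : (W.ι ⁻¹ᵁ N.1).toScheme ⟶ N.1.toScheme :=
    IsOpenImmersion.lift N.1.ι ((W.ι ⁻¹ᵁ N.1).ι ≫ W.ι) (by
      rintro _ ⟨x, rfl⟩
      rw [Scheme.Opens.range_ι]
      exact x.2)
  have he (N) : e N ≫ N.1.ι = (W.ι ⁻¹ᵁ N.1).ι ≫ W.ι := IsOpenImmersion.lift_fac _ _ _
  obtain ⟨F, hF⟩ := exists_glued_hom (fun N => W.ι ⁻¹ᵁ N.1) (fun x => by
      obtain ⟨N, hN, hx⟩ := TopologicalSpace.Opens.mem_sSup.mp x.2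
      exact ⟨⟨N, hN⟩, hx⟩) (fun N => e N ≫ g N) (fun N N' => by
      refine G.uniq i j (pullback.fst (W.ι ⁻¹ᵁ N.1).ι (W.ι ⁻¹ᵁ N'.1).ι ≫ (W.ι ⁻¹ᵁ N.1).ι ≫ W.ι)
        _ _ ?_ ?_
      · simp only [Category.assoc, hg, reassoc_of% he]
      · simp only [Category.assoc, hg, reassoc_of% he]
        rw [← pullback.condition_assoc])
  refine ⟨F, Scheme.hom_ext_of_forall _ _ fun x => ?_⟩
  obtain ⟨N, hN, hx⟩ := TopologicalSpace.Opens.mem_sSup.mp x.2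
  refine ⟨W.ι ⁻¹ᵁ N, hx, ?_⟩
  have := hF ⟨N, hN⟩
  rw [reassoc_of% this, hg, reassoc_of% he]

/-- The morphism from the overlap to `B j`. -/
def trans (i j : G.J) : (G.overlap i j).toScheme ⟶ G.B j := (G.exists_transition i j).choose

@[simp]
lemma trans_h (i j : G.J) : G.trans i j ≫ G.h j = (G.overlap i j).ι ≫ G.h i :=
  (G.exists_transition i j).choose_spec

lemma mem_overlap {i j : G.J} {N : (G.B i).Opens} {g : N.toScheme ⟶ G.B j}
    (hg : g ≫ G.h j = N.ι ≫ G.h i) {p : G.B i} (hp : p ∈ N) : p ∈ G.overlap i j :=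
  TopologicalSpace.Opens.mem_sSup.mpr ⟨N, ⟨g, hg⟩, hp⟩

lemma trans_mem (i j : G.J) (q : (G.overlap i j).toScheme) : G.trans i j q ∈ G.overlap j i := by
  obtain ⟨N', g', hg', hq⟩ := G.rev i j _ _ (G.trans_h i j) q
  exact G.mem_overlap hg' hq

lemma overlap_self (i : G.J) : G.overlap i i = ⊤ :=
  top_le_iff.mp fun _ _ => G.mem_overlap (N := ⊤) (g := Scheme.Opens.ι _) rfl trivial

/-- The transition isomorphisms. -/
def t (i j : G.J) : (G.overlap i j).toScheme ⟶ (G.overlap j i).toScheme :=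
  IsOpenImmersion.lift (G.overlap j i).ι (G.trans i j) (by
    rintro _ ⟨q, rfl⟩
    simpa using G.trans_mem i j q)

@[simp]
lemma t_ι (i j : G.J) : G.t i j ≫ (G.overlap j i).ι = G.trans i j :=
  IsOpenImmersion.lift_fac _ _ _

@[simp]
lemma t_ι_assoc (i j : G.J) {Z : Scheme.{u}} (k : G.B j ⟶ Z) :
    G.t i j ≫ (G.overlap j i).ι ≫ k = G.trans i j ≫ k := by
  rw [← Category.assoc, t_ι]

lemma t_trans (i j : G.J) : G.t i j ≫ G.trans j i = (G.overlap i j).ι := by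
  refine G.uniq i i (G.overlap i j).ι _ _ ?_ rfl
  rw [Category.assoc, trans_h, t_ι_assoc, trans_h]

/-- Returning from `B j` to `B i` and continuing to `B k` is a morphism over `X` on a neighborhood
of the image of `q`, and the overlap is the largest such domain. -/
lemma trans_mem_overlap (i j k : G.J) (q : (G.overlap i j).toScheme) (hq : q.1 ∈ G.overlap i k) :
    G.trans i j q ∈ G.overlap j k := by
  let W := G.overlap j i
  let N := G.trans j i ⁻¹ᵁ G.overlap i k
  let m : N.toScheme ⟶ (G.overlap i k).toScheme :=
    IsOpenImmersion.lift (G.overlap i k).ι (N.ι ≫ G.trans j i) (by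
      rintro _ ⟨x, rfl⟩
      rw [Scheme.Opens.range_ι]
      exact x.2)
  have hm : m ≫ (G.overlap i k).ι = N.ι ≫ G.trans j i := IsOpenImmersion.lift_fac _ _ _
  let e := (N.ι ≫ W.ι).isoOpensRange
  refine G.mem_overlap (N := (N.ι ≫ W.ι).opensRange) (g := e.inv ≫ m ≫ G.trans i k) ?_ ?_
  · rw [Category.assoc, Category.assoc, trans_h, reassoc_of% hm, trans_h, Iso.inv_comp_eq]
    exact congr($((N.ι ≫ W.ι).isoOpensRange_hom_ι.symm) ≫ G.h j)
  · have h1 : G.trans j i (G.t i j q) = q.1 := by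
      exact congr($(G.t_trans i j) q)
    refine ⟨⟨G.t i j q, ?_⟩, ?_⟩
    · change G.trans j i (G.t i j q) ∈ G.overlap i k
      rwa [h1]
    · exact congr($(G.t_ι i j) q)

/-- The transition on triple overlaps. -/
def tripleLift (i j k : G.J) : pullback (G.overlap i j).ι (G.overlap i k).ι ⟶
    (G.overlap j k).toScheme :=
  IsOpenImmersion.lift (G.overlap j k).ι (pullback.fst _ _ ≫ G.trans i j) (by
    rintro _ ⟨q, rfl⟩
    have h1 : (G.overlap i j).ι (pullback.fst (G.overlap i j).ι (G.overlap i k).ι q) =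
        (G.overlap i k).ι (pullback.snd (G.overlap i j).ι (G.overlap i k).ι q) := by
      rw [← Scheme.Hom.comp_apply, pullback.condition, Scheme.Hom.comp_apply]
    rw [Scheme.Hom.comp_apply]
    simp only [Scheme.Opens.range_ι]
    refine G.trans_mem_overlap i j k _ ?_
    change (G.overlap i j).ι _ ∈ _
    rw [h1]
    exact (pullback.snd (G.overlap i j).ι (G.overlap i k).ι q).2)

@[simp]
lemma tripleLift_ι (i j k : G.J) : G.tripleLift i j k ≫ (G.overlap j k).ι =
    pullback.fst _ _ ≫ G.trans i j :=
  IsOpenImmersion.lift_fac _ _ _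

@[simp]
lemma tripleLift_ι_assoc (i j k : G.J) {Z : Scheme.{u}} (m : G.B j ⟶ Z) :
    G.tripleLift i j k ≫ (G.overlap j k).ι ≫ m = pullback.fst _ _ ≫ G.trans i j ≫ m := by
  rw [← Category.assoc, tripleLift_ι, Category.assoc]

/-- The transition on triple overlaps. -/
def t' (i j k : G.J) : pullback (G.overlap i j).ι (G.overlap i k).ι ⟶
    pullback (G.overlap j k).ι (G.overlap j i).ι :=
  pullback.lift (G.tripleLift i j k) (pullback.fst _ _ ≫ G.t i j) (by simp)

lemma t'_comp (i j k : G.J) : G.t' i j k ≫ pullback.fst _ _ ≫ (G.overlap j k).ι ≫ G.h j =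
    pullback.fst _ _ ≫ (G.overlap i j).ι ≫ G.h i := by
  rw [t', pullback.lift_fst_assoc, tripleLift_ι_assoc, trans_h]

/-- The glue data. -/
def glueData : Scheme.GlueData.{u} where
  J := G.J
  U := G.B
  V ij := (G.overlap ij.1 ij.2).toScheme
  f i j := (G.overlap i j).ι
  f_id i := by
    rw [G.overlap_self i]
    exact inferInstanceAs (IsIso (G.B i).topIso.hom)
  t i j := G.t i j
  t_id i := by
    rw [← cancel_mono (G.overlap i i).ι, t_ι, Category.id_comp]
    exact G.uniq i i (G.overlap i i).ι _ _ (G.trans_h i i) rfl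
  t' i j k := G.t' i j k
  t_fac i j k := pullback.lift_snd _ _ _
  -- Both sides are morphisms to the same piece with the same composite to `X`, so `uniq` suffices.
  cocycle i j k := by
    rw [← cancel_mono (pullback.fst (G.overlap i j).ι (G.overlap i k).ι ≫ (G.overlap i j).ι),
      Category.id_comp]
    refine G.uniq i i (pullback.fst (G.overlap i j).ι (G.overlap i k).ι ≫ (G.overlap i j).ι) _ _
      ?_ rfl
    simp only [Category.assoc, t'_comp]
  f_open i j := inferInstance

/-- The glued scheme. -/
def glued : Scheme.{u} := G.glueData.glued

/-- The inclusion of a piece. -/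
def ι (i : G.J) : G.B i ⟶ G.glued := G.glueData.ι i

instance (i : G.J) : IsOpenImmersion (G.ι i) := G.glueData.ι_isOpenImmersion i

lemma exists_ι_eq (x : G.glued) : ∃ (i : G.J) (y : G.B i), G.ι i y = x :=
  G.glueData.ι_jointly_surjective x

lemma overlap_ι (i j : G.J) : (G.overlap i j).ι ≫ G.ι i = G.trans i j ≫ G.ι j := by
  have := G.glueData.glue_condition i j
  rw [← t_ι, Category.assoc]
  exact this.symm

lemma exists_π : ∃ π : G.glued ⟶ X, ∀ i, G.ι i ≫ π = G.h i :=
  ⟨Multicoequalizer.desc _ _ G.h (by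
    rintro ⟨i, j⟩
    change (G.overlap i j).ι ≫ G.h i = (G.t i j ≫ (G.overlap j i).ι) ≫ G.h j
    exact (congr($(G.t_ι i j) ≫ G.h j).trans (G.trans_h i j)).symm), fun i => Multicoequalizer.π_desc _ _ _ _ _⟩

/-- The projection from the glued scheme. -/
def π : G.glued ⟶ X := G.exists_π.choose

@[simp]
lemma ι_π (i : G.J) : G.ι i ≫ G.π = G.h i := G.exists_π.choose_spec i

@[simp]
lemma ι_π_assoc (i : G.J) {Z : Scheme.{u}} (k : X ⟶ Z) : G.ι i ≫ G.π ≫ k = G.h i ≫ k := by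
  rw [← Category.assoc, ι_π]

/-- The domain of `g` lies in the overlap by maximality, and `uniq` identifies `g` with the
restricted transition morphism. -/
lemma ι_comp_eq (i j : G.J) {N : (G.B i).Opens} {g : N.toScheme ⟶ G.B j}
    (hg : g ≫ G.h j = N.ι ≫ G.h i) : N.ι ≫ G.ι i = g ≫ G.ι j := by
  have hle : N ≤ G.overlap i j := le_sSup ⟨g, hg⟩
  have h1 : N.ι = (G.B i).homOfLE hle ≫ (G.overlap i j).ι := by simp
  have h2 : g = (G.B i).homOfLE hle ≫ G.trans i j := by
    refine G.uniq i j N.ι _ _ hg ?_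
    rw [Category.assoc, trans_h, Scheme.homOfLE_ι_assoc]
  rw [h2, h1, Category.assoc, overlap_ι, Category.assoc]

lemma ι_apply_eq (i j : G.J) {N : (G.B i).Opens} {g : N.toScheme ⟶ G.B j}
    (hg : g ≫ G.h j = N.ι ≫ G.h i) (q : N.toScheme) : G.ι i q.1 = G.ι j (g q) := by
  exact congr($(G.ι_comp_eq i j hg) q)

end GluingPieces

end Gluing

/-! ### Étale charts with values in affine schemes, as ring homomorphisms. -/

section EtaleCharts

variable {X S : Scheme.{u}}

/-- The morphism from an open subscheme to an affine scheme given by a ring homomorphism. -/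
def specHom (U : X.Opens) {A : Type u} [CommRing A] (θ : A →+* Γ(X, U)) :
    U.toScheme ⟶ Spec (CommRingCat.of A) :=
  U.toSpecΓ ≫ Spec.map (CommRingCat.ofHom θ)

variable {U W : X.Opens} {A A' : Type u} [CommRing A] [CommRing A']

lemma specHom_comp (θ : A →+* Γ(X, U)) (ψ : A' →+* A) :
    specHom U θ ≫ Spec.map (CommRingCat.ofHom ψ) = specHom U (θ.comp ψ) := by
  rw [specHom, specHom, Category.assoc, ← Spec.map_comp, ← CommRingCat.ofHom_comp]

lemma homOfLE_specHom (h : W ≤ U) (θ : A →+* Γ(X, U)) :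
    X.homOfLE h ≫ specHom U θ =
      specHom W ((X.presheaf.map (homOfLE h).op).hom.comp θ) := by
  rw [specHom, specHom, ← Scheme.Opens.toSpecΓ_SpecMap_presheaf_map_assoc, ← Spec.map_comp]
  rfl

lemma resLE_specHom {X' : Scheme.{u}} (π : X' ⟶ X) {W : X'.Opens} (h : W ≤ π ⁻¹ᵁ U)
    (θ : A →+* Γ(X, U)) :
    π.resLE U W h ≫ specHom U θ = specHom W ((π.appLE U W h).hom.comp θ) := by
  rw [specHom, specHom, ← Scheme.Opens.toSpecΓ_SpecMap_appLE_assoc, ← Spec.map_comp]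
  rfl

lemma specHom_injective : Function.Injective (specHom U (A := A)) := by
  intro θ θ' h
  have h1 := congr(Scheme.Hom.appTop $h)
  simp only [specHom, Scheme.Hom.comp_appTop, Scheme.Opens.toSpecΓ_appTop] at h1
  have h2 (ψ : A →+* Γ(X, U)) : (Spec.map (CommRingCat.ofHom ψ)).appTop ≫
      (Scheme.ΓSpecIso Γ(X, U)).hom ≫ U.topIso.inv =
      (Scheme.ΓSpecIso (CommRingCat.of A)).hom ≫ CommRingCat.ofHom ψ ≫ U.topIso.inv := by
    have h3 := Scheme.ΓSpecIso_naturality (CommRingCat.ofHom ψ)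
    exact (Category.assoc _ _ _).symm.trans
      (congr($h3 ≫ U.topIso.inv).trans (Category.assoc _ _ _))
  rw [h2, h2, cancel_epi, cancel_mono] at h1
  exact congr(CommRingCat.Hom.hom $h1)

lemma exists_eq_specHom (g : U.toScheme ⟶ Spec (CommRingCat.of A)) :
    ∃ θ : A →+* Γ(X, U), g = specHom U θ := by
  refine ⟨((Scheme.ΓSpecIso (CommRingCat.of A)).inv ≫ g.appTop ≫ U.topIso.hom).hom, ?_⟩
  have h1 := Scheme.toSpecΓ_naturality g
  have h2 : (Spec (CommRingCat.of A)).toSpecΓ ≫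
      Spec.map (Scheme.ΓSpecIso (CommRingCat.of A)).inv = 𝟙 _ := by
    simp
  rw [specHom, Scheme.Opens.toSpecΓ, CommRingCat.ofHom_hom, Category.assoc, ← Spec.map_comp,
    Category.assoc, Category.assoc, Iso.hom_inv_id, Category.comp_id, Spec.map_comp, ← reassoc_of% h1,
    h2, Category.comp_id]

lemma specHom_fromSpec {f : X ⟶ S} {V : S.Opens} (hV : IsAffineOpen V) (h : U ≤ f ⁻¹ᵁ V) :
    specHom U (f.appLE V U h).hom ≫ hV.fromSpec = U.ι ≫ f := by
  rw [specHom, CommRingCat.ofHom_hom]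
  have h1 := Scheme.Opens.toSpecΓ_SpecMap_appLE f V U h
  refine congr($h1 ≫ hV.fromSpec).trans ?_
  rw [Category.assoc, hV.toSpecΓ_fromSpec, Scheme.Hom.resLE_comp_ι]

/-- A ring homomorphism `A → Γ(X, U)` is an étale chart if `U → Spec A` is étale. -/
def IsEtaleChart (U : X.Opens) {A : Type u} [CommRing A] (θ : A →+* Γ(X, U)) : Prop :=
  Etale (specHom U θ)

lemma IsEtaleChart.res {θ : A →+* Γ(X, U)} (hθ : IsEtaleChart U θ) (h : W ≤ U) :
    IsEtaleChart W ((X.presheaf.map (homOfLE h).op).hom.comp θ) := by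
  rw [IsEtaleChart] at hθ ⊢
  rw [← homOfLE_specHom]
  infer_instance

/-- An étale chart may be lifted along an étale ring homomorphism. -/
lemma IsEtaleChart.of_comp {θ : A →+* Γ(X, U)} {ψ : A' →+* A} (hψ : ψ.Etale)
    (hθ : IsEtaleChart U (θ.comp ψ)) : IsEtaleChart U θ := by
  rw [IsEtaleChart] at hθ ⊢
  rw [← specHom_comp] at hθ
  have : Etale (Spec.map (CommRingCat.ofHom ψ)) :=
    (HasRingHomProperty.Spec_iff (P := @Etale)).mpr hψ
  exact MorphismProperty.of_postcomp @Etale (W' := @Etale) _ _ this hθ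

lemma IsEtaleChart.comp {θ : A →+* Γ(X, U)} {ψ : A' →+* A} (hψ : ψ.Etale)
    (hθ : IsEtaleChart U θ) : IsEtaleChart U (θ.comp ψ) := by
  rw [IsEtaleChart] at hθ ⊢
  rw [← specHom_comp]
  have : Etale (Spec.map (CommRingCat.ofHom ψ)) :=
    (HasRingHomProperty.Spec_iff (P := @Etale)).mpr hψ
  infer_instance

lemma IsEtaleChart.etale_of_isAffineOpen {θ : A →+* Γ(X, U)} (hθ : IsEtaleChart U θ)
    (hU : IsAffineOpen U) : θ.Etale := by
  rw [IsEtaleChart, specHom, ← hU.isoSpec_hom] at hθ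
  have : Etale (Spec.map (CommRingCat.ofHom θ)) := by
    have : Etale (hU.isoSpec.inv ≫ hU.isoSpec.hom ≫ Spec.map (CommRingCat.ofHom θ)) :=
      inferInstance
    rwa [Iso.inv_hom_id_assoc] at this
  exact (HasRingHomProperty.Spec_iff (P := @Etale)).mp this

/-- An étale chart at the stalks. -/
lemma IsEtaleChart.germ {θ : A →+* Γ(X, U)} (hθ : IsEtaleChart U θ) {z : X} (hz : z ∈ U) :
    let θz : A →+* X.presheaf.stalk z := (X.presheaf.germ U z hz).hom.comp θ
    θz.FormallyEtale ∧ θz.Flat ∧ ((IsLocalRing.maximalIdeal _).comap θz).map θz =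
      IsLocalRing.maximalIdeal (X.presheaf.stalk z) := by
  intro θz
  obtain ⟨W, hW, hzW, hWU⟩ := X.isBasis_affineOpens.exists_subset_of_mem_open hz U.isOpen
  obtain ⟨W, hWa, rfl⟩ := hW
  replace hWU : W ≤ U := hWU
  replace hzW : z ∈ W := hzW
  replace hWa : IsAffineOpen W := hWa
  have het := (hθ.res hWU).etale_of_isAffineOpen hWa
  let ψ : A →+* Γ(X, W) := (X.presheaf.map (homOfLE hWU).op).hom.comp θ
  have hθz : θz = (X.presheaf.germ W z hzW).hom.comp ψ := by
    rw [← RingHom.comp_assoc, ← CommRingCat.hom_comp, X.presheaf.germ_res]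
  let : Algebra A Γ(X, W) := ψ.toAlgebra
  let : Algebra Γ(X, W) (X.presheaf.stalk z) := (X.presheaf.germ W z hzW).hom.toAlgebra
  let : Algebra A (X.presheaf.stalk z) := θz.toAlgebra
  have : IsScalarTower A Γ(X, W) (X.presheaf.stalk z) := IsScalarTower.of_algebraMap_eq' hθz
  have : Algebra.Etale A Γ(X, W) := het
  have hloc : IsLocalization.AtPrime (X.presheaf.stalk z) (hWa.primeIdealOf ⟨z, hzW⟩).asIdeal :=
    hWa.isLocalization_stalk ⟨z, hzW⟩
  exact etale_localization (A := A) (B := Γ(X, W)) (O := X.presheaf.stalk z)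
    (hWa.primeIdealOf ⟨z, hzW⟩).asIdeal

end EtaleCharts

/-! ### Local rings at the points of charts: nodes and curve points. -/

section ChartsAtPoints

open IsLocalRing

/-- The properties of étale charts at stalks only depend on a localization of the chart. -/
lemma chart_localization {A A' O : Type u} [CommRing A] [CommRing A'] [CommRing O] [IsLocalRing O]
    [Algebra A A'] (M : Submonoid A) [IsLocalization M A'] {θ : A →+* O} {θ' : A' →+* O}
    (h : θ'.comp (algebraMap A A') = θ) (hFE : θ.FormallyEtale) (hflat : θ.Flat)
    (hmax : ((maximalIdeal O).comap θ).map θ = maximalIdeal O) :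
    θ'.FormallyEtale ∧ θ'.Flat ∧ ((maximalIdeal O).comap θ').map θ' = maximalIdeal O := by
  refine ⟨?_, ?_, le_antisymm Ideal.map_comap_le ?_⟩
  · algebraize [θ, θ']
    have : IsScalarTower A A' O := IsScalarTower.of_algebraMap_eq' h.symm
    exact Algebra.FormallyEtale.localization_base M
  · algebraize [θ, θ']
    have : IsScalarTower A A' O := IsScalarTower.of_algebraMap_eq' h.symm
    exact (Module.flat_iff_of_isLocalization A' M O).mpr hflat
  · conv_lhs => rw [← hmax]
    rw [Ideal.map_le_iff_le_comap]
    intro p hp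
    have h1 (p : A) : θ p = θ' (algebraMap A A' p) := (RingHom.congr_fun h p).symm
    rw [Ideal.mem_comap, h1]
    refine Ideal.mem_map_of_mem _ ?_
    rw [Ideal.mem_comap, ← h1]
    exact hp

variable {R R' O : Type u} [CommRing R] [CommRing R'] [CommRing O] [IsLocalRing O] [Algebra R R']

/-- Flatness and formal étaleness survive localization of the base. For the maximal ideal: every
element of the node algebra is a constant modulo `(x, y)`, and a constant which is not a unit in `O`
lies in the maximal ideal of `R'`. -/
lemma isNode_of_chart [IsLocalRing R'] (M : Submonoid R) [IsLocalization M R'] {φ : R' →+* O}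
    [IsLocalHom φ] {a : R} {θ : NodeAlgebra R a →+* O}
    (h : θ.comp (algebraMap R _) = φ.comp (algebraMap R R'))
    (hFE : θ.FormallyEtale) (hflat : θ.Flat)
    (hmax : ((maximalIdeal O).comap θ).map θ = maximalIdeal O)
    (hs : ¬ IsUnit (θ (NodeAlgebra.x a))) (ht : ¬ IsUnit (θ (NodeAlgebra.y a))) :
    IsNode φ (algebraMap R R' a) (θ (NodeAlgebra.x a)) (θ (NodeAlgebra.y a)) := by
  have hmul : θ (NodeAlgebra.x a) * θ (NodeAlgebra.y a) = φ (algebraMap R R' a) := by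
    rw [← map_mul, NodeAlgebra.x_mul_y]
    exact RingHom.congr_fun h a
  have h1 : algebraMap R R' a = 1 * algebraMap R R' a := by rw [one_mul]
  let := (NodeAlgebra.baseChange h1).toAlgebra
  have hloc := NodeAlgebra.isLocalization_baseChange M isUnit_one h1
  have h2 : (NodeAlgebra.lift φ _ _ hmul).comp
      (algebraMap (NodeAlgebra R a) (NodeAlgebra R' (algebraMap R R' a))) = θ := by
    change (NodeAlgebra.lift φ _ _ hmul).comp (NodeAlgebra.baseChange h1) = θ
    refine NodeAlgebra.hom_ext ?_ ?_ ?_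
    · rw [h]
      ext r
      simp [NodeAlgebra.baseChange]
    · simp [NodeAlgebra.baseChange]
    · simp [NodeAlgebra.baseChange]
  obtain ⟨e1, e2, e3⟩ := chart_localization (M.map (algebraMap R (NodeAlgebra R a))) h2 hFE
    hflat hmax
  refine ⟨hmul, hs, ht, e1, e2, le_antisymm ?_ ?_⟩
  · rw [← e3, Ideal.map_le_iff_le_comap]
    intro p hp
    obtain ⟨ρ, hρ⟩ := NodeAlgebra.exists_sub_algebraMap_mem p
    have h3 := Ideal.mem_map_of_mem (NodeAlgebra.lift φ _ _ hmul) hρ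
    rw [Ideal.map_span, Set.image_pair, NodeAlgebra.lift_x, NodeAlgebra.lift_y, map_sub,
      NodeAlgebra.lift_algebraMap] at h3
    have h4 : φ ρ ∈ maximalIdeal O := by
      have h5 : Ideal.span {θ (NodeAlgebra.x a), θ (NodeAlgebra.y a)} ≤ maximalIdeal O := by
        rw [Ideal.span_le]
        rintro _ (rfl | rfl)
        exacts [hs, ht]
      have := sub_mem (show NodeAlgebra.lift φ _ _ hmul p ∈ maximalIdeal O from hp) (h5 h3)
      rwa [sub_sub_cancel] at this
    have h5 : ρ ∈ maximalIdeal R' := fun hu => h4 (hu.map φ)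
    rw [Ideal.mem_comap, ← sub_add_cancel (NodeAlgebra.lift φ _ _ hmul p) (φ ρ)]
    exact add_mem (Ideal.mem_sup_right h3) (Ideal.mem_sup_left (Ideal.mem_map_of_mem _ h5))
  · refine sup_le (((local_hom_TFAE φ).out 0 2 rfl rfl).mp inferInstance) ?_
    rw [Ideal.span_le]
    rintro _ (rfl | rfl)
    exacts [hs, ht]

lemma isCurvePoint_of_chart (M : Submonoid R) [IsLocalization M R'] {φ : R' →+* O}
    {θ : Polynomial R →+* O} (h : θ.comp Polynomial.C = φ.comp (algebraMap R R'))
    (hFE : θ.FormallyEtale) (hflat : θ.Flat)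
    (hmax : ((maximalIdeal O).comap θ).map θ = maximalIdeal O) : IsCurvePoint φ := by
  let := (Polynomial.mapRingHom (algebraMap R R')).toAlgebra
  have : IsLocalization (M.map (Polynomial.C : R →+* Polynomial R)) (Polynomial R') :=
    Polynomial.isLocalization M R'
  let θ' : Polynomial R' →+* O := Polynomial.eval₂RingHom φ (θ Polynomial.X)
  refine ⟨θ', by ext; simp [θ'], chart_localization (M.map (Polynomial.C : R →+* Polynomial R))
    (θ := θ) ?_ hFE hflat hmax⟩
  refine Polynomial.ringHom_ext (fun r => ?_) ?_
  · have := RingHom.congr_fun h r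
    simpa [θ', RingHom.algebraMap_toAlgebra] using this.symm
  · simp [θ', RingHom.algebraMap_toAlgebra]

variable {X S : Scheme.{u}}

/-- An étale morphism from an open subscheme of `X` to `Spec R[x, y] / (x y - a)` over `S`. -/
structure NodeChart (f : X ⟶ S) where
  U : X.Opens
  V : S.Opens
  hV : IsAffineOpen V
  le : U ≤ f ⁻¹ᵁ V
  a : Γ(S, V)
  θ : NodeAlgebra Γ(S, V) a →+* Γ(X, U)
  comm : θ.comp (algebraMap _ _) = (f.appLE V U le).hom
  etale : IsEtaleChart U θ

lemma germ_appLE {f : X ⟶ S} {U : X.Opens} {V : S.Opens} (h : U ≤ f ⁻¹ᵁ V) {z : X} (hz : z ∈ U)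
    (r : Γ(S, V)) : X.presheaf.germ U z hz (f.appLE V U h r) =
      f.stalkMap z (S.presheaf.germ V (f z) (h hz) r) := by
  refine Eq.trans ?_ (Scheme.Hom.germ_stalkMap_apply f V z (h hz) r).symm
  rw [Scheme.Hom.appLE, CommRingCat.comp_apply]
  exact TopCat.Presheaf.germ_res_apply X.presheaf (homOfLE h) z hz _

lemma isCurvePoint_stalkMap {f : X ⟶ S} {U : X.Opens} {V : S.Opens} (hV : IsAffineOpen V)
    (h : U ≤ f ⁻¹ᵁ V) {θ : Polynomial Γ(S, V) →+* Γ(X, U)}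
    (comm : θ.comp Polynomial.C = (f.appLE V U h).hom) (hθ : IsEtaleChart U θ) {z : X}
    (hz : z ∈ U) : IsCurvePoint (f.stalkMap z).hom := by
  obtain ⟨e1, e2, e3⟩ := hθ.germ hz
  let : Algebra Γ(S, V) (S.presheaf.stalk (f z)) := (S.presheaf.germ V (f z) (h hz)).hom.toAlgebra
  have : IsLocalization.AtPrime (S.presheaf.stalk (f z)) (hV.primeIdealOf ⟨f z, h hz⟩).asIdeal :=
    hV.isLocalization_stalk ⟨f z, h hz⟩
  refine isCurvePoint_of_chart (hV.primeIdealOf ⟨f z, h hz⟩).asIdeal.primeCompl ?_ e1 e2 e3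
  rw [RingHom.comp_assoc, comm]
  ext r
  exact germ_appLE h hz r

namespace NodeChart

variable {f : X ⟶ S} (c : NodeChart f)

/-- The first coordinate of a node chart. -/
def s : Γ(X, c.U) := c.θ (NodeAlgebra.x c.a)

/-- The second coordinate of a node chart. -/
def t : Γ(X, c.U) := c.θ (NodeAlgebra.y c.a)

lemma s_mul_t : c.s * c.t = f.appLE c.V c.U c.le c.a := by
  rw [s, t, ← map_mul, NodeAlgebra.x_mul_y]
  exact RingHom.congr_fun c.comm _

lemma isNode {z : X} (hz : z ∈ c.U) (hs : ¬ IsUnit (X.presheaf.germ c.U z hz c.s))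
    (ht : ¬ IsUnit (X.presheaf.germ c.U z hz c.t)) :
    IsNode (f.stalkMap z).hom (S.presheaf.germ c.V (f z) (c.le hz) c.a)
      (X.presheaf.germ c.U z hz c.s) (X.presheaf.germ c.U z hz c.t) := by
  obtain ⟨e1, e2, e3⟩ := c.etale.germ hz
  let : Algebra Γ(S, c.V) (S.presheaf.stalk (f z)) :=
    (S.presheaf.germ c.V (f z) (c.le hz)).hom.toAlgebra
  have : IsLocalization.AtPrime (S.presheaf.stalk (f z))
      (c.hV.primeIdealOf ⟨f z, c.le hz⟩).asIdeal := c.hV.isLocalization_stalk ⟨f z, c.le hz⟩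
  refine isNode_of_chart (c.hV.primeIdealOf ⟨f z, c.le hz⟩).asIdeal.primeCompl ?_ e1 e2 e3 hs ht
  rw [RingHom.comp_assoc, c.comm]
  ext r
  exact germ_appLE c.le hz r

/-- Exchange of the coordinates. -/
def swap : NodeChart f where
  U := c.U
  V := c.V
  hV := c.hV
  le := c.le
  a := c.a
  θ := c.θ.comp (NodeAlgebra.swap c.a : NodeAlgebra Γ(S, c.V) c.a →+* NodeAlgebra Γ(S, c.V) c.a)
  comm := by
    rw [← c.comm]
    ext r
    simp
  etale := c.etale.comp (RingHom.Etale.of_bijective (NodeAlgebra.swap c.a).bijective)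

/-- On the open set where `s` is invertible the chart factors through the localization at `x`, which
is étale over the affine line. -/
lemma isCurvePoint_of_isUnit_s {z : X} (hz : z ∈ c.U) (hs : IsUnit (X.presheaf.germ c.U z hz c.s)) :
    IsCurvePoint (f.stalkMap z).hom := by
  let W := X.basicOpen c.s
  have hWU : W ≤ c.U := X.basicOpen_le _
  let ρ := (X.presheaf.map (homOfLE hWU).op).hom
  have hu : IsUnit (ρ c.s) := RingedSpace.isUnit_res_basicOpen X.toRingedSpace c.s
  have hzW : z ∈ W := (X.mem_basicOpen c.s z hz).mpr hs
  obtain ⟨ψ, hψ, hψC, hψX⟩ := NodeAlgebra.exists_etale_away_x c.a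
  let θ' : Localization.Away (NodeAlgebra.x c.a) →+* Γ(X, W) :=
    IsLocalization.Away.lift (NodeAlgebra.x c.a) (g := ρ.comp c.θ) hu
  have hθ' : θ'.comp (algebraMap _ _) = ρ.comp c.θ := IsLocalization.Away.lift_comp _ _
  have hetL : (algebraMap (NodeAlgebra Γ(S, c.V) c.a)
      (Localization.Away (NodeAlgebra.x c.a))).Etale := RingHom.etale_algebraMap.mpr
    (Algebra.Etale.of_isLocalizationAway (NodeAlgebra.x c.a))
  have h1 : IsEtaleChart W θ' := IsEtaleChart.of_comp hetL (by
    rw [hθ']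
    exact c.etale.res hWU)
  refine isCurvePoint_stalkMap c.hV (hWU.trans c.le) (θ := θ'.comp ψ) ?_ (h1.comp hψ) hzW
  rw [RingHom.comp_assoc, hψC, ← RingHom.comp_assoc, hθ', RingHom.comp_assoc, c.comm,
    ← CommRingCat.hom_comp, Scheme.Hom.appLE_map]

lemma isCurvePoint {z : X} (hz : z ∈ c.U) (h : IsUnit (X.presheaf.germ c.U z hz c.s) ∨
    IsUnit (X.presheaf.germ c.U z hz c.t)) : IsCurvePoint (f.stalkMap z).hom := by
  obtain h | h := h
  · exact c.isCurvePoint_of_isUnit_s hz h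
  · refine c.swap.isCurvePoint_of_isUnit_s hz ?_
    have : c.swap.s = c.t := congr(c.θ $(NodeAlgebra.swap_x (a := c.a)))
    rw [this]
    exact h

end NodeChart

end ChartsAtPoints

/-! ### Factorizations into primes, as ordered words. -/

section Words

variable {R : Type u} [CommRing R]

open Classical in
/-- The word of prime elements of a list of elements, up to units. -/
def primeWord (l : List R) : List (Associates R) :=
  (l.filter fun r => ¬ IsUnit r).map Associates.mk

lemma primeWord_prod (l : List R) : (primeWord l).prod = Associates.mk l.prod := by
  induction l with
  | nil => rfl
  | cons r l ih =>
    rw [List.prod_cons, ← Associates.mk_mul_mk, ← ih, primeWord]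
    by_cases hr : IsUnit r
    · rw [List.filter_cons_of_neg (by simpa using hr), Associates.mk_eq_one.mpr hr, one_mul]
      rfl
    · rw [List.filter_cons_of_pos (by simpa using hr), List.map_cons, List.prod_cons]
      rfl

/-- A prefix of a filtered list is the filtered list of a prefix. The index may change, since the
units may sit at different places in the two lists. -/
lemma primeWord_isPrefix {l l' : List R} (h : primeWord l = primeWord l') (j : ℕ) :
    ∃ j', primeWord (l.take j) = primeWord (l'.take j') := by
  have h1 : primeWord (l.take j) <+: primeWord l' := by
    rw [← h]
    exact ((show l.take j <+: l from ⟨_, List.take_append_drop j l⟩).filter _).map _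
  obtain ⟨l₁, hl₁, h2⟩ := List.prefix_map_iff.mp h1
  obtain ⟨l₂, hl₂, rfl⟩ := List.prefix_filter_iff.mp hl₁
  obtain ⟨j', rfl⟩ : ∃ j', l₂ = l'.take j' := ⟨_, List.prefix_iff_eq_take.mp hl₂⟩
  exact ⟨j', h2⟩

/-- Two factorizations into units and primes, sorted by a key which separates the primes, have the
same partial products up to units. -/
lemma exists_associated_take [IsDomain R] {G : Type*} [LinearOrder G] (key : R → G)
    {l l' : List R}
    (hkey : ∀ p q, Associated p q → key p = key q)
    (hinj : ∀ p ∈ l, ∀ q ∈ l, Prime p → Prime q → key p = key q → Associated p q)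
    (hl : ∀ r ∈ l, IsUnit r ∨ Prime r) (hl' : ∀ r ∈ l', IsUnit r ∨ Prime r)
    (hs : l.Pairwise fun r r' => ¬ IsUnit r → ¬ IsUnit r' → key r ≤ key r')
    (hs' : l'.Pairwise fun r r' => ¬ IsUnit r → ¬ IsUnit r' → key r ≤ key r')
    (hprod : Associated l.prod l'.prod) (j : ℕ) :
    ∃ j', Associated (l.take j).prod (l'.take j').prod := by
  classical
  let K : Associates R → G := Quotient.lift key hkey
  have hprime {l : List R} (hl : ∀ r ∈ l, IsUnit r ∨ Prime r) : ∀ P ∈ primeWord l, Prime P := by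
    intro P hP
    obtain ⟨r, hr, rfl⟩ := List.mem_map.mp hP
    rw [List.mem_filter] at hr
    exact Associates.prime_mk.mpr ((hl r hr.1).resolve_left (by simpa using hr.2))
  have hsort {l : List R}
      (hs : l.Pairwise fun r r' => ¬ IsUnit r → ¬ IsUnit r' → key r ≤ key r') :
      (primeWord l).Pairwise fun P Q => K P ≤ K Q := by
    rw [primeWord, List.pairwise_map, List.pairwise_filter]
    refine hs.imp fun h hr hr' => h (by simpa using hr) (by simpa using hr')
  have hperm : (primeWord l).Perm (primeWord l') := by
    rw [← Multiset.coe_eq_coe, ← Multiset.rel_eq]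
    have := prime_factors_unique (f := (primeWord l : Multiset (Associates R)))
      (g := (primeWord l' : Multiset (Associates R))) (hprime hl) (hprime hl') (by
        rw [Multiset.prod_coe, Multiset.prod_coe, primeWord_prod, primeWord_prod,
          Associates.mk_eq_mk_iff_associated.mpr hprod])
    exact this.mono fun _ _ _ _ h => associated_iff_eq.mp h
  -- Unique factorization gives a permutation; two sorted lists that are permutations of each other
  -- agree, because equal keys force equality up to units.
  have heq : primeWord l = primeWord l' := by
    refine hperm.eq_of_pairwise (le := fun P Q => K P ≤ K Q) ?_ (hsort hs) (hsort hs')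
    intro P Q hP hQ h1 h2
    rw [← hperm.mem_iff] at hQ
    obtain ⟨p, hp, rfl⟩ := List.mem_map.mp hP
    obtain ⟨q, hq, rfl⟩ := List.mem_map.mp hQ
    rw [List.mem_filter] at hp hq
    exact Associates.mk_eq_mk_iff_associated.mpr (hinj p hp.1 q hq.1
      ((hl p hp.1).resolve_left (by simpa using hp.2))
      ((hl q hq.1).resolve_left (by simpa using hq.2)) (le_antisymm h1 h2))
  obtain ⟨j', hj'⟩ := primeWord_isPrefix heq j
  refine ⟨j', ?_⟩
  rw [← Associates.mk_eq_mk_iff_associated, ← primeWord_prod, ← primeWord_prod, hj']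

/-- A divisor of a product of primes is a partial product up to units. -/
lemma exists_associated_of_dvd_prod [IsDomain R] {ι : Type*} (p : ι → R) {s : List ι}
    (hp : ∀ i ∈ s, Prime (p i)) {a : R} (ha : a ∣ (s.map p).prod) :
    ∃ s' : List ι, (∀ i ∈ s', i ∈ s) ∧ Associated a (s'.map p).prod := by
  induction s generalizing a with
  | nil => exact ⟨[], by simp, by simpa using isUnit_of_dvd_one ha⟩
  | cons i s ih =>
    rw [List.map_cons, List.prod_cons] at ha
    have hpi := hp i (by simp)
    replace ih := fun {a} => @ih (fun i hi => hp i (by simp [hi])) a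
    by_cases h : p i ∣ a
    · obtain ⟨b, rfl⟩ := h
      obtain ⟨s', hs', h'⟩ := ih ((mul_dvd_mul_iff_left hpi.ne_zero).mp ha)
      refine ⟨i :: s', ?_, ?_⟩
      · intro k hk
        rw [List.mem_cons] at hk ⊢
        exact hk.imp id (hs' k)
      · rw [List.map_cons, List.prod_cons]
        exact h'.mul_left _
    · obtain ⟨b, hb⟩ := ha
      obtain ⟨c, rfl⟩ := (hpi.dvd_or_dvd (Dvd.intro _ hb)).resolve_left h
      obtain ⟨s', hs', h'⟩ := ih (a := a) ⟨c, mul_left_cancel₀ hpi.ne_zero (by rw [hb]; ring)⟩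
      exact ⟨s', fun k hk => List.mem_cons_of_mem _ (hs' k hk), h'⟩

end Words

/-! ### Spreading out primality from a local ring. -/

section SpreadingOut

open IsLocalRing

variable {B : Type u} [CommRing B]

/-- If the ideal `I` becomes prime in the local ring at `p`, then in a neighborhood of `p` it
agrees with a fixed prime ideal. -/
lemma exists_prime_spread [IsNoetherianRing B] (p : Ideal B) [p.IsPrime] (I : Ideal B)
    {O : Type u} [CommRing O] [Algebra B O] [IsLocalization.AtPrime O p]
    (hI : (I.map (algebraMap B O)).IsPrime) :
    ∃ (Q : Ideal B) (b : B), Q.IsPrime ∧ b ∉ p ∧ Q = (I.map (algebraMap B O)).comap (algebraMap B O) ∧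
      ∀ (O' : Type u) [CommRing O'] (g : B →+* O'), IsUnit (g b) → I.map g = Q.map g := by
  let Q := (I.map (algebraMap B O)).comap (algebraMap B O)
  have hfg : Q.FG := IsNoetherian.noetherian Q
  obtain ⟨T, hT⟩ := hfg
  -- Each element of `Q` falls into `I` after multiplication by something outside `p`; the product
  -- over finitely many generators serves as the common denominator `b`.
  have h1 : ∀ q ∈ Q, ∃ b ∉ p, b * q ∈ I := by
    intro q hq
    have h2 : algebraMap B O q ∈ I.map (algebraMap B O) := hq
    obtain ⟨⟨i, m⟩, hm⟩ := (IsLocalization.mem_map_algebraMap_iff p.primeCompl O).mp h2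
    rw [← map_mul] at hm
    obtain ⟨c, hc⟩ := (IsLocalization.eq_iff_exists p.primeCompl O).mp hm
    refine ⟨c * m, (c * m).2, ?_⟩
    have : (c : B) * m * q = c * i := by rw [← hc]; ring
    rw [this]
    exact Ideal.mul_mem_left _ _ i.2
  choose! b hb hbI using h1
  have hTQ : ∀ q ∈ T, q ∈ Q := fun q hq => hT ▸ Ideal.subset_span hq
  refine ⟨Q, ∏ q ∈ T, b q, Ideal.IsPrime.comap _, ?_, rfl, ?_⟩
  · rw [Ideal.IsPrime.prod_mem_iff]
    rintro ⟨q, hq, h⟩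
    exact hb q (hTQ q hq) h
  · intro O' _ g hg
    refine le_antisymm (Ideal.map_mono Ideal.le_comap_map) ?_
    rw [← hT]
    rw [Ideal.map_span, Ideal.span_le]
    rintro _ ⟨q, hq, rfl⟩
    have h2 : IsUnit (g (b q)) := isUnit_of_dvd_unit (map_dvd g (Finset.dvd_prod_of_mem b hq)) hg
    have h3 := Ideal.mem_map_of_mem g (hbI q (hTQ q hq))
    rw [map_mul] at h3
    exact (Ideal.unit_mul_mem_iff_mem _ h2).mp h3

end SpreadingOut

/-! ### Keys ordering the discriminant, sorted charts, and their comparison. -/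

section Keys

open IsLocalRing

/-- An arbitrary linear order on the points of a scheme. -/
instance pointOrder (X : Scheme.{u}) : LinearOrder X :=
  open Classical in linearOrderOfSTO (WellOrderingRel (α := X))

variable {X S : Scheme.{u}}

open Classical in
/-- The generization of `z` given by a prime ideal of the local ring. -/
def idealPoint (z : X) (I : Ideal (X.presheaf.stalk z)) : X :=
  if h : I.IsPrime then X.fromSpecStalk z ⟨I, h⟩ else z

lemma idealPoint_of_isPrime {z : X} {I : Ideal (X.presheaf.stalk z)} (h : I.IsPrime) :
    idealPoint z I = X.fromSpecStalk z ⟨I, h⟩ := dif_pos h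

lemma idealPoint_inj {z : X} {I J : Ideal (X.presheaf.stalk z)} (hI : I.IsPrime) (hJ : J.IsPrime)
    (h : idealPoint z I = idealPoint z J) : I = J := by
  rw [idealPoint_of_isPrime hI, idealPoint_of_isPrime hJ] at h
  exact congr(PrimeSpectrum.asIdeal $((X.fromSpecStalk z).isEmbedding.injective h))

/-- The key by which the components `r` of the discriminant through a node with branches `s`, `t`
are ordered. It changes its sign if the branches are exchanged. -/
def branchKey (f : X ⟶ S) (z : X) (s t : X.presheaf.stalk z) (r : S.presheaf.stalk (f z)) :
    Lex (X →₀ ℤ) :=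
  toLex (Finsupp.single (idealPoint z (Ideal.span {s, f.stalkMap z r})) 1 -
    Finsupp.single (idealPoint z (Ideal.span {t, f.stalkMap z r})) 1)

lemma span_singleton_eq_of_associated {O : Type*} [CommRing O] {s s' : O} (h : Associated s s') :
    Ideal.span {s} = Ideal.span {s'} :=
  le_antisymm ((Ideal.span_singleton_le_span_singleton).mpr h.dvd')
    ((Ideal.span_singleton_le_span_singleton).mpr h.dvd)

lemma span_pair_congr {O : Type*} [CommRing O] {s s' r r' : O} (h : Associated s s')
    (h' : Associated r r') : Ideal.span {s, r} = Ideal.span {s', r'} := by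
  rw [Ideal.span_insert, Ideal.span_insert, span_singleton_eq_of_associated h,
    span_singleton_eq_of_associated h']

variable {f : X ⟶ S} {z : X}

lemma branchKey_congr {s s' t t' : X.presheaf.stalk z} {r r' : S.presheaf.stalk (f z)}
    (hs : Associated s s') (ht : Associated t t') (hr : Associated r r') :
    branchKey f z s t r = branchKey f z s' t' r' := by
  have h1 : Associated (f.stalkMap z r) (f.stalkMap z r') := hr.map (f.stalkMap z).hom
  rw [branchKey, branchKey, span_pair_congr hs h1, span_pair_congr ht h1]

lemma branchKey_swap (s t : X.presheaf.stalk z) (r : S.presheaf.stalk (f z)) :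
    branchKey f z t s r = - branchKey f z s t r := by
  rw [branchKey, branchKey, ← toLex_neg, neg_sub]

/-- At `a` the left side takes the value `1`, while the right side is positive only at `a'`. Thus a
nonzero key determines its positive point. -/
lemma eq_of_single_sub_single {α : Type*} {a b a' b' : α} (hab : a ≠ b)
    (h : Finsupp.single a (1 : ℤ) - Finsupp.single b 1 =
      Finsupp.single a' 1 - Finsupp.single b' 1) : a = a' := by
  classical
  have h1 := DFunLike.congr_fun h a
  simp only [Finsupp.sub_apply, Finsupp.single_apply] at h1
  by_contra hne
  rw [if_pos trivial, if_neg hab.symm, if_neg (Ne.symm hne)] at h1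
  split_ifs at h1 <;> omega

/-- The two branches over `r` are distinct, so the key determines the prime `(s, r)`. Its
contraction to the base is `(a, r) = (r)`, which recovers `r` up to a unit. -/
lemma associated_of_branchKey_eq [IsDomain (S.presheaf.stalk (f z))]
    {a : S.presheaf.stalk (f z)} {s t : X.presheaf.stalk z}
    (h : IsNode (f.stalkMap z).hom a s t) {r r' : S.presheaf.stalk (f z)}
    (hr : r ∣ a) (hr' : r' ∣ a) (hru : ¬ IsUnit r)
    (hs : (Ideal.span {s, f.stalkMap z r}).IsPrime) (ht : (Ideal.span {t, f.stalkMap z r}).IsPrime)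
    (hs' : (Ideal.span {s, f.stalkMap z r'}).IsPrime)
    (hkey : branchKey f z s t r = branchKey f z s t r') : Associated r r' := by
  have hne : idealPoint z (Ideal.span {s, f.stalkMap z r}) ≠
      idealPoint z (Ideal.span {t, f.stalkMap z r}) := by
    intro h1
    have h2 := idealPoint_inj hs ht h1
    refine h.t_notMem hr hru ?_
    change t ∈ Ideal.span {s, f.stalkMap z r}
    rw [h2]
    exact Ideal.subset_span (by simp)
  have h1 := idealPoint_inj hs hs' (eq_of_single_sub_single hne (toLex.injective hkey))
  have key {p q : S.presheaf.stalk (f z)} (hp : p ∣ a)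
      (h2 : Ideal.span {s, f.stalkMap z p} = Ideal.span {s, f.stalkMap z q}) : p ∣ q := by
    have h3 : f.stalkMap z q ∈ Ideal.span {s, f.stalkMap z p} := by
      rw [h2]
      exact Ideal.subset_span (by simp)
    have h4 := h.mem_span_pair (r := q) (τ := p) (Ideal.span_mono (by
      rintro _ (rfl | rfl)
      · simp
      · exact Or.inr (Or.inr rfl)) h3)
    obtain ⟨b, c, hbc⟩ := Ideal.mem_span_pair.mp h4
    rw [← hbc]
    exact dvd_add (hp.mul_left _) (dvd_mul_left _ _)
  exact associated_of_dvd_dvd (key hr h1) (key hr' h1.symm)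

/-- A node chart with a factorization of the discriminant into elements which are units or prime
at the nodes, sorted by the keys at all nodes. -/
structure SortedChart (f : X ⟶ S) extends NodeChart f where
  τ : List Γ(S, V)
  prod_eq : τ.prod = a
  mem_nonZeroDivisors : a ∈ nonZeroDivisors Γ(S, V)
  primes : ∀ (z : X) (hz : z ∈ U), ¬ IsUnit (X.presheaf.germ U z hz toNodeChart.s) →
    ¬ IsUnit (X.presheaf.germ U z hz toNodeChart.t) → ∀ r ∈ τ,
      IsUnit (S.presheaf.germ V (f z) (le hz) r) ∨ (Prime (S.presheaf.germ V (f z) (le hz) r) ∧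
        (Ideal.span {X.presheaf.germ U z hz toNodeChart.s,
          f.stalkMap z (S.presheaf.germ V (f z) (le hz) r)}).IsPrime ∧
        (Ideal.span {X.presheaf.germ U z hz toNodeChart.t,
          f.stalkMap z (S.presheaf.germ V (f z) (le hz) r)}).IsPrime)
  sorted : ∀ (z : X) (hz : z ∈ U), ¬ IsUnit (X.presheaf.germ U z hz toNodeChart.s) →
    ¬ IsUnit (X.presheaf.germ U z hz toNodeChart.t) → τ.Pairwise fun r r' =>
      ¬ IsUnit (S.presheaf.germ V (f z) (le hz) r) → ¬ IsUnit (S.presheaf.germ V (f z) (le hz) r') →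
      branchKey f z (X.presheaf.germ U z hz toNodeChart.s) (X.presheaf.germ U z hz toNodeChart.t)
        (S.presheaf.germ V (f z) (le hz) r) ≤
      branchKey f z (X.presheaf.germ U z hz toNodeChart.s) (X.presheaf.germ U z hz toNodeChart.t)
        (S.presheaf.germ V (f z) (le hz) r')

namespace SortedChart

variable (c c' : SortedChart f)

/-- The germ of `s` at a point. -/
abbrev sz (hz : z ∈ c.U) : X.presheaf.stalk z := X.presheaf.germ c.U z hz c.s

/-- The germ of `t` at a point. -/
abbrev tz (hz : z ∈ c.U) : X.presheaf.stalk z := X.presheaf.germ c.U z hz c.t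

/-- The word of the discriminant at a point. -/
def word (hz : z ∈ c.U) : List (S.presheaf.stalk (f z)) :=
  c.τ.map (S.presheaf.germ c.V (f z) (c.le hz)).hom

/-- A partial product of the discriminant at a point. -/
abbrev part (hz : z ∈ c.U) (j : ℕ) : S.presheaf.stalk (f z) := ((c.word hz).take j).prod

lemma word_prod (hz : z ∈ c.U) :
    (c.word hz).prod = S.presheaf.germ c.V (f z) (c.le hz) c.a := by
  rw [word, List.prod_hom, c.prod_eq]

lemma part_dvd (hz : z ∈ c.U) (j : ℕ) :
    c.part hz j ∣ S.presheaf.germ c.V (f z) (c.le hz) c.a := by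
  rw [← c.word_prod hz, ← List.prod_take_mul_prod_drop (c.word hz) j]
  exact dvd_mul_right _ _

lemma mem_word_dvd (hz : z ∈ c.U) {r} (hr : r ∈ c.word hz) :
    r ∣ S.presheaf.germ c.V (f z) (c.le hz) c.a := by
  rw [← c.word_prod hz]
  exact List.dvd_prod hr

lemma sz_mul_tz (hz : z ∈ c.U) :
    c.sz hz * c.tz hz = f.stalkMap z (S.presheaf.germ c.V (f z) (c.le hz) c.a) := by
  rw [sz, tz, ← map_mul, c.s_mul_t, germ_appLE]

/-- On a local ring, the branch `s` is comparable to the partial products of the discriminant. -/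
def Adapted (hz : z ∈ c.U) {O : Type u} [CommRing O] (ψ : X.presheaf.stalk z →+* O) : Prop :=
  ∀ j, ψ (f.stalkMap z (c.part hz j)) ∣ ψ (c.sz hz) ∨ ψ (c.sz hz) ∣ ψ (f.stalkMap z (c.part hz j))

/-- A node is not formally smooth over the base, so no other chart can have an invertible coordinate
there. -/
lemma isNode' {hz : z ∈ c.U} (hs : ¬ IsUnit (c.sz hz)) (ht : ¬ IsUnit (c.tz hz))
    (hz' : z ∈ c'.U) : IsNode (f.stalkMap z).hom (S.presheaf.germ c'.V (f z) (c'.le hz') c'.a)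
      (c'.sz hz') (c'.tz hz') := by
  have h1 := c.isNode hz hs ht
  by_cases h2 : IsUnit (c'.sz hz') ∨ IsUnit (c'.tz hz')
  · exact (h1.not_formallySmooth (c'.isCurvePoint hz' h2).formallySmooth).elim
  · rw [not_or] at h2
    exact c'.isNode hz' h2.1 h2.2

/-- The product `s' t'` lies in `(s, t)`, whose contraction to the base is `(a)`; the argument is
symmetric. -/
lemma discriminant_associated [IsDomain (S.presheaf.stalk (f z))]
    {a a' : S.presheaf.stalk (f z)} {s t s' t' : X.presheaf.stalk z}
    (h : IsNode (f.stalkMap z).hom a s t) (h' : IsNode (f.stalkMap z).hom a' s' t') :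
    Associated a a' := by
  have key {a a' : S.presheaf.stalk (f z)} {s t s' t' : X.presheaf.stalk z}
      (h : IsNode (f.stalkMap z).hom a s t) (h' : IsNode (f.stalkMap z).hom a' s' t') : a ∣ a' := by
    rw [← Ideal.mem_span_singleton]
    refine h.mem_span_a ?_
    rw [← h'.mul]
    exact Ideal.mul_mem_right _ _ (h.mem_span_pair_of_isNode h').1
  exact associated_of_dvd_dvd (key h h') (key h' h)

lemma word_primes {hz : z ∈ c.U} (hs : ¬ IsUnit (c.sz hz)) (ht : ¬ IsUnit (c.tz hz)) :
    ∀ r ∈ c.word hz, IsUnit r ∨ Prime r := by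
  intro r hr
  obtain ⟨r, hr₁, rfl⟩ := List.mem_map.mp hr
  exact (c.primes z hz hs ht r hr₁).imp id fun h => h.1

lemma word_sorted {hz : z ∈ c.U} (hs : ¬ IsUnit (c.sz hz)) (ht : ¬ IsUnit (c.tz hz)) :
    (c.word hz).Pairwise fun r r' => ¬ IsUnit r → ¬ IsUnit r' →
      branchKey f z (c.sz hz) (c.tz hz) r ≤ branchKey f z (c.sz hz) (c.tz hz) r' := by
  rw [word, List.pairwise_map]
  exact c.sorted z hz hs ht

lemma word_separated [IsDomain (S.presheaf.stalk (f z))] {hz : z ∈ c.U}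
    (hs : ¬ IsUnit (c.sz hz)) (ht : ¬ IsUnit (c.tz hz)) :
    ∀ p ∈ c.word hz, ∀ q ∈ c.word hz, Prime p → Prime q →
      branchKey f z (c.sz hz) (c.tz hz) p = branchKey f z (c.sz hz) (c.tz hz) q →
      Associated p q := by
  intro p hp q hq hp' hq' h
  have hpa := c.mem_word_dvd hz hp
  have hqa := c.mem_word_dvd hz hq
  obtain ⟨p, hp₁, rfl⟩ := List.mem_map.mp hp
  obtain ⟨q, hq₁, rfl⟩ := List.mem_map.mp hq
  obtain ⟨-, h1, h2⟩ := (c.primes z hz hs ht p hp₁).resolve_left hp'.not_isUnit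
  obtain ⟨-, h3, h4⟩ := (c.primes z hz hs ht q hq₁).resolve_left hq'.not_isUnit
  exact associated_of_branchKey_eq (c.isNode hz hs ht) hpa hqa hp'.not_isUnit h1 h2 h3 h

/-- At a common node, the partial products for different charts agree, or they are complementary. -/
lemma part_comparison [IsDomain (S.presheaf.stalk (f z))] (hz : z ∈ c.U) (hz' : z ∈ c'.U)
    (hs : ¬ IsUnit (c.sz hz)) (ht : ¬ IsUnit (c.tz hz)) :
    (Associated (c.sz hz) (c'.sz hz') ∧ ∀ j, ∃ j', Associated (c.part hz j) (c'.part hz' j')) ∨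
    (Associated (c.sz hz) (c'.tz hz') ∧ ∀ j, ∃ j', Associated (c.part hz j * c'.part hz' j')
      (S.presheaf.germ c'.V (f z) (c'.le hz') c'.a)) := by
  have h := c.isNode hz hs ht
  have h' := c.isNode' c' hs ht hz'
  have ha := discriminant_associated h h'
  rw [← c.word_prod hz, ← c'.word_prod hz'] at ha
  obtain ⟨h1, h2⟩ | ⟨h1, h2⟩ := h.associated_or h'
  · refine Or.inl ⟨h1, fun j => ?_⟩
    refine exists_associated_take (branchKey f z (c.sz hz) (c.tz hz))
      (fun p q hpq => branchKey_congr (.refl _) (.refl _) hpq) (c.word_separated hs ht)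
      (c.word_primes hs ht) (c'.word_primes h'.s_mem h'.t_mem) (c.word_sorted hs ht) ?_ ha j
    have h3 (r) : branchKey f z (c.sz hz) (c.tz hz) r = branchKey f z (c'.sz hz') (c'.tz hz') r :=
      branchKey_congr h1 h2 (.refl _)
    simp only [h3]
    exact c'.word_sorted h'.s_mem h'.t_mem
  · refine Or.inr ⟨h2, fun j => ?_⟩
    -- Exchanging the branches negates the keys, so the second word is sorted for the first key
    -- after reversal.
    obtain ⟨j', hj'⟩ := exists_associated_take (branchKey f z (c.sz hz) (c.tz hz))
      (l' := (c'.word hz').reverse)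
      (fun p q hpq => branchKey_congr (.refl _) (.refl _) hpq) (c.word_separated hs ht)
      (c.word_primes hs ht)
      (fun r hr => c'.word_primes h'.s_mem h'.t_mem r (List.mem_reverse.mp hr))
      (c.word_sorted hs ht) (by
        have h3 (r) : branchKey f z (c.sz hz) (c.tz hz) r =
            - branchKey f z (c'.sz hz') (c'.tz hz') r := by
          rw [← branchKey_swap]
          exact branchKey_congr h2 h1 (.refl _)
        simp only [h3, neg_le_neg_iff]
        rw [List.pairwise_reverse]
        exact (c'.word_sorted h'.s_mem h'.t_mem).imp fun h hu hv => h hv hu)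
      (by rwa [List.prod_reverse]) j
    -- The first `j'` letters of the reversed word are the last `j'` letters of the word; the
    -- complementary partial product consists of the letters before them.
    refine ⟨(c'.word hz').length - j', ?_⟩
    rw [List.take_reverse, List.prod_reverse] at hj'
    rw [← c'.word_prod hz', ← List.prod_take_mul_prod_drop (c'.word hz')
      ((c'.word hz').length - j'), mul_comm (c.part hz j)]
    exact hj'.mul_left _

/-- Adaptedness does not depend on the chart. -/
theorem adapted_of_adapted [IsDomain (S.presheaf.stalk (f z))] {hz : z ∈ c.U} (hz' : z ∈ c'.U)
    {O : Type u} [CommRing O] [IsDomain O] {ψ : X.presheaf.stalk z →+* O}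
    (hO : ∀ r : S.presheaf.stalk (f z), r ≠ 0 → ψ (f.stalkMap z r) ≠ 0)
    (hc' : S.presheaf.germ c'.V (f z) (c'.le hz') c'.a ≠ 0)
    (h : c'.Adapted hz' ψ) : c.Adapted hz ψ := by
  intro j
  by_cases hs : IsUnit (c.sz hz)
  · exact Or.inr ((hs.map ψ).dvd)
  by_cases ht : IsUnit (c.tz hz)
  · left
    refine map_dvd ψ ?_
    rw [← ht.dvd_mul_right, sz_mul_tz]
    exact map_dvd (f.stalkMap z).hom (c.part_dvd hz j)
  let Φ := ψ.comp (f.stalkMap z).hom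
  have hΦ (r) : Φ r = ψ (f.stalkMap z r) := rfl
  obtain ⟨h1, h2⟩ | ⟨h1, h2⟩ := c.part_comparison c' hz hz' hs ht
  · obtain ⟨j', hj'⟩ := h2 j
    have h3 : Associated (Φ (c.part hz j)) (Φ (c'.part hz' j')) := hj'.map Φ
    have h4 : Associated (ψ (c.sz hz)) (ψ (c'.sz hz')) := h1.map ψ
    refine (h j').imp (fun h5 => ?_) (fun h5 => ?_)
    · exact (h3.dvd_iff_dvd_left.mpr h5).trans h4.dvd'
    · exact (h4.dvd_iff_dvd_left.mpr h5).trans h3.dvd'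
  · obtain ⟨j', hj'⟩ := h2 j
    have h4 : Associated (ψ (c.sz hz)) (ψ (c'.tz hz')) := h1.map ψ
    have h5 : ψ (c'.sz hz') * ψ (c'.tz hz') =
        Φ (S.presheaf.germ c'.V (f z) (c'.le hz') c'.a) := by
      rw [← map_mul, sz_mul_tz]
      rfl
    obtain ⟨w, hw⟩ : Associated (Φ (c.part hz j) * Φ (c'.part hz' j'))
        (Φ (S.presheaf.germ c'.V (f z) (c'.le hz') c'.a)) := by
      rw [← map_mul]
      exact hj'.map Φ
    have h6 := hO _ hc'
    rw [← hΦ] at h6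
    have h7 : Φ (c'.part hz' j') ≠ 0 := by
      rintro h8
      rw [h8, mul_zero, zero_mul] at hw
      exact h6 hw.symm
    have h8 : ψ (c'.sz hz') ≠ 0 := by
      rintro h8
      rw [h8, zero_mul] at h5
      exact h6 h5.symm
    -- Up to a unit, the product of the two coordinates and the product of the two complementary
    -- parts are both the discriminant. By cancellation, `part' ∣ s'` becomes `t' ∣ part`, and `s' ∣
    -- part'` becomes `part ∣ t'`.
    obtain ⟨e, he⟩ | ⟨e, he⟩ := h j'
    · right
      rw [← hΦ] at he
      refine h4.dvd.trans ⟨e * ↑w⁻¹, ?_⟩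
      rw [← hw, he] at h5
      have h9 : e * ψ (c'.tz hz') = Φ (c.part hz j) * w :=
        mul_left_cancel₀ h7 (by linear_combination h5)
      rw [← hΦ, ← mul_assoc, mul_comm _ e, h9, Units.mul_inv_cancel_right]
    · left
      rw [← hΦ] at he
      refine Dvd.dvd.trans ⟨e * w, ?_⟩ h4.dvd'
      rw [← hw, he] at h5
      exact mul_left_cancel₀ h8 (by rw [← hΦ]; linear_combination h5)

end SortedChart

end Keys

/-! ### Nodal families: the discriminant is supported on the divisor. -/

section Discriminant

open IsLocalRing

variable {X S : Scheme.{u}}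

lemma map_stalkIdeal (I : X.IdealSheafData) {x y : X} (h : x ⤳ y) :
    (stalkIdeal I y).map (X.presheaf.stalkSpecializes h).hom = stalkIdeal I x := by
  obtain ⟨U, hU, hyU, -⟩ := X.isBasis_affineOpens.exists_subset_of_mem_open
    (Set.mem_univ y) isOpen_univ
  obtain ⟨U, hUa, rfl⟩ := hU
  rw [stalkIdeal_eq_map I y ⟨U, hUa⟩ hyU, stalkIdeal_eq_map I x ⟨U, hUa⟩ (h.mem_open U.2 hyU),
    Ideal.map_map, ← CommRingCat.hom_comp, TopCat.Presheaf.germ_stalkSpecializes]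

lemma mem_support_iff_stalkIdeal (I : X.IdealSheafData) (x : X) :
    x ∈ I.support ↔ stalkIdeal I x ≤ maximalIdeal (X.presheaf.stalk x) := by
  obtain ⟨U, hU, hxU, -⟩ := X.isBasis_affineOpens.exists_subset_of_mem_open
    (Set.mem_univ x) isOpen_univ
  obtain ⟨U, hUa, rfl⟩ := hU
  rw [Scheme.IdealSheafData.mem_support_iff_of_mem (U := ⟨U, hUa⟩) hxU,
    stalkIdeal_eq_map I x ⟨U, hUa⟩ hxU, Ideal.map_le_iff_le_comap, Scheme.mem_zeroLocus_iff]
  refine forall₂_congr fun r _ => not_congr (X.mem_basicOpen r x hxU)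

/-- The prime ideals of the local ring at `z` are the kernels of the residue maps at its
generizations. -/
lemma exists_specializes_of_isPrime {z : X} (Q : Ideal (X.presheaf.stalk z)) [hQ : Q.IsPrime] :
    ∃ (z' : X) (h : z' ⤳ z), (maximalIdeal (X.presheaf.stalk z')).comap
      (X.presheaf.stalkSpecializes h).hom = Q := by
  let p : Spec (X.presheaf.stalk z) := ⟨Q, hQ⟩
  have h : X.fromSpecStalk z p ⤳ z := by
    have : X.fromSpecStalk z p ∈ Set.range (X.fromSpecStalk z) := ⟨p, rfl⟩
    rwa [Scheme.range_fromSpecStalk] at this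
  refine ⟨_, h, ?_⟩
  have h1 := congr($(Scheme.SpecMap_stalkSpecializes_fromSpecStalk h) (closedPoint _))
  exact congr(PrimeSpectrum.asIdeal $((X.fromSpecStalk z).isEmbedding.injective
    (h1.trans Scheme.fromSpecStalk_closedPoint)))

/-- A curve over a regular scheme which is smooth outside of a divisor with simple normal
crossings, and has a node chart at every other point. -/
structure NodalFamily (f : X ⟶ S) (D : S.IdealSheafData) : Prop where
  regular : IsRegularScheme S
  snc : IsSNCDivisor D
  finitePresentation : LocallyOfFinitePresentation f
  smooth : Smooth (f ∣_ openCompl D)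
  chart : ∀ x : X, IsCurvePoint (f.stalkMap x).hom ∨ ∃ c : NodeChart f, x ∈ c.U

namespace NodalFamily

variable {f : X ⟶ S} {D : S.IdealSheafData} (F : NodalFamily f D)
include F

lemma formallySmooth_stalkMap {x : X} (hx : f x ∉ D.support) :
    (f.stalkMap x).hom.FormallySmooth := by
  have := F.finitePresentation
  have := F.smooth
  have h1 := Scheme.Hom.preimage_smoothLocus_eq (f ⁻¹ᵁ openCompl D).ι f
  have h2 : ((f ⁻¹ᵁ openCompl D).ι ≫ f).smoothLocus = ⊤ := by
    have h3 : (f ⁻¹ᵁ openCompl D).ι ≫ f = f ∣_ openCompl D ≫ (openCompl D).ι :=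
      (morphismRestrict_ι f _).symm
    have : Smooth ((f ⁻¹ᵁ openCompl D).ι ≫ f) := by
      rw [h3]
      infer_instance
    exact Scheme.Hom.smoothLocus_eq_top _
  rw [h2] at h1
  have h3 : (⟨x, hx⟩ : (f ⁻¹ᵁ openCompl D).toScheme) ∈
      (f ⁻¹ᵁ openCompl D).ι ⁻¹ᵁ f.smoothLocus := by
    rw [h1]
    trivial
  exact h3

lemma mem_support_of_isNode {z : X} {a : S.presheaf.stalk (f z)} {s t : X.presheaf.stalk z}
    (h : IsNode (f.stalkMap z).hom a s t) : f z ∈ D.support := by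
  by_contra h1
  exact h.not_formallySmooth (F.formallySmooth_stalkMap h1)

/-- The discriminant divides a power of the equation of the divisor. -/
lemma dvd_pow (c : NodeChart f) {z : X} (hz : z ∈ c.U)
    (hs : ¬ IsUnit (X.presheaf.germ c.U z hz c.s)) (ht : ¬ IsUnit (X.presheaf.germ c.U z hz c.t))
    {d : S.presheaf.stalk (f z)} (hd : d ∈ stalkIdeal D (f z)) :
    ∃ n, S.presheaf.germ c.V (f z) (c.le hz) c.a ∣ d ^ n := by
  have h1 : f.stalkMap z d ∈ (Ideal.span {X.presheaf.germ c.U z hz c.s,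
      X.presheaf.germ c.U z hz c.t}).radical := by
    -- A prime containing both branches is a generization `z'` of `z` which is again a node. It
    -- therefore lies over `D`, where `d` vanishes.
    rw [Ideal.radical_eq_sInf, Ideal.mem_sInf]
    rintro Q ⟨hQ, hQp⟩
    obtain ⟨z', h, rfl⟩ := exists_specializes_of_isPrime Q
    have hz' : z' ∈ c.U := h.mem_open c.U.2 hz
    have key (r : Γ(X, c.U)) (hr : X.presheaf.germ c.U z hz r ∈
        (maximalIdeal (X.presheaf.stalk z')).comap (X.presheaf.stalkSpecializes h).hom) :
        ¬ IsUnit (X.presheaf.germ c.U z' hz' r) := by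
      have h2 : X.presheaf.stalkSpecializes h (X.presheaf.germ c.U z hz r) =
          X.presheaf.germ c.U z' hz' r := TopCat.Presheaf.germ_stalkSpecializes_apply ..
      rw [← h2]
      exact hr
    have h2 := F.mem_support_of_isNode (c.isNode hz' (key _ (hQ (Ideal.subset_span (by simp))))
      (key _ (hQ (Ideal.subset_span (by simp)))))
    rw [mem_support_iff_stalkIdeal, ← map_stalkIdeal D (f.base.hom.map_specializes h),
      Ideal.map_le_iff_le_comap] at h2
    have h3 := h2 hd
    rw [Ideal.mem_comap] at h3
    change X.presheaf.stalkSpecializes h (f.stalkMap z d) ∈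
      maximalIdeal (X.presheaf.stalk z')
    rw [← Scheme.Hom.stalkSpecializes_stalkMap_apply]
    exact map_nonunit (f.stalkMap z').hom _ h3
  obtain ⟨n, hn⟩ := h1
  refine ⟨n, ?_⟩
  rw [← Ideal.mem_span_singleton]
  refine (c.isNode hz hs ht).mem_span_a ?_
  rw [map_pow]
  exact hn

lemma isDomain (y : S) : IsDomain (S.presheaf.stalk y) :=
  have := F.regular.2 y
  IsRegularLocalRing.isDomain _

/-- The prime factors of the discriminant are equations of components of the divisor. -/
lemma exists_isRegularSystem {c : NodeChart f} {z : X} (hz : z ∈ c.U)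
    (hs : ¬ IsUnit (X.presheaf.germ c.U z hz c.s)) (ht : ¬ IsUnit (X.presheaf.germ c.U z hz c.t)) :
    ∃ (d : ℕ) (t : Fin d → S.presheaf.stalk (f z)) (J : Finset (Fin d)), IsRegularSystem t ∧
      stalkIdeal D (f z) = Ideal.span {∏ j ∈ J, t j} ∧
      (∃ n, S.presheaf.germ c.V (f z) (c.le hz) c.a ∣ (∏ j ∈ J, t j) ^ n) ∧
      ∀ r, Prime r → r ∣ S.presheaf.germ c.V (f z) (c.le hz) c.a → ∃ j ∈ J, Associated r (t j) := by
  have hsupp := F.mem_support_of_isNode (c.isNode hz hs ht)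
  obtain ⟨hreg, d, t, J, hdim, hspan, hJ⟩ := F.snc.2 _ hsupp
  have hsys : IsRegularSystem t := ⟨hspan, by simpa using hdim⟩
  obtain ⟨n, hn⟩ := F.dvd_pow c hz hs ht (d := ∏ j ∈ J, t j)
    (hJ ▸ Ideal.mem_span_singleton_self _)
  refine ⟨d, t, J, hsys, hJ, ⟨n, hn⟩, fun r hr hra => ?_⟩
  obtain ⟨j, hj, h1⟩ := (hr.dvd_finsetProd_iff _).mp (hr.dvd_of_dvd_pow (hra.trans hn))
  have := F.isDomain (f z)
  exact ⟨j, hj, hr.irreducible.associated_of_dvd (hsys.prime j).irreducible h1⟩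

end NodalFamily

end Discriminant

/-! ### The charts `x = e u`, `y = e' v`, `u v = τ` of the modification. -/

section Pieces

/-- The substitution `x ↦ e x`, `y ↦ e' y`. -/
def NodeAlgebra.rescale {R : Type u} [CommRing R] {a e τ e' : R} (h : e * τ * e' = a) :
    NodeAlgebra R a →+* NodeAlgebra R τ :=
  NodeAlgebra.lift (algebraMap R _) (algebraMap R _ e * NodeAlgebra.x τ)
    (algebraMap R _ e' * NodeAlgebra.y τ) (by
      rw [mul_mul_mul_comm, NodeAlgebra.x_mul_y, ← map_mul, ← map_mul, ← h, mul_right_comm])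

lemma NodeAlgebra.finiteType_rescale {R : Type u} [CommRing R] {a e τ e' : R}
    (h : e * τ * e' = a) : (NodeAlgebra.rescale h).FiniteType := by
  have h1 : (algebraMap R (NodeAlgebra R τ)).FiniteType := by
    rw [RingHom.finiteType_algebraMap]
    infer_instance
  have h2 : (NodeAlgebra.rescale h).comp (algebraMap R _) = algebraMap R (NodeAlgebra R τ) :=
    NodeAlgebra.lift_comp_algebraMap ..
  rw [← h2] at h1
  exact RingHom.FiniteType.of_comp_finiteType h1

namespace NodeChart

variable {X S : Scheme.{u}} {f : X ⟶ S} (c : NodeChart f) {e τ e' : Γ(S, c.V)}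
  (h : e * τ * e' = c.a)

/-- The chart `x = e u`, `y = e' v`, `u v = τ` of a modification of `X`, where the discriminant is
`e τ e'`. -/
def piece : Scheme.{u} :=
  pullback (specHom c.U c.θ) (Spec.map (CommRingCat.ofHom (NodeAlgebra.rescale h)))

/-- The projection of a piece to the chart. -/
def pieceFst : c.piece h ⟶ c.U.toScheme := pullback.fst _ _

/-- The projection of a piece to the model. -/
def pieceSnd : c.piece h ⟶ Spec (CommRingCat.of (NodeAlgebra Γ(S, c.V) τ)) := pullback.snd _ _

lemma piece_condition : c.pieceFst h ≫ specHom c.U c.θ =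
    c.pieceSnd h ≫ Spec.map (CommRingCat.ofHom (NodeAlgebra.rescale h)) := pullback.condition

lemma piece_hom_ext {T : Scheme.{u}} {g g' : T ⟶ c.piece h}
    (h1 : g ≫ c.pieceFst h = g' ≫ c.pieceFst h) (h2 : g ≫ c.pieceSnd h = g' ≫ c.pieceSnd h) :
    g = g' := pullback.hom_ext h1 h2

instance : Etale (c.pieceSnd h) := by
  have : Etale (specHom c.U c.θ) := c.etale
  exact inferInstanceAs (Etale (pullback.snd (specHom c.U c.θ)
    (Spec.map (CommRingCat.ofHom (NodeAlgebra.rescale h)))))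

instance : IsSeparated (c.pieceFst h) := by
  exact inferInstanceAs (IsSeparated (pullback.fst (specHom c.U c.θ)
    (Spec.map (CommRingCat.ofHom (NodeAlgebra.rescale h)))))

instance : QuasiCompact (c.pieceFst h) := by
  exact inferInstanceAs (QuasiCompact (pullback.fst (specHom c.U c.θ)
    (Spec.map (CommRingCat.ofHom (NodeAlgebra.rescale h)))))

instance : LocallyOfFiniteType (c.pieceFst h) := by
  have : LocallyOfFiniteType (Spec.map (CommRingCat.ofHom (NodeAlgebra.rescale h))) :=
    (HasRingHomProperty.Spec_iff (P := @LocallyOfFiniteType)).mpr (NodeAlgebra.finiteType_rescale h)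
  exact inferInstanceAs (LocallyOfFiniteType (pullback.fst (specHom c.U c.θ)
    (Spec.map (CommRingCat.ofHom (NodeAlgebra.rescale h)))))

/-- The projection of a piece. -/
def pieceHom : c.piece h ⟶ X := c.pieceFst h ≫ c.U.ι

instance : LocallyOfFiniteType (c.pieceHom h) := by
  rw [pieceHom]
  infer_instance

lemma top_le_pieceHom : (⊤ : (c.piece h).Opens) ≤ c.pieceHom h ⁻¹ᵁ c.U := fun p _ =>
  (c.pieceFst h p).2

lemma top_le_pieceHom_comp : (⊤ : (c.piece h).Opens) ≤ (c.pieceHom h ≫ f) ⁻¹ᵁ c.V := fun p hp => by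
  have h1 : c.pieceHom h p ∈ c.U := c.top_le_pieceHom h hp
  exact c.le h1

/-- The coordinates on a piece. -/
def pieceθ : NodeAlgebra Γ(S, c.V) τ →+* Γ(c.piece h, ⊤) :=
  (exists_eq_specHom ((⊤ : (c.piece h).Opens).ι ≫ c.pieceSnd h)).choose

lemma specHom_pieceθ :
    specHom ⊤ (c.pieceθ h) = (⊤ : (c.piece h).Opens).ι ≫ c.pieceSnd h :=
  (exists_eq_specHom ((⊤ : (c.piece h).Opens).ι ≫ c.pieceSnd h)).choose_spec.symm

lemma pieceθ_comp : (c.pieceθ h).comp (NodeAlgebra.rescale h) =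
    ((c.pieceHom h).appLE c.U ⊤ (c.top_le_pieceHom h)).hom.comp c.θ := by
  apply specHom_injective
  rw [← specHom_comp, specHom_pieceθ, ← resLE_specHom, Category.assoc, ← piece_condition,
    ← Category.assoc]
  congr 1
  rw [← cancel_mono c.U.ι, Scheme.Hom.resLE_comp_ι, Category.assoc]
  rfl

lemma pieceθ_comp_algebraMap : (c.pieceθ h).comp (algebraMap _ _) =
    ((c.pieceHom h ≫ f).appLE c.V ⊤ (c.top_le_pieceHom_comp h)).hom := by
  have h1 : algebraMap Γ(S, c.V) (NodeAlgebra Γ(S, c.V) τ) =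
    (NodeAlgebra.rescale h).comp (algebraMap _ _) := (NodeAlgebra.lift_comp_algebraMap ..).symm
  rw [h1, ← RingHom.comp_assoc, pieceθ_comp, RingHom.comp_assoc, c.comm, ← CommRingCat.hom_comp,
    Scheme.Hom.appLE_comp_appLE]

/-- The pieces are nodal. -/
def pieceChart : NodeChart (c.pieceHom h ≫ f) where
  U := ⊤
  V := c.V
  hV := c.hV
  le := c.top_le_pieceHom_comp h
  a := τ
  θ := c.pieceθ h
  comm := c.pieceθ_comp_algebraMap h
  etale := by
    rw [IsEtaleChart, specHom_pieceθ]
    infer_instance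

lemma appLE_s : (c.pieceHom h).appLE c.U ⊤ (c.top_le_pieceHom h) c.s =
    (c.pieceHom h ≫ f).appLE c.V ⊤ (c.top_le_pieceHom_comp h) e * c.pieceθ h (NodeAlgebra.x τ) := by
  have h1 := RingHom.congr_fun (c.pieceθ_comp h) (NodeAlgebra.x c.a)
  have h2 := RingHom.congr_fun (c.pieceθ_comp_algebraMap h) e
  refine h1.symm.trans ?_
  rw [RingHom.comp_apply, NodeAlgebra.rescale, NodeAlgebra.lift_x, map_mul]
  exact congr($h2 * c.pieceθ h (NodeAlgebra.x τ))

lemma appLE_t : (c.pieceHom h).appLE c.U ⊤ (c.top_le_pieceHom h) c.t =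
    (c.pieceHom h ≫ f).appLE c.V ⊤ (c.top_le_pieceHom_comp h) e' * c.pieceθ h (NodeAlgebra.y τ) := by
  have h1 := RingHom.congr_fun (c.pieceθ_comp h) (NodeAlgebra.y c.a)
  have h2 := RingHom.congr_fun (c.pieceθ_comp_algebraMap h) e'
  refine h1.symm.trans ?_
  rw [RingHom.comp_apply, NodeAlgebra.rescale, NodeAlgebra.lift_y, map_mul]
  exact congr($h2 * c.pieceθ h (NodeAlgebra.y τ))

/-- `u` and `v` define a morphism to the model of the piece; the first two equations are its
compatibility with the chart, so the fibre product provides the lift. -/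
lemma exists_pieceHom_lift {T : Scheme.{u}} (m : T ⟶ X) {N : T.Opens} (hN : N ≤ m ⁻¹ᵁ c.U)
    (hN' : N ≤ (m ≫ f) ⁻¹ᵁ c.V) {u v : Γ(T, N)}
    (hu : m.appLE c.U N hN c.s = (m ≫ f).appLE c.V N hN' e * u)
    (hv : m.appLE c.U N hN c.t = (m ≫ f).appLE c.V N hN' e' * v)
    (huv : u * v = (m ≫ f).appLE c.V N hN' τ) :
    ∃ g : N.toScheme ⟶ c.piece h, g ≫ c.pieceHom h = N.ι ≫ m := by
  have h1 : m.resLE c.U N hN ≫ specHom c.U c.θ =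
      specHom N (NodeAlgebra.lift ((m ≫ f).appLE c.V N hN').hom u v huv) ≫
        Spec.map (CommRingCat.ofHom (NodeAlgebra.rescale h)) := by
    rw [specHom_comp, resLE_specHom]
    congr 1
    refine NodeAlgebra.hom_ext ?_ ?_ ?_
    · rw [RingHom.comp_assoc, c.comm, RingHom.comp_assoc, NodeAlgebra.rescale,
        NodeAlgebra.lift_comp_algebraMap, NodeAlgebra.lift_comp_algebraMap, ← CommRingCat.hom_comp,
        Scheme.Hom.appLE_comp_appLE]
    · refine Eq.trans hu ?_
      simp [NodeAlgebra.rescale]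
    · refine Eq.trans hv ?_
      simp [NodeAlgebra.rescale]
  refine ⟨pullback.lift _ _ h1, ?_⟩
  refine Eq.trans ?_ (Scheme.Hom.resLE_comp_ι m hN)
  exact (Category.assoc _ _ _).symm.trans congr($(pullback.lift_fst _ _ h1) ≫ c.U.ι)

/-- The equations `x = e u` and `y = e' v` determine `u` and `v` as soon as `e` and `e'` are regular
on the source. This is the uniqueness needed for gluing. -/
lemma pieceHom_hom_ext {T : Scheme.{u}} {g g' : T ⟶ c.piece h}
    (h1 : g ≫ c.pieceHom h = g' ≫ c.pieceHom h)
    (he : ∀ {N : T.Opens} (hN : N ≤ (g ≫ c.pieceHom h ≫ f) ⁻¹ᵁ c.V),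
      (g ≫ c.pieceHom h ≫ f).appLE c.V N hN (e * e') ∈ nonZeroDivisors Γ(T, N)) : g = g' := by
  have h2 : g ≫ c.pieceFst h = g' ≫ c.pieceFst h := by
    rw [← cancel_mono c.U.ι, Category.assoc, Category.assoc]
    exact h1
  refine c.piece_hom_ext h h2 ?_
  have hle (g : T ⟶ c.piece h) : (⊤ : T.Opens) ≤ g ⁻¹ᵁ ⊤ := fun _ _ => trivial
  obtain ⟨α, hα₀⟩ : ∃ α : (T ⟶ c.piece h) → (NodeAlgebra Γ(S, c.V) τ →+* Γ(T, ⊤)),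
    ∀ g, α g = (g.appLE ⊤ ⊤ (hle g)).hom.comp (c.pieceθ h) := ⟨_, fun _ => rfl⟩
  have hα (g : T ⟶ c.piece h) : specHom ⊤ (α g) = (⊤ : T.Opens).ι ≫ g ≫ c.pieceSnd h := by
    rw [hα₀, ← resLE_specHom, specHom_pieceθ, ← Category.assoc, Scheme.Hom.resLE_comp_ι, Category.assoc]
  suffices h3 : α g = α g' by
    have h4 := (hα g).symm.trans ((congr(specHom ⊤ $h3)).trans (hα g'))
    exact (cancel_epi T.topIso.hom).mp h4
  have hN : (⊤ : T.Opens) ≤ (g ≫ c.pieceHom h ≫ f) ⁻¹ᵁ c.V := fun p _ => by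
    have h3 : g p ∈ (c.pieceHom h ≫ f) ⁻¹ᵁ c.V := c.top_le_pieceHom_comp h trivial
    exact h3
  have hN' : (⊤ : T.Opens) ≤ (g' ≫ c.pieceHom h ≫ f) ⁻¹ᵁ c.V := fun p _ => by
    have h3 : g' p ∈ (c.pieceHom h ≫ f) ⁻¹ᵁ c.V := c.top_le_pieceHom_comp h trivial
    exact h3
  have h4 : (α g).comp (algebraMap _ _) = ((g ≫ c.pieceHom h ≫ f).appLE c.V ⊤ hN).hom := by
    rw [hα₀, RingHom.comp_assoc, pieceθ_comp_algebraMap, ← CommRingCat.hom_comp,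
      Scheme.Hom.appLE_comp_appLE]
  have h4' : (α g').comp (algebraMap _ _) = ((g' ≫ c.pieceHom h ≫ f).appLE c.V ⊤ hN').hom := by
    rw [hα₀, RingHom.comp_assoc, pieceθ_comp_algebraMap, ← CommRingCat.hom_comp,
      Scheme.Hom.appLE_comp_appLE]
  have h5 : (α g).comp (NodeAlgebra.rescale h) = (α g').comp (NodeAlgebra.rescale h) := by
    apply specHom_injective
    rw [← specHom_comp, ← specHom_comp, hα, hα, Category.assoc, Category.assoc,
      Category.assoc, Category.assoc, ← piece_condition, reassoc_of% h2]
  have h6 : (α g).comp (algebraMap Γ(S, c.V) _) = (α g').comp (algebraMap _ _) := by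
    rw [h4, h4']
    congr 2
    exact (Category.assoc _ _ _).symm.trans (congr($h1 ≫ f).trans (Category.assoc _ _ _))
  have key (p : NodeAlgebra Γ(S, c.V) τ) (r : Γ(S, c.V)) (hr : r ∣ e * e')
      (hp : α g (algebraMap Γ(S, c.V) _ r * p) = α g' (algebraMap Γ(S, c.V) _ r * p)) : α g p = α g' p := by
    have h7 : α g (algebraMap _ _ r) = α g' (algebraMap _ _ r) := RingHom.congr_fun h6 r
    have h8 : α g (algebraMap _ _ r) = (g ≫ c.pieceHom h ≫ f).appLE c.V ⊤ hN r :=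
      RingHom.congr_fun h4 r
    have h9 : α g (algebraMap _ _ r) ∈ nonZeroDivisors Γ(T, ⊤) := by
      rw [h8]
      have := he hN
      obtain ⟨q, hq⟩ := hr
      rw [hq, map_mul] at this
      exact (mul_mem_nonZeroDivisors.mp this).1
    rw [map_mul, map_mul, ← h7] at hp
    exact (mul_cancel_left_mem_nonZeroDivisors h9).mp hp
  refine NodeAlgebra.hom_ext h6 (key _ e (Dvd.intro _ rfl) ?_) (key _ e' (Dvd.intro_left _ rfl) ?_)
  · have := RingHom.congr_fun h5 (NodeAlgebra.x c.a)
    simpa only [RingHom.comp_apply, NodeAlgebra.rescale, NodeAlgebra.lift_x] using this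
  · have := RingHom.congr_fun h5 (NodeAlgebra.y c.a)
    simpa only [RingHom.comp_apply, NodeAlgebra.rescale, NodeAlgebra.lift_y] using this

end NodeChart

end Pieces

/-! ### Lifting to a piece by divisibility. -/

section Lifts

variable {X S T : Scheme.{u}} {f : X ⟶ S}

lemma germ_mem_nonZeroDivisors {V : S.Opens} (hV : IsAffineOpen V) {a : Γ(S, V)}
    (ha : a ∈ nonZeroDivisors Γ(S, V)) {y : S} (hy : y ∈ V) :
    S.presheaf.germ V y hy a ∈ nonZeroDivisors (S.presheaf.stalk y) := by
  let : Algebra Γ(S, V) (S.presheaf.stalk y) := (S.presheaf.germ V y hy).hom.toAlgebra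
  have : IsLocalization.AtPrime (S.presheaf.stalk y) (hV.primeIdealOf ⟨y, hy⟩).asIdeal :=
    hV.isLocalization_stalk ⟨y, hy⟩
  exact IsLocalization.map_nonZeroDivisors_le (hV.primeIdealOf ⟨y, hy⟩).asIdeal.primeCompl _
    ⟨a, ha, rfl⟩

lemma map_mem_nonZeroDivisors_of_flat {A B : Type u} [CommRing A] [CommRing B] {φ : A →+* B}
    (hφ : φ.Flat) {a : A} (ha : a ∈ nonZeroDivisors A) : φ a ∈ nonZeroDivisors B := by
  rw [mem_nonZeroDivisors_iff_left]
  exact fun p hp => eq_zero_of_flat hφ ha hp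

/-- A section is determined by its germs, and flatness of the stalk maps keeps the germs of `a`
regular. -/
lemma appLE_mem_nonZeroDivisors (t : T ⟶ S) [Flat t] {V : S.Opens} (hV : IsAffineOpen V)
    {a : Γ(S, V)} (ha : a ∈ nonZeroDivisors Γ(S, V)) {N : T.Opens} (hN : N ≤ t ⁻¹ᵁ V) :
    t.appLE V N hN a ∈ nonZeroDivisors Γ(T, N) := by
  rw [mem_nonZeroDivisors_iff_left]
  intro b hb
  refine TopCat.Presheaf.section_ext T.sheaf N _ _ fun p hp => ?_
  have h1 := map_mem_nonZeroDivisors_of_flat (Flat.stalkMap t p)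
    (germ_mem_nonZeroDivisors hV ha (hN hp))
  have h2 := congr(T.presheaf.germ N p hp $hb)
  rw [map_mul, germ_appLE hN hp, map_zero] at h2
  refine (mem_nonZeroDivisors_iff_left.mp h1 _ h2).trans ?_
  exact (map_zero (T.presheaf.germ N p hp).hom).symm

lemma exists_dvd_of_germ_dvd {W : T.Opens} {x y : Γ(T, W)} {p : T} (hp : p ∈ W)
    (h : T.presheaf.germ W p hp x ∣ T.presheaf.germ W p hp y) :
    ∃ (N : T.Opens) (hN : N ≤ W), p ∈ N ∧
      T.presheaf.map (homOfLE hN).op x ∣ T.presheaf.map (homOfLE hN).op y := by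
  obtain ⟨u, hu⟩ := h
  obtain ⟨N₁, hp₁, u, rfl⟩ := T.presheaf.exists_germ_eq u
  let N₂ := N₁ ⊓ W
  have h₁ : N₂ ≤ N₁ := inf_le_left
  have h₂ : N₂ ≤ W := inf_le_right
  have hp₂ : p ∈ N₂ := ⟨hp₁, hp⟩
  have h3 : T.presheaf.germ N₂ p hp₂ (T.presheaf.map (homOfLE h₂).op y) =
      T.presheaf.germ N₂ p hp₂ (T.presheaf.map (homOfLE h₂).op x *
        T.presheaf.map (homOfLE h₁).op u) := by
    rw [map_mul, TopCat.Presheaf.germ_res_apply, TopCat.Presheaf.germ_res_apply,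
      TopCat.Presheaf.germ_res_apply, hu]
  obtain ⟨N, hpN, i, j, hij⟩ := T.presheaf.germ_eq p hp₂ hp₂ _ _ h3
  refine ⟨N, i.le.trans h₂, hpN, T.presheaf.map i.op (T.presheaf.map (homOfLE h₁).op u), ?_⟩
  obtain rfl : i = j := Subsingleton.elim _ _
  rw [map_mul] at hij
  have h4 (r : Γ(T, W)) (k : N ⟶ N₂) : T.presheaf.map k.op (T.presheaf.map (homOfLE h₂).op r) =
      T.presheaf.map (homOfLE (i.le.trans h₂)).op r := by
    rw [← CommRingCat.comp_apply, ← T.presheaf.map_comp]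
    rfl
  rw [← h4 _ i, ← h4 _ i, hij]

namespace NodeChart

variable (c : NodeChart f) {e τ e' : Γ(S, c.V)} (h : e * τ * e' = c.a)

/-- The quotients `u = s / e` and `v = e τ / s` exist near `p`. Flatness over `S` keeps `a`, hence
its divisors `e` and `s`, regular: cancelling `e` gives `u v = τ`, and cancelling `s` in `s t = e τ
e'` gives `t = e' v`. -/
lemma exists_lift_of_dvd (ha : c.a ∈ nonZeroDivisors Γ(S, c.V)) (m : T ⟶ X) [Flat (m ≫ f)] {p : T}
    (hp : m p ∈ c.U)
    (h1 : m.stalkMap p (f.stalkMap (m p) (S.presheaf.germ c.V (f (m p)) (c.le hp) e)) ∣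
      m.stalkMap p (X.presheaf.germ c.U (m p) hp c.s))
    (h2 : m.stalkMap p (X.presheaf.germ c.U (m p) hp c.s) ∣
      m.stalkMap p (f.stalkMap (m p) (S.presheaf.germ c.V (f (m p)) (c.le hp) (e * τ)))) :
    ∃ (N : T.Opens) (g : N.toScheme ⟶ c.piece h), p ∈ N ∧ g ≫ c.pieceHom h = N.ι ≫ m := by
  let W := m ⁻¹ᵁ c.U
  have hle {N : T.Opens} (hN : N ≤ W) : N ≤ (m ≫ f) ⁻¹ᵁ c.V := fun q hq => by
    have h3 : m q ∈ c.U := hN hq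
    exact c.le h3
  let ρ (N : T.Opens) (hN : N ≤ W) : Γ(S, c.V) →+* Γ(T, N) := ((m ≫ f).appLE c.V N (hle hN)).hom
  let σ (N : T.Opens) (hN : N ≤ W) : Γ(T, N) := m.appLE c.U N hN c.s
  have hσ (r) : T.presheaf.germ W p hp (m.appLE c.U W le_rfl r) =
      m.stalkMap p (X.presheaf.germ c.U (m p) hp r) := germ_appLE _ _ _
  have hρ (r : Γ(S, c.V)) : T.presheaf.germ W p hp (ρ W le_rfl r) =
      m.stalkMap p (f.stalkMap (m p) (S.presheaf.germ c.V (f (m p)) (c.le hp) r)) := by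
    rw [← germ_appLE c.le hp, ← hσ]
    congr 1
    exact RingHom.congr_fun congr(($(Scheme.Hom.appLE_comp_appLE m f c.V c.U W c.le le_rfl)).hom).symm r
  rw [← hσ, ← hρ] at h1
  rw [← hσ, ← hρ] at h2
  obtain ⟨N₁, hN₁, hp₁, h1⟩ := exists_dvd_of_germ_dvd (W := W) hp h1
  obtain ⟨N₂, hN₂, hp₂, h2⟩ := exists_dvd_of_germ_dvd (W := W) hp h2
  let N := N₁ ⊓ N₂
  have hN : N ≤ W := inf_le_left.trans hN₁
  have hres {N' : T.Opens} (hN' : N' ≤ W) (hNN : N ≤ N') (r : Γ(T, W)) :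
      T.presheaf.map (homOfLE hNN).op (T.presheaf.map (homOfLE hN').op r) =
      T.presheaf.map (homOfLE hN).op r := by
    rw [← CommRingCat.comp_apply, ← T.presheaf.map_comp]
    rfl
  replace h1 := map_dvd (T.presheaf.map (homOfLE (inf_le_left : N ≤ N₁)).op).hom h1
  replace h2 := map_dvd (T.presheaf.map (homOfLE (inf_le_right : N ≤ N₂)).op).hom h2
  have hresσ (r) : T.presheaf.map (homOfLE hN).op (m.appLE c.U W le_rfl r) = m.appLE c.U N hN r :=
    RingHom.congr_fun congr(($(Scheme.Hom.appLE_map m le_rfl (homOfLE hN).op)).hom) r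
  have hresρ (r) : T.presheaf.map (homOfLE hN).op (ρ W le_rfl r) = ρ N hN r :=
    RingHom.congr_fun congr(($(Scheme.Hom.appLE_map (m ≫ f) (hle le_rfl) (homOfLE hN).op)).hom) r
  replace h1 : ρ N hN e ∣ m.appLE c.U N hN c.s := by
    have h3 := hres hN₁ inf_le_left (ρ W le_rfl e)
    have h4 := hres hN₁ inf_le_left (m.appLE c.U W le_rfl c.s)
    rw [hresρ] at h3
    rw [hresσ] at h4
    rw [← h3, ← h4]
    exact h1
  replace h2 : m.appLE c.U N hN c.s ∣ ρ N hN (e * τ) := by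
    have h3 := hres hN₂ inf_le_right (ρ W le_rfl (e * τ))
    have h4 := hres hN₂ inf_le_right (m.appLE c.U W le_rfl c.s)
    rw [hresρ] at h3
    rw [hresσ] at h4
    rw [← h3, ← h4]
    exact h2
  obtain ⟨u, hu⟩ := h1
  obtain ⟨v, hv⟩ := h2
  have h3 : ρ N hN c.a ∈ nonZeroDivisors Γ(T, N) :=
    appLE_mem_nonZeroDivisors (m ≫ f) c.hV ha (hle hN)
  have h4 : m.appLE c.U N hN c.s * m.appLE c.U N hN c.t = ρ N hN c.a := by
    rw [← map_mul, c.s_mul_t]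
    exact RingHom.congr_fun congr(($(Scheme.Hom.appLE_comp_appLE m f c.V c.U N c.le hN)).hom) c.a
  have h5 : ρ N hN e ∈ nonZeroDivisors Γ(T, N) := by
    rw [← h, map_mul, map_mul] at h3
    exact (mul_mem_nonZeroDivisors.mp (mul_mem_nonZeroDivisors.mp h3).1).1
  have h6 : m.appLE c.U N hN c.s ∈ nonZeroDivisors Γ(T, N) := by
    rw [← h4] at h3
    exact (mul_mem_nonZeroDivisors.mp h3).1
  obtain ⟨g, hg⟩ := c.exists_pieceHom_lift h m hN (hle hN) (u := u) (v := v) hu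
    ((mul_cancel_left_mem_nonZeroDivisors h6).mp (by
      rw [h4, ← h, map_mul, hv]
      change _ = _ * (ρ N hN e' * v)
      ring))
    ((mul_cancel_left_mem_nonZeroDivisors h5).mp (by
      rw [← mul_assoc, ← hu, ← hv, map_mul]))
  exact ⟨N, g, ⟨hp₁, hp₂⟩, hg⟩

lemma pieceHom_mem (p : c.piece h) : c.pieceHom h p ∈ c.U := c.top_le_pieceHom h trivial

lemma stalkMap_s (p : c.piece h) :
    (c.pieceHom h).stalkMap p (X.presheaf.germ c.U (c.pieceHom h p)
      (c.pieceHom_mem h p) c.s) =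
    (c.pieceHom h).stalkMap p (f.stalkMap _ (S.presheaf.germ c.V (f (c.pieceHom h p))
      (c.le (c.pieceHom_mem h p)) e)) *
      (c.piece h).presheaf.germ ⊤ p trivial (c.pieceθ h (NodeAlgebra.x τ)) := by
  rw [← germ_appLE c.le (c.pieceHom_mem h p), ← germ_appLE (c.top_le_pieceHom h) (z := p) trivial,
    ← germ_appLE (c.top_le_pieceHom h) (z := p) trivial, c.appLE_s h, map_mul]
  congr 2
  exact RingHom.congr_fun congr(($(Scheme.Hom.appLE_comp_appLE (c.pieceHom h) f c.V c.U ⊤ c.le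
    (c.top_le_pieceHom h))).hom).symm e

lemma stalkMap_t (p : c.piece h) :
    (c.pieceHom h).stalkMap p (X.presheaf.germ c.U (c.pieceHom h p)
      (c.pieceHom_mem h p) c.t) =
    (c.pieceHom h).stalkMap p (f.stalkMap _ (S.presheaf.germ c.V (f (c.pieceHom h p))
      (c.le (c.pieceHom_mem h p)) e')) *
      (c.piece h).presheaf.germ ⊤ p trivial (c.pieceθ h (NodeAlgebra.y τ)) := by
  rw [← germ_appLE c.le (c.pieceHom_mem h p), ← germ_appLE (c.top_le_pieceHom h) (z := p) trivial,
    ← germ_appLE (c.top_le_pieceHom h) (z := p) trivial, c.appLE_t h, map_mul]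
  congr 2
  exact RingHom.congr_fun congr(($(Scheme.Hom.appLE_comp_appLE (c.pieceHom h) f c.V c.U ⊤ c.le
    (c.top_le_pieceHom h))).hom).symm e'

lemma germ_x_mul_germ_y (p : c.piece h) :
    (c.piece h).presheaf.germ ⊤ p trivial (c.pieceθ h (NodeAlgebra.x τ)) *
      (c.piece h).presheaf.germ ⊤ p trivial (c.pieceθ h (NodeAlgebra.y τ)) =
    (c.pieceHom h).stalkMap p (f.stalkMap _ (S.presheaf.germ c.V (f (c.pieceHom h p))
      (c.le (c.pieceHom_mem h p)) τ)) := by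
  rw [← map_mul, ← map_mul, NodeAlgebra.x_mul_y, ← germ_appLE c.le (c.pieceHom_mem h p),
    ← germ_appLE (c.top_le_pieceHom h) (z := p) trivial]
  congr 1
  refine (RingHom.congr_fun (c.pieceθ_comp_algebraMap h) τ).trans ?_
  exact RingHom.congr_fun congr(($(Scheme.Hom.appLE_comp_appLE (c.pieceHom h) f c.V c.U ⊤ c.le
    (c.top_le_pieceHom h))).hom).symm τ

end NodeChart

end Lifts

/-! ### The local form of regularity and normal crossings. -/

section LocalCrossings

open IsLocalRing

variable {R O : Type u} [CommRing R] [CommRing O] [IsLocalRing O]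

/-- The ring `O` is regular, and the extension of the ideal `I` to `O` is generated by a product of
elements of a regular system of parameters. -/
def IsSNCHom [IsLocalRing R] (I : Ideal R) (φ : R →+* O) : Prop :=
  IsRegularLocalRing O ∧ (I ≤ maximalIdeal R → ∃ (ι : Type) (_ : Fintype ι) (g : ι → O)
    (J : Finset ι), IsRegularSystem g ∧ I.map φ = Ideal.span {∏ j ∈ J, g j})

lemma IsCurvePoint.isSNCHom [IsRegularLocalRing R] [IsNoetherianRing O] {φ : R →+* O}
    (h : IsCurvePoint φ) [IsLocalHom φ] {I : Ideal R}
    (hI : I ≤ maximalIdeal R → ∃ (d : ℕ) (t : Fin d → R) (J : Finset (Fin d)), IsRegularSystem t ∧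
      I = Ideal.span {∏ j ∈ J, t j}) : IsSNCHom I φ := by
  constructor
  · obtain ⟨d, t, ht⟩ := exists_isRegularSystem R
    obtain ⟨n, g, hg⟩ := h.exists_extend inferInstance ht
    exact hg.isRegularLocalRing
  · intro h1
    obtain ⟨d, t, J, ht, hJ⟩ := hI h1
    obtain ⟨n, g, hg⟩ := h.exists_extend inferInstance ht
    refine ⟨_, inferInstance, _, J.disjSum ∅, hg, ?_⟩
    rw [hJ, Ideal.map_span, Set.image_singleton, map_prod, Finset.prod_disjSum]
    simp

/-- In the extended equation of the divisor the factor `τ i` turns into `s t` up to a unit, a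
product of two parameters which replace `τ i` in the regular system. -/
lemma IsNode.isSNCHom [IsLocalRing R] [IsNoetherianRing R] [IsNoetherianRing O] {φ : R →+* O} {a : R} {s t : O}
    (h : IsNode φ a s t) {d : ℕ} {τ : Fin d → R} (hτ : IsRegularSystem τ) {J : Finset (Fin d)}
    {i : Fin d} (hi : i ∈ J) (hia : Associated (τ i) a) {I : Ideal R}
    (hI : I = Ideal.span {∏ j ∈ J, τ j}) : IsSNCHom I φ := by
  have hg := h.isRegularSystem hτ i hia
  refine ⟨hg.isRegularLocalRing, fun _ => ⟨_, inferInstance, _,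
    (J.subtype (· ≠ i)).disjSum Finset.univ, hg, ?_⟩⟩
  rw [hI, Ideal.map_span, Set.image_singleton, Finset.prod_disjSum]
  refine span_singleton_eq_of_associated ?_
  rw [← Finset.mul_prod_erase J τ hi, map_mul, map_prod, mul_comm]
  refine Associated.mul_mul ?_ ?_
  · simp only [Sum.elim_inl]
    rw [Finset.prod_subtype_eq_prod_filter (f := fun j => φ (τ j)), Finset.filter_ne']
    exact Associated.refl _
  · simp only [Sum.elim_inr, Fin.prod_univ_two, Matrix.cons_val_zero, Matrix.cons_val_one]
    rw [h.mul]
    exact hia.map φ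

end LocalCrossings

/-! ### Flatness of nodal families and of their pieces. -/

section Flatness

variable {X S : Scheme.{u}} {f : X ⟶ S}

lemma NodeChart.flat_stalkMap (c : NodeChart f) {z : X} (hz : z ∈ c.U) :
    (f.stalkMap z).hom.Flat := by
  by_cases h : IsUnit (X.presheaf.germ c.U z hz c.s) ∨ IsUnit (X.presheaf.germ c.U z hz c.t)
  · exact (c.isCurvePoint hz h).flat
  · rw [not_or] at h
    exact (c.isNode hz h.1 h.2).flat_base

lemma NodalFamily.flat {D : S.IdealSheafData} (F : NodalFamily f D) : Flat f := by
  refine Flat.of_stalkMap _ fun x => ?_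
  obtain h | ⟨c, hc⟩ := F.chart x
  exacts [h.flat, c.flat_stalkMap hc]

instance NodeChart.flat_pieceHom (c : NodeChart f) {e τ e' : Γ(S, c.V)} (h : e * τ * e' = c.a) :
    Flat (c.pieceHom h ≫ f) :=
  Flat.of_stalkMap _ fun _ => (c.pieceChart h).flat_stalkMap trivial

end Flatness

/-! ### Lifting to the pieces of a sorted chart, and adaptedness. -/

section SortedPieces

variable {X S T : Scheme.{u}} {f : X ⟶ S}

namespace SortedChart

variable (c : SortedChart f)

lemma take_mul_drop (k : Fin c.τ.length) :
    (c.τ.take k).prod * c.τ[k] * (c.τ.drop (k + 1)).prod = c.a := by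
  rw [← c.prod_eq, Fin.getElem_fin, ← List.prod_take_succ, List.prod_take_mul_prod_drop]

/-- The pieces of the modification over a sorted chart. -/
abbrev sortedPiece (k : Fin c.τ.length) : Scheme.{u} := c.piece (c.take_mul_drop k)

/-- The projection of a piece over a sorted chart. -/
abbrev sortedHom (k : Fin c.τ.length) : c.sortedPiece k ⟶ X := c.pieceHom (c.take_mul_drop k)

lemma part_eq {z : X} (hz : z ∈ c.U) (j : ℕ) :
    c.part hz j = S.presheaf.germ c.V (f z) (c.le hz) (c.τ.take j).prod := by
  rw [part, word, ← List.map_take, List.prod_hom]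

lemma part_dvd_part {z : X} (hz : z ∈ c.U) {i j : ℕ} (h : i ≤ j) : c.part hz i ∣ c.part hz j := by
  rw [part, part, ← List.prod_take_mul_prod_drop ((c.word hz).take j) i, List.take_take,
    min_eq_left h]
  exact dvd_mul_right _ _

/-- The morphism `m` lifts to the `k`th piece near `p`. -/
def DvdAt (k : ℕ) (m : T ⟶ X) (p : T) : Prop :=
  ∃ hp : m p ∈ c.U, m.stalkMap p (f.stalkMap _ (c.part hp k)) ∣ m.stalkMap p (c.sz hp) ∧
    m.stalkMap p (c.sz hp) ∣ m.stalkMap p (f.stalkMap _ (c.part hp (k + 1)))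

/-- Adaptedness at the points of a scheme over `X`. -/
def AdaptedAt (m : T ⟶ X) (p : T) : Prop :=
  ∃ hp : m p ∈ c.U, c.Adapted hp (m.stalkMap p).hom

variable {c}

lemma DvdAt.comp {k : ℕ} {m : T ⟶ X} {T' : Scheme.{u}} (g : T' ⟶ T) {q : T'}
    (h : c.DvdAt k m (g q)) : c.DvdAt k (g ≫ m) q := by
  obtain ⟨hp, h1, h2⟩ := h
  refine ⟨hp, ?_, ?_⟩
  · rw [Scheme.Hom.stalkMap_comp]
    exact map_dvd (g.stalkMap q).hom h1
  · rw [Scheme.Hom.stalkMap_comp]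
    exact map_dvd (g.stalkMap q).hom h2

/-- The partial products form a chain under divisibility, so squeezing `s` between two consecutive
ones compares it with all of them. -/
lemma DvdAt.adaptedAt {k : ℕ} {m : T ⟶ X} {p : T} (h : c.DvdAt k m p) : c.AdaptedAt m p := by
  obtain ⟨hp, h1, h2⟩ := h
  refine ⟨hp, fun j => ?_⟩
  obtain hj | hj := le_or_gt j k
  · exact Or.inl ((map_dvd (m.stalkMap p).hom
      (map_dvd (f.stalkMap (m p)).hom (c.part_dvd_part hp hj))).trans h1)
  · exact Or.inr (h2.trans (map_dvd (m.stalkMap p).hom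
      (map_dvd (f.stalkMap (m p)).hom (c.part_dvd_part hp hj))))

/-- If `y` divides `x` instead, regularity of `α y` makes the cofactor a unit after `α`, hence a
unit already. -/
lemma dvd_of_map_dvd {A B : Type*} [CommRing A] [CommRing B] (α : A →+* B) [IsLocalHom α] {x y : A}
    (h : x ∣ y ∨ y ∣ x) (hy : α y ∈ nonZeroDivisors B) (hxy : α x ∣ α y) : x ∣ y := by
  obtain h | ⟨w, rfl⟩ := h
  · exact h
  · obtain ⟨v, hv⟩ := hxy
    have h1 : α w * v = 1 := by
      refine (mul_cancel_left_mem_nonZeroDivisors hy).mp ?_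
      rw [mul_one, ← mul_assoc, ← map_mul, ← hv]
    have h2 : IsUnit w := isUnit_of_map_unit α _ (IsUnit.of_mul_eq_one _ h1)
    exact (h2.mul_right_dvd).mpr dvd_rfl

lemma stalkMap_mem_nonZeroDivisors (m : T ⟶ X) [Flat (m ≫ f)] {p : T} (hp : m p ∈ c.U)
    {r : S.presheaf.stalk (f (m p))} (hr : r ∣ S.presheaf.germ c.V _ (c.le hp) c.a) :
    m.stalkMap p (f.stalkMap _ r) ∈ nonZeroDivisors (T.presheaf.stalk p) := by
  have h1 := map_mem_nonZeroDivisors_of_flat (Flat.stalkMap (m ≫ f) p)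
    (germ_mem_nonZeroDivisors c.hV c.mem_nonZeroDivisors (c.le hp))
  obtain ⟨w, hw⟩ := hr
  have h2 : (m ≫ f).stalkMap p = f.stalkMap (m p) ≫ m.stalkMap p := Scheme.Hom.stalkMap_comp ..
  have h3 : m.stalkMap p (f.stalkMap _ (r * w)) ∈ nonZeroDivisors (T.presheaf.stalk p) := by
    rw [← hw]
    rw [h2] at h1
    exact h1
  rw [map_mul, map_mul] at h3
  exact (mul_mem_nonZeroDivisors.mp h3).1

lemma stalkMap_sz_mem_nonZeroDivisors (m : T ⟶ X) [Flat (m ≫ f)] {p : T} (hp : m p ∈ c.U) :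
    m.stalkMap p (c.sz hp) ∈ nonZeroDivisors (T.presheaf.stalk p) := by
  have h1 := stalkMap_mem_nonZeroDivisors m hp dvd_rfl
  rw [← c.sz_mul_tz hp, map_mul] at h1
  exact (mul_mem_nonZeroDivisors.mp h1).1

/-- Adaptedness supplies the comparability without which divisibility does not descend along a local
homomorphism. This makes the overlaps of the pieces symmetric. -/
lemma DvdAt.of_comp {k : ℕ} {m : T ⟶ X} {T' : Scheme.{u}} (g : T' ⟶ T) [Flat ((g ≫ m) ≫ f)] {q : T'}
    (h : c.DvdAt k (g ≫ m) q) (ha : c.AdaptedAt m (g q)) : c.DvdAt k m (g q) := by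
  obtain ⟨hp, h1, h2⟩ := h
  obtain ⟨hp', ha⟩ := ha
  have h3 := stalkMap_sz_mem_nonZeroDivisors (g ≫ m) hp
  have h4 := stalkMap_mem_nonZeroDivisors (g ≫ m) hp (c.part_dvd hp (k + 1))
  rw [Scheme.Hom.stalkMap_comp] at h1 h2 h3 h4
  exact ⟨hp, dvd_of_map_dvd (g.stalkMap q).hom (ha k) h3 h1,
    dvd_of_map_dvd (g.stalkMap q).hom (ha (k + 1)).symm h4 h2⟩

lemma DvdAt.exists_lift {k : Fin c.τ.length} {m : T ⟶ X} [Flat (m ≫ f)] {p : T}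
    (h : c.DvdAt k m p) :
    ∃ (N : T.Opens) (g : N.toScheme ⟶ c.sortedPiece k), p ∈ N ∧ g ≫ c.sortedHom k = N.ι ≫ m := by
  obtain ⟨hp, h1, h2⟩ := h
  rw [part_eq] at h1 h2
  refine c.exists_lift_of_dvd (c.take_mul_drop k) c.mem_nonZeroDivisors m hp h1 ?_
  rwa [Fin.getElem_fin, ← List.prod_take_succ]

lemma dvdAt_sortedHom (k : Fin c.τ.length) (p : c.sortedPiece k) :
    c.DvdAt k (c.sortedHom k) p := by
  refine ⟨c.pieceHom_mem _ p, ?_, ?_⟩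
  · rw [part_eq]
    exact Dvd.intro _ (c.stalkMap_s (c.take_mul_drop k) p).symm
  · rw [part_eq, List.prod_take_succ]
    refine Dvd.intro ((c.sortedPiece k).presheaf.germ ⊤ p trivial
      (c.pieceθ (c.take_mul_drop k) (NodeAlgebra.y c.τ[k]))) ?_
    rw [map_mul, map_mul, map_mul]
    refine (congr($(c.stalkMap_s (c.take_mul_drop k) p) * _)).trans ?_
    rw [mul_assoc, c.germ_x_mul_germ_y]
    rfl

/-- The first `j` with `s ∣ part (j + 1)` works: by minimality `s` does not divide `part j` unless
`j = 0`, so comparability gives `part j ∣ s`. -/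
lemma AdaptedAt.exists_dvdAt {m : T ⟶ X} {p : T} (h : c.AdaptedAt m p) (hτ : c.τ ≠ []) :
    ∃ k : Fin c.τ.length, c.DvdAt k m p := by
  classical
  obtain ⟨hp, h⟩ := h
  have h0 : m.stalkMap p (f.stalkMap _ (c.part hp 0)) ∣ m.stalkMap p (c.sz hp) := by
    simp [part]
  have h1 : m.stalkMap p (c.sz hp) ∣ m.stalkMap p (f.stalkMap _ (c.part hp c.τ.length)) := by
    have h2 : c.part hp c.τ.length = S.presheaf.germ c.V _ (c.le hp) c.a := by
      rw [part_eq, List.take_length, c.prod_eq]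
    rw [h2, ← sz_mul_tz, map_mul]
    exact dvd_mul_right _ _
  have hpos : 0 < c.τ.length := List.length_pos_iff.mpr hτ
  let P (j : ℕ) : Prop :=
    m.stalkMap p (c.sz hp) ∣ m.stalkMap p (f.stalkMap _ (c.part hp (j + 1)))
  have hP : ∃ j, P j := ⟨c.τ.length - 1, by
    change _ ∣ m.stalkMap p (f.stalkMap _ (c.part hp (c.τ.length - 1 + 1)))
    rwa [show c.τ.length - 1 + 1 = c.τ.length from Nat.sub_add_cancel hpos]⟩
  have hlt : Nat.find hP < c.τ.length := by
    refine (Nat.find_le (n := c.τ.length - 1) ?_).trans_lt (Nat.sub_lt hpos one_pos)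
    change _ ∣ m.stalkMap p (f.stalkMap _ (c.part hp (c.τ.length - 1 + 1)))
    rwa [show c.τ.length - 1 + 1 = c.τ.length from Nat.sub_add_cancel hpos]
  refine ⟨⟨Nat.find hP, hlt⟩, hp, ?_, Nat.find_spec hP⟩
  change m.stalkMap p (f.stalkMap _ (c.part hp (Nat.find hP))) ∣ _
  obtain h2 | h2 := Nat.eq_zero_or_pos (Nat.find hP)
  · rwa [h2]
  · refine (h _).resolve_right fun h3 => ?_
    refine Nat.find_min hP (m := Nat.find hP - 1) (Nat.sub_lt h2 one_pos) ?_
    change _ ∣ m.stalkMap p (f.stalkMap _ (c.part hp (Nat.find hP - 1 + 1)))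
    rw [show Nat.find hP - 1 + 1 = Nat.find hP from Nat.sub_add_cancel h2]
    exact h3

lemma adaptedAt_of_isUnit {m : T ⟶ X} {p : T} (hp : m p ∈ c.U)
    (h : IsUnit (c.sz hp) ∨ IsUnit (c.tz hp)) : c.AdaptedAt m p := by
  refine ⟨hp, fun j => ?_⟩
  obtain h | h := h
  · exact Or.inr ((h.map (m.stalkMap p).hom).dvd)
  · left
    refine map_dvd (m.stalkMap p).hom ?_
    rw [← h.dvd_mul_right, sz_mul_tz]
    exact map_dvd (f.stalkMap _).hom (c.part_dvd hp j)

lemma adaptedAt_of_formallySmooth {m : T ⟶ X} {p : T} (hp : m p ∈ c.U)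
    (h : (f.stalkMap (m p)).hom.FormallySmooth) : c.AdaptedAt m p := by
  refine adaptedAt_of_isUnit hp ?_
  by_contra h1
  rw [not_or] at h1
  exact (c.isNode hp h1.1 h1.2).not_formallySmooth h

lemma AdaptedAt.of_adaptedAt {c' : SortedChart f} {m : T ⟶ X} [Flat (m ≫ f)] {p : T}
    [IsDomain (S.presheaf.stalk (f (m p)))] [IsDomain (T.presheaf.stalk p)] (hp : m p ∈ c.U)
    (h : c'.AdaptedAt m p) : c.AdaptedAt m p := by
  obtain ⟨hp', h⟩ := h
  refine ⟨hp, c.adapted_of_adapted c' hp' (fun r hr => ?_) (nonZeroDivisors.ne_zero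
    (germ_mem_nonZeroDivisors c'.hV c'.mem_nonZeroDivisors (c'.le hp'))) h⟩
  have h0 : r ∈ nonZeroDivisors (S.presheaf.stalk (f (m p))) := mem_nonZeroDivisors_of_ne_zero hr
  have h1 := map_mem_nonZeroDivisors_of_flat (Flat.stalkMap (m ≫ f) p) h0
  rw [Scheme.Hom.stalkMap_comp] at h1
  exact nonZeroDivisors.ne_zero h1

end SortedChart

end SortedPieces

/-! ### The pieces of the modification satisfy the gluing conditions. -/

section Modification

variable {X S T : Scheme.{u}} {f : X ⟶ S} {D : S.IdealSheafData} (F : NodalFamily f D)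

lemma SortedChart.sortedHom_hom_ext (c : SortedChart f) {k : Fin c.τ.length}
    {g g' : T ⟶ c.sortedPiece k} (h : g ≫ c.sortedHom k = g' ≫ c.sortedHom k)
    (hg : Flat ((g ≫ c.sortedHom k) ≫ f)) : g = g' := by
  rw [Category.assoc] at hg
  refine c.pieceHom_hom_ext (c.take_mul_drop k) h fun {N} hN => ?_
  refine appLE_mem_nonZeroDivisors _ c.hV ?_ hN
  have h2 := c.mem_nonZeroDivisors
  rw [← c.take_mul_drop k, mul_right_comm] at h2
  exact (mul_mem_nonZeroDivisors.mp h2).1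

section

open IsLocalRing

lemma IsRegularSystem.ringEquiv {O O' : Type u} [CommRing O] [CommRing O'] [IsLocalRing O]
    [IsLocalRing O'] (e : O ≃+* O') {ι : Type} [Fintype ι] {g : ι → O} (h : IsRegularSystem g) :
    IsRegularSystem (e ∘ g) := by
  constructor
  · have h1 := congr(Ideal.map e $h.span_range)
    rwa [map_ringEquiv_maximalIdeal e, Ideal.map_span, ← Set.range_comp] at h1
  · rw [← ringKrullDim_eq_of_ringEquiv e, h.dim]

lemma IsSNCHom.comp_ringEquiv {R O O' : Type u} [CommRing R] [IsLocalRing R] [CommRing O]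
    [CommRing O'] [IsLocalRing O] [IsLocalRing O'] {I : Ideal R} {φ : R →+* O} (h : IsSNCHom I φ)
    (e : O ≃+* O') : IsSNCHom I ((e : O →+* O').comp φ) := by
  have := h.1
  refine ⟨IsRegularLocalRing.of_ringEquiv e, fun hI => ?_⟩
  obtain ⟨ι, _, g, J, hg, hJ⟩ := h.2 hI
  refine ⟨ι, inferInstance, _, J, hg.ringEquiv e, ?_⟩
  rw [← Ideal.map_map, hJ, Ideal.map_span, Set.image_singleton, map_prod]
  rfl

lemma isSNCHom_comp_iff {T' : Scheme.{u}} (k : T' ⟶ T) [IsOpenImmersion k] (t : T ⟶ S) (q : T') :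
    IsSNCHom (stalkIdeal D ((k ≫ t) q)) ((k ≫ t).stalkMap q).hom ↔
      IsSNCHom (stalkIdeal D (t (k q))) (t.stalkMap (k q)).hom := by
  let e := (asIso (k.stalkMap q)).commRingCatIsoToRingEquiv
  have h1 : (k ≫ t).stalkMap q = t.stalkMap (k q) ≫ k.stalkMap q := Scheme.Hom.stalkMap_comp ..
  rw [h1]
  refine ⟨fun h => ?_, fun h => h.comp_ringEquiv e⟩
  have h2 := h.comp_ringEquiv e.symm
  have h3 : (e.symm : _ →+* _).comp (t.stalkMap (k q) ≫ k.stalkMap q).hom =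
      (t.stalkMap (k q)).hom := by
    ext r
    exact e.symm_apply_apply _
  exact congr(IsSNCHom (stalkIdeal D (t (k q))) $h3).mp h2

end

namespace NodalFamily

include F

lemma isLocallyNoetherian (t : T ⟶ S) [LocallyOfFiniteType t] : IsLocallyNoetherian T :=
  have := F.regular.1
  LocallyOfFiniteType.isLocallyNoetherian t

lemma locallyOfFiniteType : LocallyOfFiniteType f :=
  have := F.finitePresentation
  inferInstance

lemma isSNCHom_of_isCurvePoint (t : T ⟶ S) [LocallyOfFiniteType t] {p : T}
    (h : IsCurvePoint (t.stalkMap p).hom) :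
    IsSNCHom (stalkIdeal D (t p)) (t.stalkMap p).hom := by
  have := F.isLocallyNoetherian t
  have := F.regular.2 (t p)
  refine h.isSNCHom fun hI => ?_
  obtain ⟨-, d, g, J, hdim, hspan, hJ⟩ := F.snc.2 _ ((mem_support_iff_stalkIdeal D _).mpr hI)
  exact ⟨d, g, J, ⟨hspan, by simpa using hdim⟩, hJ⟩

/-- A node of a piece lies over a node of `X`, because the old coordinates are multiples of the new
ones. Its discriminant is a single letter of the word, not a unit since `u v = τₖ`, hence prime and
associated to a parameter occurring in the equation of `D`. -/
lemma isSNCHom_sortedHom (c : SortedChart f) (k : Fin c.τ.length) (p : c.sortedPiece k) :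
    IsSNCHom (stalkIdeal D ((c.sortedHom k ≫ f) p)) ((c.sortedHom k ≫ f).stalkMap p).hom := by
  have := F.locallyOfFiniteType
  let b := c.pieceChart (c.take_mul_drop k)
  have := F.isLocallyNoetherian (c.sortedHom k ≫ f)
  have := F.regular.1
  by_cases h : IsUnit ((c.sortedPiece k).presheaf.germ ⊤ p trivial b.s) ∨
    IsUnit ((c.sortedPiece k).presheaf.germ ⊤ p trivial b.t)
  · exact F.isSNCHom_of_isCurvePoint _ (b.isCurvePoint trivial h)
  rw [not_or] at h
  have hp := c.pieceHom_mem (c.take_mul_drop k) p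
  have hs : ¬ IsUnit (c.sz hp) := by
    intro h1
    have h2 : IsUnit ((c.sortedHom k).stalkMap p (c.sz hp)) :=
      h1.map ((c.sortedHom k).stalkMap p).hom
    rw [c.stalkMap_s (c.take_mul_drop k) p] at h2
    exact h.1 (isUnit_of_mul_isUnit_right h2)
  have ht : ¬ IsUnit (c.tz hp) := by
    intro h1
    have h2 : IsUnit ((c.sortedHom k).stalkMap p (c.tz hp)) :=
      h1.map ((c.sortedHom k).stalkMap p).hom
    rw [c.stalkMap_t (c.take_mul_drop k) p] at h2
    exact h.2 (isUnit_of_mul_isUnit_right h2)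
  obtain h1 | ⟨h1, -, -⟩ := c.primes _ hp hs ht c.τ[k] (List.getElem_mem _)
  · have h2 := (h1.map (f.stalkMap _).hom).map ((c.sortedHom k).stalkMap p).hom
    have h3 := c.germ_x_mul_germ_y (c.take_mul_drop k) p
    exact (h.1 (isUnit_of_mul_isUnit_left (h3 ▸ h2))).elim
  · obtain ⟨d, g, J, hg, hJ, -, H⟩ := F.exists_isRegularSystem hp hs ht
    obtain ⟨j, hj, hja⟩ := H _ h1 (by
      refine map_dvd (S.presheaf.germ c.V _ (c.le hp)).hom ?_
      rw [← c.prod_eq]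
      exact List.dvd_prod (List.getElem_mem _))
    exact (b.isNode trivial h.1 h.2).isSNCHom hg hj hja.symm hJ

omit F in
lemma isDomain_of_isSNCHom {t : T ⟶ S} {p : T}
    (h : IsSNCHom (stalkIdeal D (t p)) (t.stalkMap p).hom) : IsDomain (T.presheaf.stalk p) :=
  have := h.1
  IsRegularLocalRing.isDomain _

/-- The smooth locus of the family. -/
def smoothOpen : X.Opens :=
  have := F.finitePresentation
  f.smoothLocus

lemma isCurvePoint_of_mem_smoothOpen {x : X} (hx : x ∈ F.smoothOpen) :
    IsCurvePoint (f.stalkMap x).hom := by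
  obtain h | ⟨c, hc⟩ := F.chart x
  · exact h
  · refine c.isCurvePoint hc ?_
    by_contra h
    rw [not_or] at h
    exact (c.isNode hc h.1 h.2).not_formallySmooth hx

/-- The pieces of the modification: the smooth locus and the pieces over the sorted charts. -/
def piece : Option (Σ c : SortedChart f, Fin c.τ.length) → Scheme.{u}
  | none => F.smoothOpen.toScheme
  | some i => i.1.sortedPiece i.2

/-- The projections of the pieces. -/
def pieceHom : ∀ i, F.piece i ⟶ X
  | none => F.smoothOpen.ι
  | some i => i.1.sortedHom i.2

instance locallyOfFiniteType_pieceHom (i) : LocallyOfFiniteType (F.pieceHom i) := by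
  cases i with
  | none => exact inferInstanceAs (LocallyOfFiniteType F.smoothOpen.ι)
  | some i => exact inferInstanceAs (LocallyOfFiniteType (i.1.sortedHom i.2))

instance flat_pieceHom (i) : Flat (F.pieceHom i ≫ f) := by
  have := F.flat
  cases i with
  | none => exact inferInstanceAs (Flat (F.smoothOpen.ι ≫ f))
  | some i => exact inferInstanceAs (Flat (i.1.sortedHom i.2 ≫ f))

lemma isSNCHom_pieceHom (i) (p : F.piece i) :
    IsSNCHom (stalkIdeal D ((F.pieceHom i ≫ f) p)) ((F.pieceHom i ≫ f).stalkMap p).hom := by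
  cases i with
  | none =>
    have := F.locallyOfFiniteType
    exact (isSNCHom_comp_iff F.smoothOpen.ι f p).mpr
      (F.isSNCHom_of_isCurvePoint f (F.isCurvePoint_of_mem_smoothOpen p.2))
  | some i => exact F.isSNCHom_sortedHom i.1 i.2 p

/-- A piece is adapted to its own chart by construction. The local rings of the pieces are domains,
so comparison of charts extends this to all sorted charts. -/
lemma adaptedAt_pieceHom (i) (q : F.piece i) (c : SortedChart f) (hq : F.pieceHom i q ∈ c.U) :
    c.AdaptedAt (F.pieceHom i) q := by
  cases i with
  | none => exact SortedChart.adaptedAt_of_formallySmooth hq (show F.smoothOpen.ι q ∈ F.smoothOpen from q.2)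
  | some i =>
    have := F.isDomain (f (F.pieceHom (some i) q))
    have := isDomain_of_isSNCHom (F.isSNCHom_pieceHom (some i) q)
    exact (i.1.dvdAt_sortedHom i.2 q).adaptedAt.of_adaptedAt (m := F.pieceHom (some i)) hq

end NodalFamily

/-- The gluing data of the modification. -/
def NodalFamily.gluingPieces : GluingPieces X where
  J := Option (Σ c : SortedChart f, Fin c.τ.length)
  B := F.piece
  h := F.pieceHom
  uniq i j T k _ g g' hg hg' := by
    cases j with
    | none =>
      have : Mono (F.pieceHom none) := inferInstanceAs (Mono F.smoothOpen.ι)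
      rw [← cancel_mono (F.pieceHom none), hg, hg']
    | some j =>
      refine j.1.sortedHom_hom_ext (hg.trans hg'.symm) ?_
      have h1 : (g ≫ F.pieceHom (some j)) ≫ f = k ≫ F.pieceHom i ≫ f := by
        rw [hg, Category.assoc]
      change Flat ((g ≫ F.pieceHom (some j)) ≫ f)
      rw [h1]
      infer_instance
  rev i j N g hg q := by
    cases i with
    | none =>
      have h1 : F.pieceHom j (g q) ∈ F.smoothOpen := by
        have h2 : F.pieceHom j (g q) = F.smoothOpen.ι q.1 := congr($hg q)
        rw [h2]
        exact Subtype.prop (p := fun x => x ∈ F.smoothOpen) q.1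
      exact ⟨F.pieceHom j ⁻¹ᵁ F.smoothOpen, F.pieceHom j ∣_ F.smoothOpen,
        morphismRestrict_ι _ _, h1⟩
    | some i =>
      -- On `N` the map to `X` factors through the `i`th piece, which gives the divisibilities at
      -- `q`. They descend to the local ring of `B j` at `g q`, and a lift then exists on a
      -- neighborhood.
      have h1 : i.1.DvdAt i.2 (g ≫ F.pieceHom j) q := by
        rw [hg]
        exact (i.1.dvdAt_sortedHom i.2 (N.ι q)).comp N.ι
      have : Flat ((g ≫ F.pieceHom j) ≫ f) := by
        rw [hg, Category.assoc]
        infer_instance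
      have h2 := h1.of_comp g (F.adaptedAt_pieceHom j (g q) i.1 h1.choose)
      obtain ⟨N', g', hN', hg'⟩ := h2.exists_lift
      exact ⟨N', g', hg', hN'⟩

end Modification

/-! ### Restricting node charts and rescaling the discriminant. -/

section Shrinking

variable {X S : Scheme.{u}} {f : X ⟶ S}

lemma NodeAlgebra.etale_baseChange {R R' : Type u} [CommRing R] [CommRing R'] [Algebra R R']
    (r : R) [IsLocalization.Away r R'] {a : R} {w a' : R'} (hw : IsUnit w)
    (h : algebraMap R R' a = w * a') : (NodeAlgebra.baseChange h).Etale := by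
  let := (NodeAlgebra.baseChange h).toAlgebra
  have h1 := NodeAlgebra.isLocalization_baseChange (Submonoid.powers r) hw h
  rw [Submonoid.map_powers] at h1
  have : Algebra.Etale (NodeAlgebra R a) (NodeAlgebra R' a') :=
    Algebra.Etale.of_isLocalizationAway (algebraMap R (NodeAlgebra R a) r)
  exact RingHom.etale_algebraMap.mpr this

namespace NodeChart

variable (c : NodeChart f)

/-- Restriction of a node chart to an open subscheme. -/
def restrict (U' : X.Opens) (h : U' ≤ c.U) : NodeChart f where
  U := U'
  V := c.V
  hV := c.hV
  le := h.trans c.le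
  a := c.a
  θ := (X.presheaf.map (homOfLE h).op).hom.comp c.θ
  comm := by
    rw [RingHom.comp_assoc, c.comm, ← CommRingCat.hom_comp, Scheme.Hom.appLE_map]
  etale := c.etale.res h

lemma restrict_s (U' : X.Opens) (h : U' ≤ c.U) {z : X} (hz : z ∈ U') :
    X.presheaf.germ U' z hz (c.restrict U' h).s = X.presheaf.germ c.U z (h hz) c.s :=
  TopCat.Presheaf.germ_res_apply X.presheaf (homOfLE h) z hz _

lemma restrict_t (U' : X.Opens) (h : U' ≤ c.U) {z : X} (hz : z ∈ U') :
    X.presheaf.germ U' z hz (c.restrict U' h).t = X.presheaf.germ c.U z (h hz) c.t :=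
  TopCat.Presheaf.germ_res_apply X.presheaf (homOfLE h) z hz _

/-- Restriction of the base of a node chart to a basic open subset, where the discriminant may be
changed by a unit. -/
def restrictBase (r : Γ(S, c.V)) {w a' : Γ(S, S.basicOpen r)} (hw : IsUnit w)
    (h : S.presheaf.map (homOfLE (S.basicOpen_le r)).op c.a = w * a') : NodeChart f where
  U := c.U ⊓ f ⁻¹ᵁ S.basicOpen r
  V := S.basicOpen r
  hV := c.hV.basicOpen r
  le := inf_le_right
  a := a'
  θ := NodeAlgebra.lift (f.appLE (S.basicOpen r) (c.U ⊓ f ⁻¹ᵁ S.basicOpen r) inf_le_right).hom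
    (f.appLE (S.basicOpen r) (c.U ⊓ f ⁻¹ᵁ S.basicOpen r) inf_le_right ↑hw.unit⁻¹ *
      X.presheaf.map (homOfLE inf_le_left).op c.s)
    (X.presheaf.map (homOfLE inf_le_left).op c.t) (by
      rw [mul_assoc, ← map_mul, c.s_mul_t]
      have h1 : X.presheaf.map (homOfLE (inf_le_left : c.U ⊓ f ⁻¹ᵁ S.basicOpen r ≤ c.U)).op
          (f.appLE c.V c.U c.le c.a) =
          f.appLE (S.basicOpen r) (c.U ⊓ f ⁻¹ᵁ S.basicOpen r) inf_le_right
            (S.presheaf.map (homOfLE (S.basicOpen_le r)).op c.a) := by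
        rw [← CommRingCat.comp_apply, ← CommRingCat.comp_apply, Scheme.Hom.appLE_map,
          Scheme.Hom.map_appLE]
      rw [h1, h, ← map_mul, ← mul_assoc, IsUnit.val_inv_mul, one_mul])
  comm := NodeAlgebra.lift_comp_algebraMap ..
  etale := by
    let : Algebra Γ(S, c.V) Γ(S, S.basicOpen r) :=
      (S.presheaf.map (homOfLE (S.basicOpen_le r)).op).hom.toAlgebra
    have : IsLocalization.Away r Γ(S, S.basicOpen r) := c.hV.isLocalization_basicOpen r
    refine IsEtaleChart.of_comp (NodeAlgebra.etale_baseChange r hw h) ?_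
    convert c.etale.res (inf_le_left : c.U ⊓ f ⁻¹ᵁ S.basicOpen r ≤ c.U) using 1
    refine NodeAlgebra.hom_ext ?_ ?_ ?_
    · rw [NodeAlgebra.baseChange, RingHom.comp_assoc, NodeAlgebra.lift_comp_algebraMap,
        ← RingHom.comp_assoc, NodeAlgebra.lift_comp_algebraMap, RingHom.comp_assoc, c.comm,
        ← CommRingCat.hom_comp, Scheme.Hom.appLE_map, RingHom.algebraMap_toAlgebra,
        ← CommRingCat.hom_comp, Scheme.Hom.map_appLE]
    · rw [RingHom.comp_apply, NodeAlgebra.baseChange, NodeAlgebra.lift_x, map_mul,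
        NodeAlgebra.lift_x, NodeAlgebra.lift_algebraMap, ← mul_assoc]
      have h1 : (f.appLE (S.basicOpen r) (c.U ⊓ f ⁻¹ᵁ S.basicOpen r) inf_le_right).hom w *
          f.appLE (S.basicOpen r) (c.U ⊓ f ⁻¹ᵁ S.basicOpen r) inf_le_right ↑hw.unit⁻¹ = 1 := by
        refine (map_mul _ _ _).symm.trans ?_
        rw [IsUnit.mul_val_inv, map_one]
      rw [h1, one_mul]
      rfl
    · rw [RingHom.comp_apply, NodeAlgebra.baseChange, NodeAlgebra.lift_y, NodeAlgebra.lift_y]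
      rfl

end NodeChart

end Shrinking

/-! ### Clearing denominators; local constancy of generic points. -/

section Spreading

open Filter Topology

section Algebra

variable {R O : Type u} [CommRing R] [CommRing O] [Algebra R O] (p : Ideal R) [p.IsPrime]
  [IsLocalization.AtPrime O p]

include p in
lemma exists_associated_algebraMap (x : O) : ∃ n : R, Associated (algebraMap R O n) x := by
  obtain ⟨⟨n, m⟩, h⟩ := IsLocalization.surj p.primeCompl x
  refine ⟨n, Associated.symm ⟨(IsLocalization.map_units O m).unit, h⟩⟩

lemma exists_mul_eq_mul_of_associated {a b : R}
    (h : Associated (algebraMap R O a) (algebraMap R O b)) :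
    ∃ u ∉ p, ∃ v ∉ p, a * u = b * v := by
  obtain ⟨w, hw⟩ := h
  obtain ⟨⟨n, m⟩, hm⟩ := IsLocalization.surj p.primeCompl (w : O)
  have hn : n ∉ p := by
    refine fun hn => ?_
    have h1 : IsUnit (algebraMap R O n) := by
      rw [← hm]
      exact w.isUnit.mul (IsLocalization.map_units O m)
    exact (IsLocalization.AtPrime.isUnit_to_map_iff O p n).mp h1 hn
  have h1 : algebraMap R O (a * n) = algebraMap R O (b * m) := by
    rw [map_mul, map_mul, ← hm, ← hw]
    ring
  obtain ⟨q, hq⟩ := (IsLocalization.eq_iff_exists p.primeCompl O).mp h1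
  refine ⟨q * n, p.primeCompl.mul_mem q.2 hn, q * m, (q * m).2, ?_⟩
  linear_combination hq

/-- The annihilator of `a` is finitely generated and vanishes in the local ring, so a single
denominator kills it; inverting that denominator makes `a` regular. -/
lemma exists_mul_eq_zero_of_mem_nonZeroDivisors [IsNoetherianRing R] {a : R}
    (ha : algebraMap R O a ∈ nonZeroDivisors O) : ∃ r ∉ p, ∀ b, a * b = 0 → r * b = 0 := by
  let I : Ideal R := LinearMap.ker (LinearMap.mulLeft R a)
  obtain ⟨T, hT⟩ : I.FG := IsNoetherian.noetherian I
  have h1 : ∀ b ∈ I, ∃ r ∉ p, r * b = 0 := by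
    intro b hb
    have h2 : a * b = 0 := hb
    have h3 : algebraMap R O b = algebraMap R O 0 := by
      rw [map_zero]
      refine mem_nonZeroDivisors_iff_left.mp ha _ ?_
      rw [← map_mul, h2, map_zero]
    obtain ⟨q, hq⟩ := (IsLocalization.eq_iff_exists p.primeCompl O).mp h3
    exact ⟨q, q.2, by simpa using hq⟩
  choose! r hr hr' using h1
  refine ⟨∏ b ∈ T, r b, fun h => ?_, fun b hb => ?_⟩
  · obtain ⟨b, hb, h⟩ := (Ideal.IsPrime.prod_mem_iff).mp h
    exact hr b (hT ▸ Ideal.subset_span hb) h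
  · have h4 : I ≤ LinearMap.ker (LinearMap.mulLeft R (∏ b ∈ T, r b)) := by
      rw [← hT, Submodule.span_le]
      intro b hb
      have h5 : r b ∣ ∏ b ∈ T, r b := Finset.dvd_prod_of_mem _ hb
      obtain ⟨w, hw⟩ := h5
      change (∏ b ∈ T, r b) * b = 0
      rw [hw, mul_right_comm, hr' b (hT ▸ Ideal.subset_span hb), zero_mul]
    exact h4 hb

lemma mem_nonZeroDivisors_away {R' : Type u} [CommRing R'] [Algebra R R'] {a r : R}
    [IsLocalization.Away r R'] (h : ∀ b, a * b = 0 → r * b = 0) :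
    algebraMap R R' a ∈ nonZeroDivisors R' := by
  rw [mem_nonZeroDivisors_iff_left]
  intro x hx
  obtain ⟨⟨n, m⟩, hm⟩ := IsLocalization.surj (Submonoid.powers r) x
  have h1 : algebraMap R R' (a * n) = algebraMap R R' 0 := by
    rw [map_mul, ← hm, ← mul_assoc, hx, zero_mul, map_zero]
  obtain ⟨q, hq⟩ := (IsLocalization.eq_iff_exists (Submonoid.powers r) R').mp h1
  have h2 := h (q * n) (by linear_combination hq)
  have h3 : algebraMap R R' n = 0 := by
    have h4 : IsUnit (algebraMap R R' (r * q)) := by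
      rw [map_mul]
      exact (IsLocalization.Away.algebraMap_isUnit r).mul (IsLocalization.map_units R' q)
    refine (h4.mul_right_eq_zero).mp ?_
    rw [← map_mul, mul_assoc, h2, map_zero]
  rw [h3] at hm
  exact ((IsLocalization.map_units R' m).mul_left_eq_zero).mp hm

end Algebra

variable {X : Scheme.{u}}

/-- Primality of an ideal spreads out, and the point given by the ideal is locally constant. -/
lemma exists_eventually_isPrime [IsLocallyNoetherian X] {U : X.Opens} (hU : IsAffineOpen U) {x : X}
    (hx : x ∈ U) (I : Ideal Γ(X, U)) (hI : (I.map (X.presheaf.germ U x hx).hom).IsPrime) :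
    ∃ P : X, ∀ᶠ z in 𝓝 x, ∀ hz : z ∈ U, I.map (X.presheaf.germ U z hz).hom = ⊤ ∨
      ((I.map (X.presheaf.germ U z hz).hom).IsPrime ∧
        idealPoint z (I.map (X.presheaf.germ U z hz).hom) = P) := by
  have : IsNoetherianRing Γ(X, U) := IsLocallyNoetherian.component_noetherian ⟨U, hU⟩
  let alg (z : X) (hz : z ∈ U) : Algebra Γ(X, U) (X.presheaf.stalk z) :=
    (X.presheaf.germ U z hz).hom.toAlgebra
  have hloc (z : X) (hz : z ∈ U) : @IsLocalization.AtPrime _ _ (X.presheaf.stalk z) _ (alg z hz)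
      (hU.primeIdealOf ⟨z, hz⟩).asIdeal _ := hU.isLocalization_stalk ⟨z, hz⟩
  let := alg x hx
  have := hloc x hx
  obtain ⟨Q, b, hQ, hb, -, h⟩ := exists_prime_spread (hU.primeIdealOf ⟨x, hx⟩).asIdeal I
    (O := X.presheaf.stalk x) hI
  refine ⟨hU.fromSpec ⟨Q, hQ⟩, ?_⟩
  have hxb : x ∈ X.basicOpen b := (X.mem_basicOpen b x hx).mpr
    ((IsLocalization.AtPrime.isUnit_to_map_iff (X.presheaf.stalk x)
      (hU.primeIdealOf ⟨x, hx⟩).asIdeal b).mpr hb)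
  filter_upwards [(X.basicOpen b).isOpen.mem_nhds hxb] with z hzb hz
  have h1 := h (X.presheaf.stalk z) (X.presheaf.germ U z hz).hom ((X.mem_basicOpen b z hz).mp hzb)
  rw [h1]
  let := alg z hz
  have := hloc z hz
  -- Either `Q` is contained in the prime of `z`, and then the ideal at `z` is the localization of
  -- `Q`, or `Q` generates the unit ideal there.
  by_cases hQz : Disjoint ((hU.primeIdealOf ⟨z, hz⟩).asIdeal.primeCompl : Set Γ(X, U)) (Q : Set Γ(X, U))
  · right
    have hP : (Q.map (algebraMap Γ(X, U) (X.presheaf.stalk z))).IsPrime :=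
      IsLocalization.isPrime_of_isPrime_disjoint
        (hU.primeIdealOf ⟨z, hz⟩).asIdeal.primeCompl _ Q hQ hQz
    refine ⟨hP, ?_⟩
    refine (idealPoint_of_isPrime hP).trans
      (congr($(hU.fromSpecStalk_eq_fromSpecStalk hz) ⟨_, hP⟩).symm.trans ?_)
    have h2 : (Q.map (algebraMap Γ(X, U) (X.presheaf.stalk z))).comap
        (algebraMap Γ(X, U) (X.presheaf.stalk z)) = Q :=
      IsLocalization.under_map_of_isPrime_disjoint
        (hU.primeIdealOf ⟨z, hz⟩).asIdeal.primeCompl _ hQ hQz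
    refine congr(hU.fromSpec $(?_))
    exact PrimeSpectrum.ext h2
  · left
    obtain ⟨q, hq, hqQ⟩ := Set.not_disjoint_iff.mp hQz
    exact Ideal.eq_top_of_isUnit_mem _ (Ideal.mem_map_of_mem _ hqQ)
      (IsLocalization.map_units (X.presheaf.stalk z) (⟨q, hq⟩ :
        (hU.primeIdealOf ⟨z, hz⟩).asIdeal.primeCompl))

lemma eventually_isPrime [IsLocallyNoetherian X] {U : X.Opens} (hU : IsAffineOpen U) {x : X}
    (hx : x ∈ U) (I : Ideal Γ(X, U)) (hI : (I.map (X.presheaf.germ U x hx).hom).IsPrime) :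
    ∀ᶠ z in 𝓝 x, ∀ hz : z ∈ U, I.map (X.presheaf.germ U z hz).hom = ⊤ ∨
      ((I.map (X.presheaf.germ U z hz).hom).IsPrime ∧
        idealPoint z (I.map (X.presheaf.germ U z hz).hom) =
          idealPoint x (I.map (X.presheaf.germ U x hx).hom)) := by
  obtain ⟨P, hP⟩ := exists_eventually_isPrime hU hx I hI
  have h1 := (hP.self_of_nhds hx).resolve_left hI.ne_top
  rwa [h1.2]

end Spreading

/-! ### Existence of sorted charts at the nodes. -/

section SortedChartExistence

open Filter Topology IsLocalRing

variable {X S : Scheme.{u}} {f : X ⟶ S}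

/-- Primality spreads out unless the ideal becomes the unit ideal, which cannot happen where neither
generator is a unit. The second conclusion makes the keys locally constant. -/
lemma NodeChart.eventually_span_isPrime [IsLocallyNoetherian X] (c : NodeChart f) {x : X}
    (hx : x ∈ c.U) (σ : Γ(X, c.U)) (r : Γ(S, c.V))
    (h : (Ideal.span {X.presheaf.germ c.U x hx σ,
      f.stalkMap x (S.presheaf.germ c.V (f x) (c.le hx) r)}).IsPrime) :
    ∀ᶠ z in 𝓝 x, ∀ hz : z ∈ c.U, ¬ IsUnit (X.presheaf.germ c.U z hz σ) →
      ¬ IsUnit (S.presheaf.germ c.V (f z) (c.le hz) r) →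
      (Ideal.span {X.presheaf.germ c.U z hz σ,
        f.stalkMap z (S.presheaf.germ c.V (f z) (c.le hz) r)}).IsPrime ∧
      idealPoint z (Ideal.span {X.presheaf.germ c.U z hz σ,
        f.stalkMap z (S.presheaf.germ c.V (f z) (c.le hz) r)}) =
      idealPoint x (Ideal.span {X.presheaf.germ c.U x hx σ,
        f.stalkMap x (S.presheaf.germ c.V (f x) (c.le hx) r)}) := by
  obtain ⟨U, hU, hxU, hle⟩ := X.isBasis_affineOpens.exists_subset_of_mem_open hx c.U.isOpen
  obtain ⟨U, hUa, rfl⟩ := hU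
  replace hle : U ≤ c.U := hle
  let I : Ideal Γ(X, U) := Ideal.span {X.presheaf.map (homOfLE hle).op σ,
    X.presheaf.map (homOfLE hle).op (f.appLE c.V c.U c.le r)}
  have hI {z : X} (hz : z ∈ U) : I.map (X.presheaf.germ U z hz).hom =
      Ideal.span {X.presheaf.germ c.U z (hle hz) σ,
        f.stalkMap z (S.presheaf.germ c.V (f z) (c.le (hle hz)) r)} := by
    rw [Ideal.map_span, Set.image_pair, ← germ_appLE c.le (hle hz)]
    congr 2
    · exact TopCat.Presheaf.germ_res_apply X.presheaf (homOfLE hle) z hz σ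
    · exact congrArg _ (TopCat.Presheaf.germ_res_apply X.presheaf (homOfLE hle) z hz _)
  have h1 := eventually_isPrime hUa hxU I (by rwa [hI])
  filter_upwards [h1, U.isOpen.mem_nhds hxU] with z hz hzU hz' hσ hr
  have h2 := hz hzU
  rw [hI, hI] at h2
  refine h2.resolve_left fun h3 => ?_
  have h4 : Ideal.span {X.presheaf.germ c.U z hz' σ,
      f.stalkMap z (S.presheaf.germ c.V (f z) (c.le hz') r)} ≤
        maximalIdeal (X.presheaf.stalk z) := by
    rw [Ideal.span_le]
    rintro _ (rfl | rfl)
    · exact hσ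
    · exact fun h5 => hr (isUnit_of_map_unit (f.stalkMap z).hom _ h5)
  rw [h3, top_le_iff] at h4
  exact (maximalIdeal.isMaximal _).ne_top h4

lemma NodeChart.eventually_prime [IsLocallyNoetherian S] (c : NodeChart f) {x : X}
    (hx : x ∈ c.U) (r : Γ(S, c.V)) (hr : r ∈ nonZeroDivisors Γ(S, c.V))
    (h : Prime (S.presheaf.germ c.V (f x) (c.le hx) r)) :
    ∀ᶠ z in 𝓝 x, ∀ hz : z ∈ c.U, ¬ IsUnit (S.presheaf.germ c.V (f z) (c.le hz) r) →
      Prime (S.presheaf.germ c.V (f z) (c.le hz) r) := by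
  have hI {y : S} (hy : y ∈ c.V) : (Ideal.span {r}).map (S.presheaf.germ c.V y hy).hom =
      Ideal.span {S.presheaf.germ c.V y hy r} := by
    rw [Ideal.map_span, Set.image_singleton]
  have hy : f x ∈ c.V := c.le hx
  have h1 := eventually_isPrime c.hV hy (Ideal.span {r}) (by
    rw [hI hy]
    exact (Ideal.span_singleton_prime h.ne_zero).mpr h)
  filter_upwards [f.continuous.continuousAt.eventually h1] with z hz hzU hru
  have hzV : f z ∈ c.V := c.le hzU
  have h2 := hz hzV
  rw [hI hzV, hI hy] at h2
  refine (Ideal.span_singleton_prime (nonZeroDivisors.ne_zero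
    (germ_mem_nonZeroDivisors c.hV hr hzV))).mp (h2.resolve_left fun h3 => ?_).1
  exact hru (Ideal.span_singleton_eq_top.mp h3)

namespace NodalFamily

variable {D : S.IdealSheafData} (F : NodalFamily f D)
include F

/-- A node chart whose discriminant is a product of prime elements can be sorted. -/
lemma exists_sortedChart_of_prod (c : NodeChart f) {x : X} (hx : x ∈ c.U)
    (hs : ¬ IsUnit (X.presheaf.germ c.U x hx c.s)) (ht : ¬ IsUnit (X.presheaf.germ c.U x hx c.t))
    (ha : c.a ∈ nonZeroDivisors Γ(S, c.V)) {d : ℕ} {t : Fin d → S.presheaf.stalk (f x)}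
    (hsys : IsRegularSystem t) (n : Fin d → Γ(S, c.V))
    (hn : ∀ j, Associated (S.presheaf.germ c.V (f x) (c.le hx) (n j)) (t j)) (L : List (Fin d))
    (hL : (L.map n).prod = c.a) : ∃ c' : SortedChart f, x ∈ c'.U := by
  have := F.regular.1
  have := F.locallyOfFiniteType
  have := F.isLocallyNoetherian f
  have hnode := c.isNode hx hs ht
  let key (j : Fin d) := branchKey f x (X.presheaf.germ c.U x hx c.s)
    (X.presheaf.germ c.U x hx c.t) (S.presheaf.germ c.V (f x) (c.le hx) (n j))
  have hdvd {j : Fin d} (hj : j ∈ L) : n j ∣ c.a := by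
    rw [← hL]
    exact List.dvd_prod (List.mem_map_of_mem hj)
  have htdvd {j : Fin d} (hj : j ∈ L) : t j ∣ S.presheaf.germ c.V (f x) (c.le hx) c.a :=
    (hn j).symm.dvd.trans (map_dvd (S.presheaf.germ c.V (f x) (c.le hx)).hom (hdvd hj))
  have hspan {σ τ : X.presheaf.stalk x} {α : S.presheaf.stalk (f x)}
      (h : IsNode (f.stalkMap x).hom α σ τ) {j : Fin d} (hj : t j ∣ α) :
      (Ideal.span {σ, f.stalkMap x (S.presheaf.germ c.V (f x) (c.le hx) (n j))}).IsPrime := by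
    rw [span_pair_congr (.refl _) ((hn j).map (f.stalkMap x).hom)]
    exact h.isPrime_span hsys j hj
  -- At nearby nodes every factor which is still not a unit keeps the key it has at `x`, so one
  -- ordering chosen at `x` serves a whole neighborhood.
  have key1 : ∀ j ∈ L.toFinset, ∀ᶠ z in 𝓝 x, ∀ hz : z ∈ c.U,
      ¬ IsUnit (X.presheaf.germ c.U z hz c.s) → ¬ IsUnit (X.presheaf.germ c.U z hz c.t) →
      ¬ IsUnit (S.presheaf.germ c.V (f z) (c.le hz) (n j)) →
        (Prime (S.presheaf.germ c.V (f z) (c.le hz) (n j)) ∧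
        (Ideal.span {X.presheaf.germ c.U z hz c.s,
          f.stalkMap z (S.presheaf.germ c.V (f z) (c.le hz) (n j))}).IsPrime ∧
        (Ideal.span {X.presheaf.germ c.U z hz c.t,
          f.stalkMap z (S.presheaf.germ c.V (f z) (c.le hz) (n j))}).IsPrime) ∧
        branchKey f z (X.presheaf.germ c.U z hz c.s) (X.presheaf.germ c.U z hz c.t)
          (S.presheaf.germ c.V (f z) (c.le hz) (n j)) = key j := by
    intro j hj
    replace hj := List.mem_toFinset.mp hj
    have hnzd : n j ∈ nonZeroDivisors Γ(S, c.V) := by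
      obtain ⟨w, hw⟩ := hdvd hj
      rw [hw] at ha
      exact (mul_mem_nonZeroDivisors.mp ha).1
    filter_upwards [c.eventually_prime hx (n j) hnzd (((hn j).prime_iff).mpr (hsys.prime j)),
      c.eventually_span_isPrime hx c.s (n j) (hspan hnode (htdvd hj)),
      c.eventually_span_isPrime hx c.t (n j) (hspan hnode.symm (htdvd hj))]
      with z h1 h2 h3 hz hs ht hu
    obtain ⟨h4, h5⟩ := h2 hz hs hu
    obtain ⟨h6, h7⟩ := h3 hz ht hu
    refine ⟨⟨h1 hz hu, h4, h6⟩, ?_⟩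
    rw [branchKey, h5, h7]
    rfl
  obtain ⟨W, hW, hWo, hxW⟩ := eventually_nhds_iff.mp ((Finset.eventually_all _).mpr key1)
  let U : X.Opens := c.U ⊓ ⟨W, hWo⟩
  have hUc : U ≤ c.U := inf_le_left
  let L' := L.insertionSort fun i j => key i ≤ key j
  have hperm : L'.Perm L := List.perm_insertionSort _ _
  have key2 {z : X} (hz : z ∈ U) (hs : ¬ IsUnit (X.presheaf.germ U z hz (c.restrict U hUc).s))
      (ht : ¬ IsUnit (X.presheaf.germ U z hz (c.restrict U hUc).t)) {j : Fin d} (hj : j ∈ L')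
      (hu : ¬ IsUnit (S.presheaf.germ c.V (f z) (c.le hz.1) (n j))) := by
    rw [c.restrict_s U hUc hz] at hs
    rw [c.restrict_t U hUc hz] at ht
    exact hW z hz.2 j (List.mem_toFinset.mpr (hperm.mem_iff.mp hj)) hz.1 hs ht hu
  refine ⟨⟨c.restrict U hUc, L'.map n, ?_, ha, ?_, ?_⟩, ⟨hx, hxW⟩⟩
  · exact (hperm.map n).prod_eq.trans hL
  · intro z hz hs ht r hr
    obtain ⟨j, hj, rfl⟩ := List.mem_map.mp hr
    refine or_iff_not_imp_left.mpr fun hu => ?_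
    have h1 := (key2 hz hs ht hj hu).1
    rw [← c.restrict_s U hUc hz, ← c.restrict_t U hUc hz] at h1
    exact h1
  · intro z hz hs ht
    refine List.pairwise_map.mpr ?_
    have hsort : L'.Pairwise fun i j => key i ≤ key j := List.pairwise_insertionSort _ _
    refine hsort.imp_of_mem fun {i j} hi hj hij hui huj => ?_
    have h1 := (key2 hz hs ht hi hui).2
    have h2 := (key2 hz hs ht hj huj).2
    rw [← c.restrict_s U hUc hz, ← c.restrict_t U hUc hz] at h1 h2
    exact h1.le.trans (hij.trans h2.ge)

/-- There is a sorted chart at every node. -/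
theorem exists_sortedChart (c : NodeChart f) {x : X} (hx : x ∈ c.U)
    (hs : ¬ IsUnit (X.presheaf.germ c.U x hx c.s)) (ht : ¬ IsUnit (X.presheaf.germ c.U x hx c.t)) :
    ∃ c' : SortedChart f, x ∈ c'.U := by
  have := F.regular.1
  have := F.isDomain (f x)
  have hnoeth : IsNoetherianRing Γ(S, c.V) := IsLocallyNoetherian.component_noetherian ⟨c.V, c.hV⟩
  let : Algebra Γ(S, c.V) (S.presheaf.stalk (f x)) :=
    (S.presheaf.germ c.V (f x) (c.le hx)).hom.toAlgebra
  let p := (c.hV.primeIdealOf ⟨f x, c.le hx⟩).asIdeal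
  have hloc : IsLocalization.AtPrime (S.presheaf.stalk (f x)) p :=
    c.hV.isLocalization_stalk ⟨f x, c.le hx⟩
  obtain ⟨d, t, J, hsys, -, ⟨N, hN⟩, -⟩ := F.exists_isRegularSystem hx hs ht
  -- Writing the power as the product of a list of primes allows the discriminant to be extracted as
  -- the product of a list of the same primes.
  have h1 : (∏ j ∈ J, t j) ^ N = (((List.replicate N J.toList).flatten).map t).prod := by
    simp [List.map_flatten, List.prod_flatten]
  rw [h1] at hN
  obtain ⟨L, -, hL⟩ := exists_associated_of_dvd_prod t (fun j _ => hsys.prime j) hN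
  choose n hn using fun j => exists_associated_algebraMap (R := Γ(S, c.V)) p (t j)
  have h2 : Associated (algebraMap Γ(S, c.V) (S.presheaf.stalk (f x)) (L.map n).prod)
      (L.map t).prod := by
    rw [map_list_prod, List.map_map]
    clear hL
    induction L with
    | nil => exact .refl _
    | cons j L ih => exact (hn j).mul_mul ih
  have h3 : Associated (algebraMap Γ(S, c.V) (S.presheaf.stalk (f x)) c.a)
      (algebraMap Γ(S, c.V) (S.presheaf.stalk (f x)) (L.map n).prod) := hL.trans h2.symm
  obtain ⟨u, hu, v, hv, huv⟩ := exists_mul_eq_mul_of_associated p h3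
  have h4 : algebraMap Γ(S, c.V) (S.presheaf.stalk (f x)) c.a ≠ 0 := by
    intro h5
    have h6 : (L.map t).prod = 0 := (hL.eq_zero_iff).mp h5
    obtain ⟨j, -, hj⟩ := List.mem_map.mp (List.prod_eq_zero_iff.mp h6)
    exact (hsys.prime j).ne_zero hj
  obtain ⟨r₀, hr₀, hann⟩ := exists_mul_eq_zero_of_mem_nonZeroDivisors p
    (mem_nonZeroDivisors_of_ne_zero h4)
  -- Inverting `r₀` makes the discriminant regular; inverting `u` and `v` makes it a unit multiple
  -- of the product of the chosen numerators.
  let r := r₀ * (u * v)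
  have hr : r ∉ p := p.primeCompl.mul_mem hr₀ (p.primeCompl.mul_mem hu hv)
  have hxr : f x ∈ S.basicOpen r := (S.mem_basicOpen r (f x) (c.le hx)).mpr
    ((IsLocalization.AtPrime.isUnit_to_map_iff (S.presheaf.stalk (f x)) p r).mpr hr)
  let : Algebra Γ(S, c.V) Γ(S, S.basicOpen r) :=
    (S.presheaf.map (homOfLE (S.basicOpen_le r)).op).hom.toAlgebra
  have haway : IsLocalization.Away r Γ(S, S.basicOpen r) := c.hV.isLocalization_basicOpen r
  let ρ := algebraMap Γ(S, c.V) Γ(S, S.basicOpen r)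
  have hρ : IsUnit (ρ r) := IsLocalization.Away.algebraMap_isUnit r
  rw [map_mul, map_mul] at hρ
  have hρu : IsUnit (ρ u) := isUnit_of_mul_isUnit_left (isUnit_of_mul_isUnit_right hρ)
  have hρv : IsUnit (ρ v) := isUnit_of_mul_isUnit_right (isUnit_of_mul_isUnit_right hρ)
  have hw : IsUnit (ρ v * ↑hρu.unit⁻¹) := hρv.mul (Units.isUnit _)
  have h5 : ρ c.a = (ρ v * ↑hρu.unit⁻¹) * (L.map (ρ ∘ n)).prod := by
    rw [← List.map_map, List.prod_hom]
    have h6 := congr(ρ $huv)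
    rw [map_mul, map_mul] at h6
    rw [mul_right_comm, mul_comm (ρ v), ← h6, mul_assoc, IsUnit.mul_val_inv, mul_one]
  let c₁ := c.restrictBase r hw h5
  have hx₁ : x ∈ c₁.U := ⟨hx, hxr⟩
  -- The point remains a node in the new chart: an invertible coordinate would make it formally
  -- smooth over the base.
  have hns : ¬ (IsUnit (X.presheaf.germ c₁.U x hx₁ c₁.s) ∨ IsUnit (X.presheaf.germ c₁.U x hx₁ c₁.t)) :=
    fun h => (c.isNode hx hs ht).not_formallySmooth (c₁.isCurvePoint hx₁ h).formallySmooth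
  rw [not_or] at hns
  refine F.exists_sortedChart_of_prod c₁ hx₁ hns.1 hns.2 ?_ hsys (ρ ∘ n) (fun j => ?_) L rfl
  · have h6 : ρ c.a ∈ nonZeroDivisors Γ(S, S.basicOpen r) := by
      refine mem_nonZeroDivisors_away (R := Γ(S, c.V)) (r := r) fun b hb => ?_
      rw [mul_right_comm, hann b hb, zero_mul]
    rw [h5] at h6
    exact (mul_mem_nonZeroDivisors.mp h6).2
  · have h6 : S.presheaf.germ (S.basicOpen r) (f x) hxr (ρ (n j)) =
        S.presheaf.germ c.V (f x) (c.le hx) (n j) :=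
      TopCat.Presheaf.germ_res_apply S.presheaf (homOfLE (S.basicOpen_le r)) (f x) hxr _
    have h7 := hn j
    exact h6 ▸ h7

end NodalFamily

end SortedChartExistence

/-! ### The glued modification and the images of its pieces. -/

section ModificationGeometry

variable {X S : Scheme.{u}} {f : X ⟶ S} {D : S.IdealSheafData} (F : NodalFamily f D)

namespace NodalFamily

/-- The modification of a nodal family. -/
def modification : Scheme.{u} := F.gluingPieces.glued

/-- The inclusion of a piece of the modification. -/
def incl (i : Option (Σ c : SortedChart f, Fin c.τ.length)) : F.piece i ⟶ F.modification :=
  F.gluingPieces.ι i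

instance (i) : IsOpenImmersion (F.incl i) := GluingPieces.instIsOpenImmersionι F.gluingPieces i

/-- The projection of the modification. -/
def proj : F.modification ⟶ X := F.gluingPieces.π

lemma incl_proj (i) : F.incl i ≫ F.proj = F.pieceHom i := F.gluingPieces.ι_π i

lemma incl_proj_assoc (i) {Z : Scheme.{u}} (k : X ⟶ Z) :
    F.incl i ≫ F.proj ≫ k = F.pieceHom i ≫ k := F.gluingPieces.ι_π_assoc i k

lemma proj_incl (i) (q : F.piece i) : F.proj (F.incl i q) = F.pieceHom i q :=
  congr($(F.incl_proj i) q)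

lemma exists_incl_eq (p : F.modification) : ∃ i q, F.incl i q = p := F.gluingPieces.exists_ι_eq p

/-- The cover of the modification by its pieces. -/
def cover : F.modification.OpenCover := F.gluingPieces.glueData.openCover

instance : LocallyOfFiniteType F.proj := by
  have := HasRingHomProperty.instIsZariskiLocalAtSource (P := @LocallyOfFiniteType.{u})
  suffices h : ∀ i, LocallyOfFiniteType (F.incl i ≫ F.proj) from
    (IsZariskiLocalAtSource.iff_of_openCover (P := @LocallyOfFiniteType.{u}) F.cover).mpr h
  intro i
  rw [F.incl_proj]
  infer_instance

instance : Flat (F.proj ≫ f) := by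
  have := HasRingHomProperty.instIsZariskiLocalAtSource (P := @Flat.{u})
  suffices h : ∀ i, Flat (F.incl i ≫ F.proj ≫ f) from
    (IsZariskiLocalAtSource.iff_of_openCover (P := @Flat.{u}) F.cover).mpr h
  intro i
  rw [F.incl_proj_assoc]
  infer_instance

lemma isLocallyNoetherian_modification : IsLocallyNoetherian F.modification :=
  have := F.locallyOfFiniteType
  F.isLocallyNoetherian (F.proj ≫ f)

instance : QuasiSeparated F.proj :=
  have := F.isLocallyNoetherian_modification
  inferInstance

lemma isSNCHom_proj (p : F.modification) :
    IsSNCHom (stalkIdeal D ((F.proj ≫ f) p)) ((F.proj ≫ f).stalkMap p).hom := by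
  obtain ⟨i, q, rfl⟩ := F.exists_incl_eq p
  refine (isSNCHom_comp_iff (F.incl i) (F.proj ≫ f) q).mp ?_
  rw [F.incl_proj_assoc]
  exact F.isSNCHom_pieceHom i q

/-- Since the gluing uses the largest overlaps, an open subscheme mapping to a piece over `X` is
already identified with part of that piece. -/
lemma mem_range_incl_of_hom {p : F.modification} {N : F.modification.Opens} (hp : p ∈ N) {i}
    (g : N.toScheme ⟶ F.piece i) (hg : g ≫ F.pieceHom i = N.ι ≫ F.proj) :
    p ∈ Set.range (F.incl i) := by
  obtain ⟨j, q, rfl⟩ := F.exists_incl_eq p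
  have h1 : (F.incl j ∣_ N ≫ g) ≫ F.pieceHom i = (F.incl j ⁻¹ᵁ N).ι ≫ F.pieceHom j := by
    rw [Category.assoc, hg, morphismRestrict_ι_assoc, F.incl_proj]
  exact ⟨_, (F.gluingPieces.ι_apply_eq j i h1 ⟨q, hp⟩).symm⟩

lemma mem_range_incl_none {p : F.modification} (hp : F.proj p ∈ F.smoothOpen) :
    p ∈ Set.range (F.incl none) :=
  F.mem_range_incl_of_hom (N := F.proj ⁻¹ᵁ F.smoothOpen) hp (F.proj ∣_ F.smoothOpen)
    (morphismRestrict_ι _ _)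

lemma adaptedAt_proj (p : F.modification) (c : SortedChart f) (hp : F.proj p ∈ c.U) :
    c.AdaptedAt F.proj p := by
  obtain ⟨i, q, rfl⟩ := F.exists_incl_eq p
  have hq : F.pieceHom i q ∈ c.U := F.proj_incl i q ▸ hp
  obtain ⟨hq', h⟩ : c.AdaptedAt (F.incl i ≫ F.proj) q := by
    rw [F.incl_proj]
    exact F.adaptedAt_pieceHom i q c hq
  refine ⟨hp, fun j => ?_⟩
  have h1 := h j
  let e := (asIso ((F.incl i).stalkMap q)).commRingCatIsoToRingEquiv
  rw [Scheme.Hom.stalkMap_comp] at h1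
  exact h1.imp (fun h => (map_dvd_iff e).mp h) (fun h => (map_dvd_iff e).mp h)

/-- The divisibilities hold on the piece and descend to the modification, which is adapted;
conversely they yield a local lift, and local lifts are absorbed by the overlaps. -/
lemma mem_range_incl_some_iff {p : F.modification} {c : SortedChart f} {k : Fin c.τ.length} :
    p ∈ Set.range (F.incl (some ⟨c, k⟩)) ↔ c.DvdAt k F.proj p := by
  constructor
  · rintro ⟨q, rfl⟩
    have h1 : c.DvdAt k (F.incl (some ⟨c, k⟩) ≫ F.proj) q := by
      rw [F.incl_proj]
      exact c.dvdAt_sortedHom k q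
    have : Flat ((F.incl (some ⟨c, k⟩) ≫ F.proj) ≫ f) := by
      rw [F.incl_proj]
      exact F.flat_pieceHom _
    exact h1.of_comp _ (F.adaptedAt_proj _ c h1.choose)
  · intro h
    obtain ⟨N, g, hN, hg⟩ := h.exists_lift
    exact F.mem_range_incl_of_hom hN g hg

end NodalFamily

end ModificationGeometry

/-! ### The divisibility argument behind the valuative criterion. -/

section ValuativeAlgebra

variable {O K : Type*} [CommRing O] [Field K] (θ : O →+* K)

/-- The largest index with `c k ∣ s ∣ c (k + 1)` has integral `v`. Among the indices with integral
`v` the smallest has integral `u`: otherwise `u` is a unit with integral inverse, and this inverse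
is the `v` of the preceding index. -/
lemma exists_dvd_step {R : Subring K} (hR : ∀ x : K, x ∉ R → x⁻¹ ∈ R) (hθ : ∀ x, θ x ≠ 0 → IsUnit x)
    {n : ℕ} {c : ℕ → O} {s t : O} (hmono : ∀ {i j}, i ≤ j → c i ∣ c j) (h0 : c 0 = 1)
    (hn : c n = s * t) (hc : ∀ i ≤ n, c i ∈ nonZeroDivisors O) (hs : θ s ∈ R) (ht : θ t ∈ R) {k₀ : ℕ}
    (hk₀ : k₀ < n) (hk₀' : c k₀ ∣ s) (hk₀'' : s ∣ c (k₀ + 1)) :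
    ∃ k < n, ∃ u v, s = c k * u ∧ c (k + 1) = s * v ∧ θ u ∈ R ∧ θ v ∈ R := by
  classical
  have hsn : s ∈ nonZeroDivisors O := by
    have := hc n le_rfl
    rw [hn] at this
    exact (mul_mem_nonZeroDivisors.mp this).1
  let P (k : ℕ) : Prop := k < n ∧ c k ∣ s ∧ s ∣ c (k + 1)
  let Q (k : ℕ) : Prop := P k ∧ ∃ v, c (k + 1) = s * v ∧ θ v ∈ R
  have hQ : ∃ k, Q k := by
    have hP := Nat.findGreatest_spec (P := P) hk₀.le ⟨hk₀, hk₀', hk₀''⟩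
    obtain ⟨m, hm⟩ : ∃ m, m = Nat.findGreatest P n := ⟨_, rfl⟩
    rw [← hm] at hP
    obtain ⟨hmn, hms, v, hv⟩ := hP
    refine ⟨m, ⟨hmn, hms, v, hv⟩, v, hv, ?_⟩
    -- A value outside `R` is nonzero, so `v` is a unit and `c (m + 1) ∣ s`. The next index then
    -- contradicts maximality, unless `m + 1 = n`, where `v` is `t`.
    by_contra h
    have hvu : IsUnit v := hθ v fun h1 => h (h1 ▸ R.zero_mem)
    have h1 : c (m + 1) ∣ s := by rw [hv, hvu.mul_right_dvd]
    obtain h2 | h2 := Nat.lt_or_ge (m + 1) n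
    · have h3 := Nat.le_findGreatest (P := P) h2.le ⟨h2, h1, (Dvd.intro _ hv.symm).trans (hmono (Nat.le_succ _))⟩
      rw [← hm] at h3
      exact Nat.not_succ_le_self _ h3
    · obtain rfl : n = m + 1 := le_antisymm h2 hmn
      rw [hn] at hv
      exact h ((mul_cancel_left_mem_nonZeroDivisors hsn).mp hv ▸ ht)
  obtain ⟨⟨hk, ⟨u, hu⟩, -⟩, v, hv, hvR⟩ := Nat.find_spec hQ
  refine ⟨_, hk, u, v, hu, hv, ?_, hvR⟩
  by_contra h
  have huu : IsUnit u := hθ u fun h1 => h (h1 ▸ R.zero_mem)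
  obtain ⟨m, hm⟩ : ∃ m, m = Nat.find hQ := ⟨_, rfl⟩
  have hmin := fun j => Nat.find_min (m := j) hQ
  rw [← hm] at hmin hk hu hv
  cases m with
  | zero =>
    rw [h0, one_mul] at hu
    exact h (hu ▸ hs)
  | succ m =>
    refine hmin m m.lt_succ_self ⟨⟨m.lt_succ_self.trans hk, (hmono m.le_succ).trans (Dvd.intro _ hu.symm), ?_⟩, ↑huu.unit⁻¹, ?_, ?_⟩
    · rw [hu, huu.mul_right_dvd]
    · rw [hu, mul_assoc, IsUnit.mul_val_inv, mul_one]
    · rw [map_units_inv]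
      exact hR _ h

lemma mul_eq_one_of_dvd {s ci cj v u' e : O} (hs : s ∈ nonZeroDivisors O) (hu : s = cj * u')
    (hv : ci = s * v) (he : cj = ci * e) : v * u' * e = 1 := by
  refine (mul_cancel_left_mem_nonZeroDivisors hs).mp ?_
  rw [mul_one]
  conv_rhs => rw [hu, he, hv]
  ring

end ValuativeAlgebra

/-! ### Evaluation at points with values in local rings, and integral points of pieces. -/

section LocalPoints

open IsLocalRing Scheme

variable {X T : Scheme.{u}} {R K : Type u} [CommRing R] [IsLocalRing R] [Field K] [Algebra R K]

/-- The value at the stalk of `p` of a section over a neighborhood of the image of `p`. -/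
def stalkEval (m : T ⟶ X) {U : X.Opens} {p : T} (hp : m p ∈ U) : Γ(X, U) →+* T.presheaf.stalk p :=
  (X.presheaf.germ U (m p) hp ≫ m.stalkMap p).hom

lemma stalkEval_comp {T' : Scheme.{u}} (k : T' ⟶ T) (m : T ⟶ X) {U : X.Opens} {p : T'}
    (hp : m (k p) ∈ U) (r : Γ(X, U)) :
    k.stalkMap p (stalkEval m hp r) = stalkEval (k ≫ m) (p := p) hp r := by
  exact congr($((Scheme.Hom.stalkMap_comp k m p).symm) (X.presheaf.germ U _ hp r))

lemma stalkSpecializes_stalkEval (m : T ⟶ X) {U : X.Opens} {p q : T} (h : q ⤳ p) (hp : m p ∈ U)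
    (hq : m q ∈ U) (r : Γ(X, U)) :
    T.presheaf.stalkSpecializes h (stalkEval m hp r) = stalkEval m hq r := by
  have h1 := m.germ_stalkMap_apply U p hp r
  have h2 := m.germ_stalkMap_apply U q hq r
  refine (congr(T.presheaf.stalkSpecializes h $h1)).trans (Eq.trans ?_ h2.symm)
  exact TopCat.Presheaf.germ_stalkSpecializes_apply ..

/-- The image of the generic point specializes to that of the closed point; the compatibility of
evaluations compares germs at the two points inside `K`. -/
lemma exists_stalkSpecializes_stalkClosedPointTo {L : Spec (.of R) ⟶ T} {L₁ : Spec (.of K) ⟶ T}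
    (h : Spec.map (CommRingCat.ofHom (algebraMap R K)) ≫ L = L₁) :
    ∃ hs : L₁ (closedPoint K) ⤳ L (closedPoint R),
      T.presheaf.stalkSpecializes hs ≫ stalkClosedPointTo L₁ =
        stalkClosedPointTo L ≫ CommRingCat.ofHom (algebraMap R K) := by
  subst h
  let j := Spec.map (CommRingCat.ofHom (algebraMap R K))
  have h1 : j (closedPoint K) ⤳ closedPoint R := specializes_closedPoint _
  refine ⟨h1.map L.continuous, ?_⟩
  have h2 : stalkClosedPointTo (j ≫ L) = L.stalkMap (j (closedPoint K)) ≫ stalkClosedPointTo j :=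
    stalkClosedPointTo_comp j L
  have h3 : (Spec (.of R)).presheaf.stalkSpecializes h1 ≫ stalkClosedPointTo j =
      (stalkClosedPointIso (.of R)).hom ≫ CommRingCat.ofHom (algebraMap R K) := by
    have h4 := germ_stalkClosedPointTo_Spec (CommRingCat.ofHom (algebraMap R K))
    rw [← Iso.inv_comp_eq, ← cancel_epi (ΓSpecIso (.of R)).hom, ← Category.assoc,
      ΓSpecIso_hom_stalkClosedPointIso_inv, ← h4, ← Category.assoc]
    congr 1
    exact TopCat.Presheaf.germ_stalkSpecializes ..
  have h5 := Scheme.Hom.stalkSpecializes_stalkMap L _ _ h1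
  refine congr(T.presheaf.stalkSpecializes (h1.map L.continuous) ≫ $h2).trans ?_
  refine (Category.assoc _ _ _).symm.trans (congr($h5 ≫ _).trans ?_)
  rw [Category.assoc, h3, stalkClosedPointTo, Category.assoc]

lemma stalkClosedPointTo_stalkEval (L : Spec (.of R) ⟶ T) (m : T ⟶ X) {U : X.Opens}
    (h : m (L (closedPoint R)) ∈ U) (r : Γ(X, U)) :
    stalkClosedPointTo L (stalkEval m h r) =
      stalkClosedPointTo (L ≫ m) (X.presheaf.germ U ((L ≫ m) (closedPoint R)) h r) := by
  rw [stalkClosedPointTo_comp]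
  rfl

lemma stalkClosedPointTo_stalkEval_eq {L₁ : Spec (.of K) ⟶ T} (m : T ⟶ X) {L : Spec (.of R) ⟶ X}
    (h : L₁ ≫ m = Spec.map (CommRingCat.ofHom (algebraMap R K)) ≫ L) {U : X.Opens}
    (h₁ : m (L₁ (closedPoint K)) ∈ U) (hU : L (closedPoint R) ∈ U) (r : Γ(X, U)) :
    stalkClosedPointTo L₁ (stalkEval m h₁ r) =
      algebraMap R K (stalkClosedPointTo L (X.presheaf.germ U _ hU r)) := by
  obtain ⟨hs, h2⟩ := exists_stalkSpecializes_stalkClosedPointTo h.symm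
  rw [stalkClosedPointTo_stalkEval]
  refine Eq.trans ?_ congr($h2 (X.presheaf.germ U _ hU r))
  rw [CommRingCat.comp_apply]
  congr 1
  exact (TopCat.Presheaf.germ_stalkSpecializes_apply ..).symm

lemma comp_specHom {U : X.Opens} {A : Type u} [CommRing A] (θ : A →+* Γ(X, U))
    {g : Spec (.of R) ⟶ X} {g' : Spec (.of R) ⟶ U.toScheme} (h : g' ≫ U.ι = g)
    (hU : g (closedPoint R) ∈ U) : g' ≫ specHom U θ =
    Spec.map (CommRingCat.ofHom ((X.presheaf.germ U _ hU ≫ stalkClosedPointTo g).hom.comp θ)) := by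
  have h1 : g' = Spec.map (stalkClosedPointTo g) ≫ U.fromSpecStalkOfMem _ hU := by
    rw [← cancel_mono U.ι, h, Category.assoc, Opens.fromSpecStalkOfMem_ι,
      Spec_stalkClosedPointTo_fromSpecStalk]
  rw [h1, specHom, Category.assoc, Opens.fromSpecStalkOfMem_toSpecΓ_assoc, ← Spec.map_comp,
    ← Spec.map_comp]
  rfl

namespace NodeChart

variable {S : Scheme.{u}} {f : X ⟶ S} (c : NodeChart f) {e τ e' : Γ(S, c.V)}
  (h : e * τ * e' = c.a)

omit [IsLocalRing R] in
-- Integral values of the two coordinates define a map to `R` by the universal property; the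
-- required identities can be checked in `K` because `R` embeds there.
lemma exists_eq_comp_rescale {A : Type u} [CommRing A] {a e τ e' : A} {h : e * τ * e' = a}
    (hinj : Function.Injective (algebraMap R K)) {φ : NodeAlgebra A a →+* R}
    {ψ : NodeAlgebra A τ →+* K} (hψφ : ψ.comp (NodeAlgebra.rescale h) = (algebraMap R K).comp φ)
    (hx : ψ (NodeAlgebra.x τ) ∈ (algebraMap R K).range)
    (hy : ψ (NodeAlgebra.y τ) ∈ (algebraMap R K).range) :
    ∃ ψ' : NodeAlgebra A τ →+* R, (algebraMap R K).comp ψ' = ψ ∧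
      φ = ψ'.comp (NodeAlgebra.rescale h) := by
  have hbase : ψ.comp (algebraMap A _) = (algebraMap R K).comp (φ.comp (algebraMap A _)) := by
    have h1 : (NodeAlgebra.rescale h).comp (algebraMap A _) = algebraMap _ _ :=
      NodeAlgebra.lift_comp_algebraMap ..
    rw [← h1, ← RingHom.comp_assoc, hψφ, RingHom.comp_assoc]
  obtain ⟨u, hu⟩ := hx
  obtain ⟨v, hv⟩ := hy
  have huv : u * v = φ (algebraMap A _ τ) := by
    apply hinj
    have h1 := RingHom.congr_fun hbase τ
    rw [RingHom.comp_apply, RingHom.comp_apply, RingHom.comp_apply] at h1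
    rw [← h1, map_mul, hu, hv, ← map_mul, NodeAlgebra.x_mul_y]
  obtain ⟨ψ', h1, h2, h3⟩ : ∃ ψ' : NodeAlgebra A τ →+* R,
      ψ'.comp (algebraMap A _) = φ.comp (algebraMap A _) ∧ ψ' (NodeAlgebra.x τ) = u ∧
      ψ' (NodeAlgebra.y τ) = v :=
    ⟨NodeAlgebra.lift (φ.comp (algebraMap A _)) u v huv, NodeAlgebra.lift_comp_algebraMap ..,
      NodeAlgebra.lift_x .., NodeAlgebra.lift_y ..⟩
  have hψ' : (algebraMap R K).comp ψ' = ψ := by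
    refine NodeAlgebra.hom_ext ?_ ?_ ?_
    · rw [hbase, RingHom.comp_assoc, h1]
    · rw [RingHom.comp_apply, h2, hu]
    · rw [RingHom.comp_apply, h3, hv]
  refine ⟨ψ', hψ', RingHom.ext fun r => hinj ?_⟩
  have h1 := RingHom.congr_fun hψφ r
  rw [← hψ'] at h1
  exact h1.symm

lemma exists_pieceSnd_eq (i₁ : Spec (.of R) ⟶ c.piece h) : ∃ ψ : NodeAlgebra Γ(S, c.V) τ →+* R,
    i₁ ≫ c.pieceSnd h = Spec.map (CommRingCat.ofHom ψ) ∧ ∀ r, ψ r = stalkClosedPointTo i₁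
      ((c.piece h).presheaf.germ ⊤ (i₁ (closedPoint R)) trivial (c.pieceθ h r)) := by
  have htop : (c.piece h).topIso.inv ≫ (⊤ : (c.piece h).Opens).ι = 𝟙 _ := Iso.inv_hom_id _
  have h1 : (i₁ ≫ (c.piece h).topIso.inv) ≫ (⊤ : (c.piece h).Opens).ι = i₁ := by
    rw [Category.assoc, htop, Category.comp_id]
  refine ⟨_, Eq.trans ?_ (comp_specHom (c.pieceθ h) h1 trivial), fun r => rfl⟩
  rw [specHom_pieceθ, ← Category.assoc, h1]

/-- A point of a piece with values in the field of fractions of a local domain is integral if its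
coordinates are integral. -/
lemma exists_lift_of_mem_range (hinj : Function.Injective (algebraMap R K))
    {i₁ : Spec (.of K) ⟶ c.piece h} {i₂ : Spec (.of R) ⟶ X}
    (comm : i₁ ≫ c.pieceHom h = Spec.map (CommRingCat.ofHom (algebraMap R K)) ≫ i₂)
    (hU : i₂ (closedPoint R) ∈ c.U)
    (hx : stalkClosedPointTo i₁ ((c.piece h).presheaf.germ ⊤ (i₁ (closedPoint K)) trivial
      (c.pieceθ h (NodeAlgebra.x τ))) ∈ (algebraMap R K).range)
    (hy : stalkClosedPointTo i₁ ((c.piece h).presheaf.germ ⊤ (i₁ (closedPoint K)) trivial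
      (c.pieceθ h (NodeAlgebra.y τ))) ∈ (algebraMap R K).range) :
    ∃ L : Spec (.of R) ⟶ c.piece h, Spec.map (CommRingCat.ofHom (algebraMap R K)) ≫ L = i₁ ∧
      L ≫ c.pieceHom h = i₂ := by
  have hrange : Set.range i₂ ⊆ Set.range c.U.ι := by
    rw [Scheme.Opens.range_ι]
    rintro _ ⟨y, rfl⟩
    have h1 : y ∈ i₂ ⁻¹ᵁ c.U := preimage_eq_top_of_closedPoint_mem i₂ hU ▸ trivial
    exact h1
  obtain ⟨i₂', hi₂'⟩ : ∃ i₂', i₂' ≫ c.U.ι = i₂ :=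
    ⟨IsOpenImmersion.lift c.U.ι i₂ hrange, IsOpenImmersion.lift_fac _ _ _⟩
  obtain ⟨φ, hφ⟩ : ∃ φ : NodeAlgebra Γ(S, c.V) c.a →+* R,
    i₂' ≫ specHom c.U c.θ = Spec.map (CommRingCat.ofHom φ) := ⟨_, comp_specHom c.θ hi₂' hU⟩
  obtain ⟨ψ, hψ, hψr⟩ := c.exists_pieceSnd_eq h i₁
  rw [← hψr] at hx hy
  have hj : Spec.map (CommRingCat.ofHom (algebraMap R K)) ≫ i₂' = i₁ ≫ c.pieceFst h := by
    rw [← cancel_mono c.U.ι, Category.assoc, hi₂', ← comm, pieceHom, Category.assoc]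
  have hψφ : ψ.comp (NodeAlgebra.rescale h) = (algebraMap R K).comp φ := by
    have h1 := congr(i₁ ≫ $(c.piece_condition h))
    rw [reassoc_of% hψ, ← reassoc_of% hj, hφ, ← Spec.map_comp, ← Spec.map_comp] at h1
    exact congr(($(Spec.map_injective h1)).hom).symm
  obtain ⟨ψ', hψ', hφψ'⟩ := exists_eq_comp_rescale hinj hψφ hx hy
  have hlift : i₂' ≫ specHom c.U c.θ = Spec.map (CommRingCat.ofHom ψ') ≫
      Spec.map (CommRingCat.ofHom (NodeAlgebra.rescale h)) := by
    rw [hφ, ← Spec.map_comp, hφψ', CommRingCat.ofHom_comp]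
  obtain ⟨L, hfst, hsnd⟩ : ∃ L : Spec (.of R) ⟶ c.piece h, L ≫ c.pieceFst h = i₂' ∧
      L ≫ c.pieceSnd h = Spec.map (CommRingCat.ofHom ψ') :=
    ⟨pullback.lift _ _ hlift, pullback.lift_fst _ _ hlift, pullback.lift_snd _ _ hlift⟩
  refine ⟨L, c.piece_hom_ext h ?_ ?_, ?_⟩
  · rw [Category.assoc, hfst, hj]
  · rw [Category.assoc, hsnd, hψ, ← hψ', CommRingCat.ofHom_comp, Spec.map_comp]
  · rw [pieceHom, ← Category.assoc, hfst, hi₂']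

end NodeChart

end LocalPoints

/-! ### Moving a valuation point to a piece of larger index. -/

section Properness

open IsLocalRing Scheme

variable {X S T : Scheme.{u}} {f : X ⟶ S}

namespace SortedChart

variable (c : SortedChart f)

/-- The partial products of the discriminant of a sorted chart. -/
def fn (k : ℕ) : Γ(X, c.U) := f.appLE c.V c.U c.le (c.τ.take k).prod

lemma fn_zero : c.fn 0 = 1 := by
  rw [fn, List.take_zero, List.prod_nil, map_one]

lemma fn_length : c.fn c.τ.length = c.s * c.t := by
  rw [fn, List.take_length, c.prod_eq, c.s_mul_t]

lemma fn_dvd_fn {i j : ℕ} (h : i ≤ j) : c.fn i ∣ c.fn j := by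
  refine map_dvd (f.appLE c.V c.U c.le).hom ?_
  rw [← List.prod_take_mul_prod_drop (c.τ.take j) i, List.take_take, min_eq_left h]
  exact dvd_mul_right _ _

lemma fn_succ (k : Fin c.τ.length) : c.fn (k + 1) = c.fn k * f.appLE c.V c.U c.le c.τ[k] := by
  rw [fn, List.prod_take_succ, map_mul]
  rfl

lemma stalkEval_fn {m : T ⟶ X} {p : T} (hp : m p ∈ c.U) (k : ℕ) :
    stalkEval m hp (c.fn k) = m.stalkMap p (f.stalkMap _ (c.part hp k)) := by
  rw [part_eq, ← germ_appLE c.le hp]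
  rfl

lemma stalkEval_fn_mem (m : T ⟶ X) [Flat (m ≫ f)] {p : T} (hp : m p ∈ c.U) (k : ℕ) :
    stalkEval m hp (c.fn k) ∈ nonZeroDivisors (T.presheaf.stalk p) := by
  rw [stalkEval_fn]
  exact stalkMap_mem_nonZeroDivisors m hp (c.part_dvd hp k)

lemma stalkEval_s_mem (m : T ⟶ X) [Flat (m ≫ f)] {p : T} (hp : m p ∈ c.U) :
    stalkEval m hp c.s ∈ nonZeroDivisors (T.presheaf.stalk p) :=
  stalkMap_sz_mem_nonZeroDivisors m hp

lemma dvdAt_iff {m : T ⟶ X} {p : T} (hp : m p ∈ c.U) {k : ℕ} : c.DvdAt k m p ↔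
    stalkEval m hp (c.fn k) ∣ stalkEval m hp c.s ∧
      stalkEval m hp c.s ∣ stalkEval m hp (c.fn (k + 1)) := by
  rw [stalkEval_fn, stalkEval_fn]
  exact ⟨fun h => h.2, fun h => ⟨hp, h⟩⟩

end SortedChart

variable {R K : Type u} [CommRing R] [IsLocalRing R] [Field K] [Algebra R K]
variable {D : S.IdealSheafData} (F : NodalFamily f D)

namespace NodalFamily

include F

/-- With `v = part (i + 1) / s` at `L`, `u = s / part k` at `L'` and `ε = part k / part (i + 1)`,
the product `v u ε` is `1` at the generic point, hence in `R`. So `v` and `ε` are units at `L`,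
where `s` and `part k` become associated. -/
lemma dvdAt_of_le (hinj : Function.Injective (algebraMap R K)) (c : SortedChart f)
    {L L' : Spec (.of R) ⟶ F.modification} {L₁ : Spec (.of K) ⟶ F.modification}
    (hL : Spec.map (CommRingCat.ofHom (algebraMap R K)) ≫ L = L₁)
    (hL' : Spec.map (CommRingCat.ofHom (algebraMap R K)) ≫ L' = L₁)
    {i k : ℕ} (hik : i ≤ k)
    (hi : c.DvdAt i F.proj (L (closedPoint R))) (hk : c.DvdAt k F.proj (L' (closedPoint R))) :
    c.DvdAt k F.proj (L (closedPoint R)) := by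
  obtain rfl | hlt := hik.eq_or_lt
  · exact hi
  obtain ⟨hs, hs₁⟩ := exists_stalkSpecializes_stalkClosedPointTo hL
  obtain ⟨hs', hs₁'⟩ := exists_stalkSpecializes_stalkClosedPointTo hL'
  have hU : F.proj (L (closedPoint R)) ∈ c.U := hi.1
  have hU' : F.proj (L' (closedPoint R)) ∈ c.U := hk.1
  have hU₁ : F.proj (L₁ (closedPoint K)) ∈ c.U := (hs.map F.proj.continuous).mem_open c.U.isOpen hU
  obtain ⟨ε, hε⟩ := c.fn_dvd_fn (Nat.succ_le_of_lt hlt)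
  obtain ⟨v, hv⟩ := ((c.dvdAt_iff hU).mp hi).2
  obtain ⟨u, hu⟩ := ((c.dvdAt_iff hU').mp hk).1
  have h1 (r) := stalkSpecializes_stalkEval F.proj hs hU hU₁ r
  have h1' (r) := stalkSpecializes_stalkEval F.proj hs' hU' hU₁ r
  have hv₁ := congr(F.modification.presheaf.stalkSpecializes hs $hv)
  have hu₁ := congr(F.modification.presheaf.stalkSpecializes hs' $hu)
  rw [map_mul, h1, h1] at hv₁
  rw [map_mul, h1', h1'] at hu₁
  have hε₁ := congr(stalkEval F.proj hU₁ $hε)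
  rw [map_mul] at hε₁
  have h2 := mul_eq_one_of_dvd (c.stalkEval_s_mem F.proj hU₁) hu₁ hv₁ hε₁
  rw [← h1 ε] at h2
  have h3 (r) : stalkClosedPointTo L₁ (F.modification.presheaf.stalkSpecializes hs r) =
    algebraMap R K (stalkClosedPointTo L r) := congr($hs₁ r)
  have h3' (r) : stalkClosedPointTo L₁ (F.modification.presheaf.stalkSpecializes hs' r) =
    algebraMap R K (stalkClosedPointTo L' r) := congr($hs₁' r)
  have h4 := congr(stalkClosedPointTo L₁ $h2)
  rw [map_mul, map_mul, map_one, h3, h3', h3, ← map_mul, ← map_mul] at h4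
  have h5 := isUnit_of_dvd_one (hinj (h4.trans (map_one _).symm)).dvd
  have h6 : IsUnit v := isUnit_of_map_unit (stalkClosedPointTo L).hom _
    (isUnit_of_mul_isUnit_left (isUnit_of_mul_isUnit_left h5))
  have h7 : IsUnit (stalkEval F.proj hU ε) := isUnit_of_map_unit (stalkClosedPointTo L).hom _
    (isUnit_of_mul_isUnit_right h5)
  have h8 : stalkEval F.proj hU (c.fn k) ∣ stalkEval F.proj hU c.s := by
    rw [hε, map_mul, hv, h7.mul_right_dvd, h6.mul_right_dvd]
  have h9 : stalkEval F.proj hU c.s ∣ stalkEval F.proj hU (c.fn k) := by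
    rw [hε, map_mul, hv, mul_assoc]
    exact dvd_mul_right _ _
  exact (c.dvdAt_iff hU).mpr ⟨h8, h9.trans (map_dvd _ (c.fn_dvd_fn k.le_succ))⟩

end NodalFamily

end Properness

/-! ### Uniqueness and existence in the valuative criterion. -/

section Properness

open IsLocalRing Scheme

variable {X S T : Scheme.{u}} {f : X ⟶ S}

lemma exists_comp_eq_of_closedPoint_mem_range {R : CommRingCat.{u}} [IsLocalRing R] (L : Spec R ⟶ X)
    (ι : T ⟶ X) [IsOpenImmersion ι] (h : L (closedPoint R) ∈ Set.range ι) :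
    ∃ l : Spec R ⟶ T, l ≫ ι = L := by
  have h1 : L ⁻¹ᵁ ι.opensRange = ⊤ := preimage_eq_top_of_closedPoint_mem L h
  have h2 : Set.range L ⊆ Set.range ι := by
    rintro _ ⟨y, rfl⟩
    have h3 : y ∈ L ⁻¹ᵁ ι.opensRange := h1 ▸ trivial
    exact h3
  exact ⟨IsOpenImmersion.lift ι L h2, IsOpenImmersion.lift_fac _ _ _⟩

lemma isDominant_SpecMap {R K : Type u} [CommRing R] [CommRing K] [Algebra R K]
    (h : Function.Injective (algebraMap R K)) :
    IsDominant (Spec.map (CommRingCat.ofHom (algebraMap R K))) := by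
  refine ⟨(PrimeSpectrum.denseRange_comap_iff_ker_le_nilRadical (algebraMap R K)).mpr ?_⟩
  rw [(RingHom.injective_iff_ker_eq_bot _).mp h]
  exact bot_le

lemma stalkEval_congr {m m' : T ⟶ X} (h : m = m') {U : X.Opens} {p : T} (hp : m p ∈ U)
    (hp' : m' p ∈ U) (r : Γ(X, U)) : stalkEval m hp r = stalkEval m' hp' r := by
  subst h
  rfl

namespace SortedChart

variable (c : SortedChart f) (k : Fin c.τ.length) (p : c.sortedPiece k)

lemma stalkEval_s : stalkEval (c.sortedHom k) (c.pieceHom_mem _ p) c.s =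
    stalkEval (c.sortedHom k) (c.pieceHom_mem _ p) (c.fn k) *
      (c.sortedPiece k).presheaf.germ ⊤ p trivial
        (c.pieceθ (c.take_mul_drop k) (NodeAlgebra.x c.τ[k])) := by
  rw [stalkEval_fn, part_eq]
  exact c.stalkMap_s (c.take_mul_drop k) p

lemma stalkEval_fn_succ : stalkEval (c.sortedHom k) (c.pieceHom_mem _ p) (c.fn (k + 1)) =
    stalkEval (c.sortedHom k) (c.pieceHom_mem _ p) c.s *
      (c.sortedPiece k).presheaf.germ ⊤ p trivial
        (c.pieceθ (c.take_mul_drop k) (NodeAlgebra.y c.τ[k])) := by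
  rw [stalkEval_s, mul_assoc, c.germ_x_mul_germ_y, fn_succ, map_mul, ← germ_appLE c.le]
  rfl

end SortedChart

variable {D : S.IdealSheafData} (F : NodalFamily f D)

namespace NodalFamily

lemma mem_smoothOpen_or_exists_sortedChart (x : X) :
    x ∈ F.smoothOpen ∨ ∃ c : SortedChart f, x ∈ c.U ∧ c.τ ≠ [] := by
  rw [or_iff_not_imp_left]
  intro hx
  have key (c : NodeChart f) (hc : x ∈ c.U) : ¬ (IsUnit (X.presheaf.germ c.U x hc c.s) ∨
      IsUnit (X.presheaf.germ c.U x hc c.t)) :=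
    fun h => hx (c.isCurvePoint hc h).formallySmooth
  obtain h | ⟨c, hc⟩ := F.chart x
  · exact (hx h.formallySmooth).elim
  · have h := key c hc
    rw [not_or] at h
    obtain ⟨c', hc'⟩ := F.exists_sortedChart c hc h.1 h.2
    -- With an empty word the coordinates satisfy `s t = 1`, which is impossible at a point outside
    -- the smooth locus.
    refine ⟨c', hc', fun h1 => key c'.toNodeChart hc' (Or.inl ?_)⟩
    have h2 := c'.fn_length
    rw [h1, List.length_nil, SortedChart.fn_zero] at h2
    refine (isUnit_of_dvd_one ?_).map (X.presheaf.germ c'.U x hc').hom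
    exact Dvd.intro _ h2.symm

instance (i) : IsSeparated (F.pieceHom i) := by
  cases i with
  | none => exact inferInstanceAs (IsSeparated F.smoothOpen.ι)
  | some i => exact inferInstanceAs (IsSeparated
      (i.1.pieceFst (i.1.take_mul_drop i.2) ≫ i.1.U.ι))

lemma mono_pieceHom_none : Mono (F.pieceHom none) := inferInstanceAs (Mono F.smoothOpen.ι)

section

variable {R K : Type u} [CommRing R] [IsDomain R] [ValuationRing R] [Field K] [Algebra R K]

lemma eq_of_mem_range_incl (hinj : Function.Injective (algebraMap R K))
    {L L' : Spec (.of R) ⟶ F.modification}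
    (h₁ : Spec.map (CommRingCat.ofHom (algebraMap R K)) ≫ L =
      Spec.map (CommRingCat.ofHom (algebraMap R K)) ≫ L')
    (h₂ : L ≫ F.proj = L' ≫ F.proj) {i} (hL : L (closedPoint R) ∈ Set.range (F.incl i))
    (hL' : L' (closedPoint R) ∈ Set.range (F.incl i)) : L = L' := by
  obtain ⟨l, rfl⟩ := exists_comp_eq_of_closedPoint_mem_range (R := .of R) L (F.incl i) hL
  obtain ⟨l', rfl⟩ := exists_comp_eq_of_closedPoint_mem_range (R := .of R) L' (F.incl i) hL'
  rw [← Category.assoc, ← Category.assoc, cancel_mono] at h₁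
  rw [Category.assoc, Category.assoc, F.incl_proj] at h₂
  have := isDominant_SpecMap hinj
  rw [ext_of_isDominant_of_isSeparated (F.pieceHom i) h₂ _ h₁]

/-- Both closed points lie in pieces of one chart, and the piece of larger index contains both of
them. That piece is separated over `X`. -/
lemma eq_of_comp_proj_eq (hinj : Function.Injective (algebraMap R K))
    {L L' : Spec (.of R) ⟶ F.modification}
    (h₁ : Spec.map (CommRingCat.ofHom (algebraMap R K)) ≫ L =
      Spec.map (CommRingCat.ofHom (algebraMap R K)) ≫ L')
    (h₂ : L ≫ F.proj = L' ≫ F.proj) : L = L' := by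
  have h₃ : F.proj (L (closedPoint R)) = F.proj (L' (closedPoint R)) := congr($h₂ (closedPoint R))
  obtain h | ⟨c, hc, hτ⟩ := F.mem_smoothOpen_or_exists_sortedChart (F.proj (L (closedPoint R)))
  · exact F.eq_of_mem_range_incl hinj h₁ h₂ (F.mem_range_incl_none h)
      (F.mem_range_incl_none (h₃ ▸ h))
  have hc' : F.proj (L' (closedPoint R)) ∈ c.U := h₃ ▸ hc
  obtain ⟨i, hi⟩ := (F.adaptedAt_proj _ c hc).exists_dvdAt hτ
  obtain ⟨k, hk⟩ := (F.adaptedAt_proj _ c hc').exists_dvdAt hτ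
  obtain hik | hki := le_total i k
  · exact F.eq_of_mem_range_incl hinj h₁ h₂
      (F.mem_range_incl_some_iff.mpr (F.dvdAt_of_le hinj c h₁ rfl (Fin.le_def.mp hik) hi hk))
      (F.mem_range_incl_some_iff.mpr hk)
  · exact F.eq_of_mem_range_incl hinj h₁ h₂ (F.mem_range_incl_some_iff.mpr hi)
      (F.mem_range_incl_some_iff.mpr
        (F.dvdAt_of_le hinj c h₁.symm rfl (Fin.le_def.mp hki) hk hi))

lemma exists_lift_of_mem_smoothOpen {L₁ : Spec (.of K) ⟶ F.modification} {L : Spec (.of R) ⟶ X}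
    (comm : L₁ ≫ F.proj = Spec.map (CommRingCat.ofHom (algebraMap R K)) ≫ L)
    (hL : L (closedPoint R) ∈ F.smoothOpen) (hL₁ : F.proj (L₁ (closedPoint K)) ∈ F.smoothOpen) :
    ∃ l : Spec (.of R) ⟶ F.modification,
      Spec.map (CommRingCat.ofHom (algebraMap R K)) ≫ l = L₁ ∧ l ≫ F.proj = L := by
  have h1 : L (closedPoint R) ∈ Set.range F.smoothOpen.ι := by
    rw [Scheme.Opens.range_ι]
    exact hL
  obtain ⟨l, hl⟩ : ∃ l : Spec (.of R) ⟶ F.piece none, l ≫ F.pieceHom none = L :=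
    exists_comp_eq_of_closedPoint_mem_range (R := .of R) L F.smoothOpen.ι h1
  obtain ⟨l₁, rfl⟩ := exists_comp_eq_of_closedPoint_mem_range (R := .of K) L₁ (F.incl none)
    (F.mem_range_incl_none hL₁)
  have := F.mono_pieceHom_none
  refine ⟨l ≫ F.incl none, ?_, by rw [Category.assoc, F.incl_proj, hl]⟩
  rw [← Category.assoc]
  congr 1
  rw [← cancel_mono (F.pieceHom none), Category.assoc, hl, ← comm, Category.assoc, F.incl_proj]

/-- The generic point may lie in several pieces of the chart; `exists_dvd_step` selects one in which
its coordinates are integral, and there the point extends to `R`. -/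
lemma exists_lift_of_sortedChart [IsFractionRing R K] {L₁ : Spec (.of K) ⟶ F.modification}
    {L : Spec (.of R) ⟶ X}
    (comm : L₁ ≫ F.proj = Spec.map (CommRingCat.ofHom (algebraMap R K)) ≫ L)
    {c : SortedChart f} (hτ : c.τ ≠ []) (hL : L (closedPoint R) ∈ c.U)
    (hL₁ : F.proj (L₁ (closedPoint K)) ∈ c.U) :
    ∃ l : Spec (.of R) ⟶ F.modification,
      Spec.map (CommRingCat.ofHom (algebraMap R K)) ≫ l = L₁ ∧ l ≫ F.proj = L := by
  have hinj : Function.Injective (algebraMap R K) := IsFractionRing.injective R K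
  have hR (r : K) (hr : r ∉ (algebraMap R K).range) : r⁻¹ ∈ (algebraMap R K).range := by
    obtain ⟨a, ha⟩ | ⟨a, ha⟩ := ValuationRing.isInteger_or_isInteger R r
    · exact (hr ⟨a, ha⟩).elim
    · exact ⟨a, ha⟩
  obtain ⟨k₀, hk₀⟩ := (F.adaptedAt_proj _ c hL₁).exists_dvdAt hτ
  rw [c.dvdAt_iff hL₁] at hk₀
  obtain ⟨k, hk, u, v, hu, hv, hur, hvr⟩ := exists_dvd_step (stalkClosedPointTo L₁).hom hR
    (n := c.τ.length) (c := fun k => stalkEval F.proj hL₁ (c.fn k))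
    (s := stalkEval F.proj hL₁ c.s) (t := stalkEval F.proj hL₁ c.t)
    (fun r hr => isUnit_of_map_unit (stalkClosedPointTo L₁).hom _ (isUnit_iff_ne_zero.mpr hr))
    (fun h => map_dvd _ (c.fn_dvd_fn h)) (by rw [c.fn_zero, map_one])
    (by rw [c.fn_length, map_mul]) (fun i _ => c.stalkEval_fn_mem F.proj hL₁ i)
    ⟨_, (stalkClosedPointTo_stalkEval_eq F.proj comm hL₁ hL c.s).symm⟩
    ⟨_, (stalkClosedPointTo_stalkEval_eq F.proj comm hL₁ hL c.t).symm⟩ k₀.2 hk₀.1 hk₀.2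
  let i : Fin c.τ.length := ⟨k, hk⟩
  have hmem : L₁ (closedPoint K) ∈ Set.range (F.incl (some ⟨c, i⟩)) :=
    F.mem_range_incl_some_iff.mpr ((c.dvdAt_iff hL₁).mpr ⟨⟨u, hu⟩, ⟨v, hv⟩⟩)
  obtain ⟨ι, _, hι, hmem⟩ : ∃ ι : c.sortedPiece i ⟶ F.modification, IsOpenImmersion ι ∧
      ι ≫ F.proj = c.sortedHom i ∧ L₁ (closedPoint K) ∈ Set.range ι :=
    ⟨F.incl (some ⟨c, i⟩), instIsOpenImmersionIncl F _, F.incl_proj _, hmem⟩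
  obtain ⟨l₁, rfl⟩ := exists_comp_eq_of_closedPoint_mem_range (R := .of K) L₁ ι hmem
  let q : c.sortedPiece i := l₁ (closedPoint K)
  have hq : c.sortedHom i q ∈ c.U := c.pieceHom_mem _ q
  have h1 (r) : ι.stalkMap q (stalkEval F.proj hL₁ r) = stalkEval (c.sortedHom i) hq r :=
    (stalkEval_comp _ _ _ r).trans (stalkEval_congr hι _ hq r)
  have h2 (r) : stalkClosedPointTo (l₁ ≫ ι) r = stalkClosedPointTo l₁ (ι.stalkMap q r) :=
    congr($(stalkClosedPointTo_comp l₁ ι) r)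
  have key {r r' : Γ(X, c.U)} {w} (h : stalkEval F.proj hL₁ r = stalkEval F.proj hL₁ r' * w) :
      stalkEval (c.sortedHom i) hq r = stalkEval (c.sortedHom i) hq r' * ι.stalkMap q w :=
    (h1 r).symm.trans (congr(ι.stalkMap q $h).trans
      ((map_mul (ι.stalkMap q).hom _ _).trans congr($(h1 r') * _)))
  -- Cancelling the regular elements `part k` and `s` identifies `u` and `v` with the coordinates of
  -- the selected piece.
  have hu₁ := (mul_cancel_left_mem_nonZeroDivisors (c.stalkEval_fn_mem (c.sortedHom i) hq i)).mp
    ((c.stalkEval_s i q).symm.trans (key hu))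
  have hv₁ := (mul_cancel_left_mem_nonZeroDivisors (c.stalkEval_s_mem (c.sortedHom i) hq)).mp
    ((c.stalkEval_fn_succ i q).symm.trans (key hv))
  have key' {w} (hw : (stalkClosedPointTo (l₁ ≫ ι)).hom w ∈ (algebraMap R K).range) {w'}
      (h : w' = ι.stalkMap q w) : stalkClosedPointTo l₁ w' ∈ (algebraMap R K).range := by
    rw [h]
    obtain ⟨r, hr⟩ := hw
    exact ⟨r, hr.trans (h2 w)⟩
  obtain ⟨l, hl, hl'⟩ := c.exists_lift_of_mem_range (c.take_mul_drop i) hinj (i₁ := l₁) (i₂ := L)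
    (by rw [← comm, Category.assoc, hι]) hL (key' hur hu₁) (key' hvr hv₁)
  refine ⟨l ≫ ι, ?_, ?_⟩
  · rw [← Category.assoc, hl]
  · rw [Category.assoc, hι, hl']

end

end NodalFamily

end Properness

/-! ### Quasi-compactness and properness of the modification. -/

section Properness

open IsLocalRing Scheme

variable {X S : Scheme.{u}} {f : X ⟶ S} {D : S.IdealSheafData} (F : NodalFamily f D)

namespace NodalFamily

lemma valuativeCriterion_proj : ValuativeCriterion F.proj := by
  rw [ValuativeCriterion.iff]
  constructor
  · intro V
    have comm := V.commSq.w
    have h1 {U : X.Opens} (hU : V.i₂ (closedPoint V.R) ∈ U) :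
        F.proj (V.i₁ (closedPoint V.K)) ∈ U := by
      obtain ⟨hs, -⟩ := exists_stalkSpecializes_stalkClosedPointTo comm.symm
      exact hs.mem_open U.isOpen hU
    obtain h | ⟨c, hc, hτ⟩ := F.mem_smoothOpen_or_exists_sortedChart (V.i₂ (closedPoint V.R))
    · obtain ⟨l, hl, hl'⟩ := F.exists_lift_of_mem_smoothOpen comm h (h1 h)
      exact ⟨⟨⟨l, hl, hl'⟩⟩⟩
    · obtain ⟨l, hl, hl'⟩ := F.exists_lift_of_sortedChart comm hτ hc (h1 hc)
      exact ⟨⟨⟨l, hl, hl'⟩⟩⟩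
  · intro V
    refine ⟨fun l l' => CommSq.LiftStruct.ext ?_⟩
    exact F.eq_of_comp_proj_eq (IsFractionRing.injective V.R V.K) (l.fac_left.trans l'.fac_left.symm)
      (l.fac_right.trans l'.fac_right.symm)

lemma isCompact_ι_preimage {U W : X.Opens} (hW : IsAffineOpen W) (h : W ≤ U) :
    IsCompact (U.ι ⁻¹ᵁ W : Set U) := by
  refine (U.ι.isOpenEmbedding.isEmbedding.isCompact_preimage_iff ?_).mpr hW.isCompact
  rw [Scheme.Opens.range_ι]
  exact h

lemma isCompact_preimage_proj {W : X.Opens} {ι : Type*} [Finite ι]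
    (i : ι → Option (Σ c : SortedChart f, Fin c.τ.length))
    (hW : ∀ k, IsCompact (F.pieceHom (i k) ⁻¹ᵁ W : Set (F.piece (i k))))
    (h : ∀ p, F.proj p ∈ W → ∃ k, p ∈ Set.range (F.incl (i k))) :
    IsCompact (F.proj ⁻¹ᵁ W : Set F.modification) := by
  have h1 : (F.proj ⁻¹ᵁ W : Set F.modification) =
      ⋃ k, F.incl (i k) '' (F.pieceHom (i k) ⁻¹ᵁ W : Set (F.piece (i k))) := by
    ext p
    simp only [Set.mem_iUnion]
    constructor
    · intro hp
      obtain ⟨k, q, rfl⟩ := h p hp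
      refine ⟨k, q, ?_, rfl⟩
      have h2 : F.pieceHom (i k) q ∈ W := F.proj_incl (i k) q ▸ hp
      exact h2
    · rintro ⟨k, q, hq, rfl⟩
      have h2 : F.pieceHom (i k) q ∈ W := hq
      rw [← F.proj_incl] at h2
      exact h2
  rw [h1]
  exact isCompact_iUnion fun k => (hW k).image (F.incl (i k)).continuous

/-- Infinitely many pieces are glued, but over the domain of one sorted chart the finitely many
pieces of that chart already cover, by adaptedness. -/
lemma exists_isCompact_preimage_proj (x : X) :
    ∃ W : X.Opens, IsAffineOpen W ∧ x ∈ W ∧ IsCompact (F.proj ⁻¹ᵁ W : Set F.modification) := by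
  have key (U : X.Opens) (hx : x ∈ U) : ∃ W : X.Opens, IsAffineOpen W ∧ x ∈ W ∧ W ≤ U := by
    obtain ⟨W, hW, hxW, hWU⟩ := X.isBasis_affineOpens.exists_subset_of_mem_open hx U.isOpen
    obtain ⟨W, hWa, rfl⟩ := hW
    exact ⟨W, hWa, hxW, hWU⟩
  obtain h | ⟨c, hc, hτ⟩ := F.mem_smoothOpen_or_exists_sortedChart x
  · obtain ⟨W, hW, hxW, hWU⟩ := key _ h
    exact ⟨W, hW, hxW, F.isCompact_preimage_proj (fun _ : Unit => none)
      (fun _ => isCompact_ι_preimage hW hWU) fun p hp => ⟨(), F.mem_range_incl_none (hWU hp)⟩⟩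
  · obtain ⟨W, hW, hxW, hWU⟩ := key _ hc
    refine ⟨W, hW, hxW, F.isCompact_preimage_proj (fun k : Fin c.τ.length => some ⟨c, k⟩)
      (fun k => ?_) fun p hp => ?_⟩
    · exact Scheme.Hom.isCompact_preimage (c.pieceFst (c.take_mul_drop k))
        (isCompact_ι_preimage hW hWU)
    · obtain ⟨k, hk⟩ := (F.adaptedAt_proj p c (hWU hp)).exists_dvdAt hτ
      exact ⟨k, F.mem_range_incl_some_iff.mpr hk⟩

instance : QuasiCompact F.proj := by
  choose W hW hxW hc using F.exists_isCompact_preimage_proj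
  have h := instHasAffinePropertyQuasiCompactCompactSpaceCarrierCarrierCommRingCat.{u}
  refine @HasAffineProperty.of_iSup_eq_top _ _ h _ _ _ _ (fun x => ⟨W x, hW x⟩)
    (top_le_iff.mp fun x _ => TopologicalSpace.Opens.mem_iSup.mpr ⟨x, hxW x⟩) fun x => ?_
  exact isCompact_iff_compactSpace.mp (hc x)

instance : IsProper F.proj := IsProper.of_valuativeCriterion _ F.valuativeCriterion_proj

end NodalFamily

end Properness

/-! ### Inverse images of ideal sheaves on affine opens and stalks. -/

section PullbackIdeal

variable {S T : Scheme.{u}} (I : S.IdealSheafData) (t : T ⟶ S)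

lemma fromSpec_comp_appLE {U : T.Opens} (hU : IsAffineOpen U) {B : CommRingCat.{u}} (φ : Γ(T, U) ⟶ B)
    (h : (⊤ : (Spec B).Opens) ≤ (Spec.map φ ≫ hU.fromSpec) ⁻¹ᵁ U) :
    (Spec.map φ ≫ hU.fromSpec).appLE U ⊤ h = φ ≫ (Scheme.ΓSpecIso B).inv := by
  have h1 : (⊤ : (Spec B).Opens) ≤ Spec.map φ ⁻¹ᵁ hU.fromSpec ⁻¹ᵁ U := h
  refine (Scheme.Hom.comp_appLE (Spec.map φ) hU.fromSpec U ⊤ h).trans ?_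
  refine congr($(hU.fromSpec_app_self) ≫ (Spec.map φ).appLE _ _ h1).trans ?_
  rw [Category.assoc, Scheme.Hom.map_appLE, Scheme.ΓSpecIso_inv_naturality]
  simp [Scheme.Hom.app_eq_appLE]

lemma comp_appLE_eq_zero {Z : Scheme.{u}} (g : Z ⟶ T) {U : S.Opens} {W : Z.Opens}
    (h : W ≤ (g ≫ t) ⁻¹ᵁ U) {r : Γ(S, U)} (hr : t.app U r = 0) : (g ≫ t).appLE U W h r = 0 := by
  have h1 : W ≤ g ⁻¹ᵁ t ⁻¹ᵁ U := h
  have h2 := congr($(Scheme.Hom.comp_appLE g t U W h) r)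
  exact h2.trans (congr(g.appLE _ W h1 $hr).trans (map_zero _))

/-- The left side is the kernel of restriction to the fibre product. The spectrum of `Γ(T, U)`
modulo the extended ideal maps to that fibre product, so a section killed there lies in the extended
ideal; the reverse inclusion is the commutativity of the square. -/
lemma ideal_comap {U : T.Opens} (hU : IsAffineOpen U) {V : S.Opens} (hV : IsAffineOpen V)
    (h : U ≤ t ⁻¹ᵁ V) :
    (I.comap t).ideal ⟨U, hU⟩ = (I.ideal ⟨V, hV⟩).map (t.appLE V U h).hom := by
  have hk : (I.comap t).ideal ⟨U, hU⟩ = RingHom.ker ((pullback.fst t I.subschemeι).app U).hom :=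
    Scheme.Hom.ker_apply _ ⟨U, hU⟩
  refine le_antisymm (fun r hr => ?_) (Ideal.map_le_iff_le_comap.mpr fun r hr => ?_)
  · rw [hk, RingHom.mem_ker] at hr
    let J := (I.ideal ⟨V, hV⟩).map (t.appLE V U h).hom
    let mk : Γ(T, U) ⟶ .of (Γ(T, U) ⧸ J) := CommRingCat.ofHom (Ideal.Quotient.mk J)
    let mk' : Γ(S, V) ⟶ .of (Γ(S, V) ⧸ I.ideal ⟨V, hV⟩) :=
      CommRingCat.ofHom (Ideal.Quotient.mk (I.ideal ⟨V, hV⟩))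
    let ψ : CommRingCat.of (Γ(S, V) ⧸ I.ideal ⟨V, hV⟩) ⟶ .of (Γ(T, U) ⧸ J) :=
      CommRingCat.ofHom (Ideal.quotientMap J (t.appLE V U h).hom Ideal.le_comap_map)
    have h1 : t.appLE V U h ≫ mk = mk' ≫ ψ := rfl
    obtain ⟨k, hk⟩ : ∃ k : Spec (.of (Γ(S, V) ⧸ I.ideal ⟨V, hV⟩)) ⟶ I.subscheme,
      k ≫ I.subschemeι = Spec.map mk' ≫ hV.fromSpec := ⟨I.subschemeCover.f ⟨V, hV⟩,
        (I.subschemeCover_map_subschemeι ⟨V, hV⟩).trans (I.glueDataObjι_ι ⟨V, hV⟩)⟩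
    have h2 : (Spec.map mk ≫ hU.fromSpec) ≫ t = (Spec.map ψ ≫ k) ≫ I.subschemeι := by
      rw [Category.assoc, Category.assoc, hk, ← Spec.map_comp_assoc, ← h1, Spec.map_comp_assoc,
        IsAffineOpen.SpecMap_appLE_fromSpec]
    obtain ⟨l, hl⟩ : ∃ l, l ≫ pullback.fst t I.subschemeι = Spec.map mk ≫ hU.fromSpec :=
      ⟨pullback.lift _ _ h2, pullback.lift_fst _ _ h2⟩
    have hle : (⊤ : (Spec (.of (Γ(T, U) ⧸ J))).Opens) ≤ (Spec.map mk ≫ hU.fromSpec) ⁻¹ᵁ U := by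
      rw [Scheme.Hom.comp_preimage, hU.fromSpec_preimage_self]
      exact le_rfl
    have h5 : (Spec.map mk ≫ hU.fromSpec).appLE U ⊤ hle r = 0 := by
      have h4 := fun hle => comp_appLE_eq_zero (pullback.fst t I.subschemeι) l (W := ⊤) hle hr
      rw [hl] at h4
      exact h4 hle
    rw [fromSpec_comp_appLE, CommRingCat.comp_apply] at h5
    have h6 := congr((Scheme.ΓSpecIso (.of (Γ(T, U) ⧸ J))).hom $h5)
    rw [← CommRingCat.comp_apply, Iso.inv_hom_id, map_zero] at h6
    exact Ideal.Quotient.eq_zero_iff_mem.mp h6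
  · rw [Ideal.mem_comap, hk, RingHom.mem_ker]
    rw [← I.ker_subschemeι_app ⟨V, hV⟩, RingHom.mem_ker] at hr
    have h2 := fun hle => comp_appLE_eq_zero I.subschemeι (pullback.snd t I.subschemeι)
      (W := pullback.fst t I.subschemeι ⁻¹ᵁ U) hle hr
    rw [← pullback.condition] at h2
    have h3 : pullback.fst t I.subschemeι ⁻¹ᵁ U ≤ (pullback.fst t I.subschemeι ≫ t) ⁻¹ᵁ V :=
      fun x hx => h hx
    have h4 := h2 h3
    rw [← Scheme.Hom.appLE_comp_appLE (pullback.fst t I.subschemeι) t V U _ h le_rfl,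
      CommRingCat.comp_apply] at h4
    rw [Scheme.Hom.app_eq_appLE]
    exact h4

lemma stalkIdeal_comap (p : T) :
    stalkIdeal (I.comap t) p = (stalkIdeal I (t p)).map (t.stalkMap p).hom := by
  obtain ⟨V, hV, hpV, -⟩ := S.isBasis_affineOpens.exists_subset_of_mem_open
    (Set.mem_univ (t p)) isOpen_univ
  obtain ⟨V, hVa, rfl⟩ := hV
  obtain ⟨U, hU, hpU, hUV⟩ := T.isBasis_affineOpens.exists_subset_of_mem_open
    (show p ∈ ((t ⁻¹ᵁ V : T.Opens) : Set T) from hpV) (t ⁻¹ᵁ V).isOpen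
  obtain ⟨U, hUa, rfl⟩ := hU
  rw [stalkIdeal_eq_map _ p ⟨U, hUa⟩ hpU, stalkIdeal_eq_map I (t p) ⟨V, hVa⟩ hpV,
    ideal_comap I t hUa hVa hUV, Ideal.map_map, Ideal.map_map]
  congr 1
  ext r
  exact germ_appLE hUV hpU r

end PullbackIdeal

/-! ### Semi-stable charts at a point. -/

section SemistableCharts

variable {X S : Scheme.{u}}

/-- The existence of a weakly strictly semi-stable chart at the point `x`. -/
def HasSemistableChart (r : ℕ) (f : X ⟶ S) (x : X) : Prop :=
  ∃ (U : X.Opens) (V : S.Opens) (hV : IsAffineOpen V) (q : ℕ) (a : Γ(S, V))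
    (g : U.toScheme ⟶ Spec (CommRingCat.of (StandardAlgebra Γ(S, V) r q a))),
    x ∈ U ∧ f x ∈ V ∧ 0 < q ∧ q ≤ r + 1 ∧ Etale g ∧
      g ≫ Spec.map (CommRingCat.ofHom (algebraMap Γ(S, V) (StandardAlgebra Γ(S, V) r q a))) ≫
        hV.fromSpec = U.ι ≫ f

lemma hasSemistableChart_comp_iff {X' : Scheme.{u}} {r : ℕ} (k : X' ⟶ X) [IsOpenImmersion k]
    {f : X ⟶ S} {x : X'} : HasSemistableChart r (k ≫ f) x ↔ HasSemistableChart r f (k x) := by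
  constructor
  · rintro ⟨U, V, hV, q, a, g, hxU, hxV, hq, hqr, hg, h⟩
    refine ⟨(U.ι ≫ k).opensRange, V, hV, q, a, (U.ι ≫ k).isoOpensRange.inv ≫ g,
      ⟨⟨x, hxU⟩, rfl⟩, hxV, hq, hqr, inferInstance, ?_⟩
    rw [Category.assoc, h, ← Category.assoc U.ι, ← Category.assoc,
      Scheme.Hom.isoOpensRange_inv_comp]
  · rintro ⟨U, V, hV, q, a, g, hxU, hxV, hq, hqr, hg, h⟩
    refine ⟨k ⁻¹ᵁ U, V, hV, q, a, k ∣_ U ≫ g, hxU, hxV, hq, hqr, inferInstance, ?_⟩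
    rw [Category.assoc, h, morphismRestrict_ι_assoc]

lemma NodeChart.hasSemistableChart {f : X ⟶ S} (c : NodeChart f) {x : X} (hx : x ∈ c.U) :
    HasSemistableChart 1 f x := by
  refine ⟨c.U, c.V, c.hV, 2, c.a, specHom c.U c.θ, hx, c.le hx, two_pos, le_rfl, c.etale, ?_⟩
  rw [← Category.assoc, specHom_comp, c.comm, specHom_fromSpec]

end SemistableCharts

/-! ### Birationality, regularity and normal crossings of the modification. -/

section ModificationProperties

variable {X S : Scheme.{u}} {f : X ⟶ S} {D : S.IdealSheafData} (F : NodalFamily f D)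

/-- Generizations lift along flat morphisms. -/
lemma dense_preimage_of_flat {T : Scheme.{u}} (t : T ⟶ S) [Flat t] {U : S.Opens}
    (hU : ∀ s : S, ∃ s' ∈ U, s' ⤳ s) : Dense ((t ⁻¹ᵁ U : T.Opens) : Set T) := by
  intro p
  obtain ⟨s', hs', h⟩ := hU (t p)
  obtain ⟨p', hp', rfl⟩ := Flat.generalizingMap t h
  exact hp'.mem_closed isClosed_closure (subset_closure hs')

namespace NodalFamily

include F in
-- The local ring is a domain and the local equation of `D` is a product of primes, hence nonzero at
-- the generic point.
lemma exists_specializes (s : S) : ∃ s' ∈ openCompl D, s' ⤳ s := by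
  by_cases hs : s ∈ D.support
  · have := F.isDomain s
    obtain ⟨s', h, hQ⟩ := exists_specializes_of_isPrime (⊥ : Ideal (S.presheaf.stalk s))
    refine ⟨s', fun h1 => ?_, h⟩
    replace h1 : s' ∈ D.support := h1
    obtain ⟨-, d, t, J, hdim, hspan, hJ⟩ := F.snc.2 s hs
    rw [mem_support_iff_stalkIdeal, ← map_stalkIdeal D h, Ideal.map_le_iff_le_comap, hQ, hJ,
      Ideal.span_singleton_le_iff_mem, Ideal.mem_bot, Finset.prod_eq_zero_iff] at h1
    obtain ⟨j, -, hj⟩ := h1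
    have hsys : IsRegularSystem t := ⟨hspan, by simpa using hdim⟩
    have := F.regular.1
    exact (hsys.prime j).ne_zero hj
  · exact ⟨s, hs, specializes_rfl⟩

lemma preimage_openCompl_le_smoothOpen : f ⁻¹ᵁ openCompl D ≤ F.smoothOpen := fun _ hx =>
  F.formallySmooth_stalkMap hx

/-- All points of the modification over the smooth locus belong to the smooth piece, so the
inclusion of `V` through that piece is a section which is a surjective open immersion. -/
lemma isIso_proj_restrict {V : X.Opens} (hV : V ≤ F.smoothOpen) : IsIso (F.proj ∣_ V) := by
  obtain ⟨j, hj, hjV⟩ : ∃ j : V.toScheme ⟶ F.piece none, IsOpenImmersion j ∧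
      j ≫ F.pieceHom none = V.ι :=
    ⟨X.homOfLE hV, inferInstanceAs (IsOpenImmersion (X.homOfLE hV)), X.homOfLE_ι hV⟩
  have h1 : (j ≫ F.incl none) ≫ F.proj = V.ι := by rw [Category.assoc, F.incl_proj, hjV]
  have h2 : Set.range (j ≫ F.incl none) ⊆ Set.range (F.proj ⁻¹ᵁ V).ι := by
    rw [Scheme.Opens.range_ι]
    rintro _ ⟨x, rfl⟩
    have h3 : F.proj ((j ≫ F.incl none) x) = V.ι x := congr($h1 x)
    exact (congr($h3 ∈ V)).mpr x.2
  obtain ⟨s, hs⟩ : ∃ s, s ≫ (F.proj ⁻¹ᵁ V).ι = j ≫ F.incl none :=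
    ⟨IsOpenImmersion.lift _ _ h2, IsOpenImmersion.lift_fac _ _ _⟩
  have : IsOpenImmersion (s ≫ (F.proj ⁻¹ᵁ V).ι) := by
    rw [hs]
    infer_instance
  have := IsOpenImmersion.of_comp s (F.proj ⁻¹ᵁ V).ι
  have : Surjective s := by
    refine ⟨fun p => ?_⟩
    obtain ⟨q, hq⟩ := F.mem_range_incl_none (p := (F.proj ⁻¹ᵁ V).ι p) (hV p.2)
    have h3 : F.pieceHom none q ∈ V := by
      rw [← F.proj_incl, hq]
      exact p.2
    refine ⟨⟨_, h3⟩, (F.proj ⁻¹ᵁ V).ι.isOpenEmbedding.injective ?_⟩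
    refine (congr($hs ⟨_, h3⟩)).trans ((congrArg (F.incl none) ?_).trans hq)
    exact F.smoothOpen.ι.isOpenEmbedding.injective (congr($hjV ⟨_, h3⟩))
  have : IsIso s := (isIso_iff_isOpenImmersion_and_epi_base s).mpr
    ⟨inferInstance, (TopCat.epi_iff_surjective _).mpr s.surjective⟩
  have h3 : s ≫ F.proj ∣_ V = 𝟙 _ := by
    rw [← cancel_mono V.ι, Category.assoc, morphismRestrict_ι, reassoc_of% hs, F.incl_proj, hjV,
      Category.id_comp]
  have : IsIso (s ≫ F.proj ∣_ V) := by
    rw [h3]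
    infer_instance
  exact IsIso.of_isIso_comp_left s _

lemma isIso_proj_openCompl : IsIso (F.proj ∣_ (f ⁻¹ᵁ openCompl D)) :=
  F.isIso_proj_restrict F.preimage_openCompl_le_smoothOpen

lemma isProperModification_proj : IsProperModification F.proj := by
  have := F.flat
  exact ⟨inferInstance, f ⁻¹ᵁ openCompl D, dense_preimage_of_flat f F.exists_specializes,
    dense_preimage_of_flat (F.proj ≫ f) F.exists_specializes, F.isIso_proj_openCompl⟩

lemma isRegularScheme_modification : IsRegularScheme F.modification :=
  ⟨F.isLocallyNoetherian_modification, fun p => (F.isSNCHom_proj p).1⟩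

lemma isSNCDivisor_comap_proj : IsSNCDivisor (D.comap (F.proj ≫ f)) := by
  refine ⟨F.isLocallyNoetherian_modification, fun p hp => ⟨(F.isSNCHom_proj p).1, ?_⟩⟩
  rw [Scheme.IdealSheafData.support_comap] at hp
  obtain ⟨ι, _, g, J, hg, hJ⟩ := (F.isSNCHom_proj p).2 ((mem_support_iff_stalkIdeal D _).mp hp)
  let e := Fintype.equivFin ι
  refine ⟨Fintype.card ι, g ∘ e.symm, J.map e.toEmbedding, hg.dim, (hg.equiv e.symm).span_range, ?_⟩
  rw [stalkIdeal_comap, hJ, Finset.prod_map]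
  simp

lemma isWeaklyStrictlySemistable_proj (hf : IsWeaklyStrictlySemistable 1 f) :
    IsWeaklyStrictlySemistable 1 (F.proj ≫ f) := by
  intro p
  change HasSemistableChart 1 (F.proj ≫ f) p
  obtain ⟨i, q, rfl⟩ := F.exists_incl_eq p
  rw [← hasSemistableChart_comp_iff, F.incl_proj_assoc]
  cases i with
  | none => exact (hasSemistableChart_comp_iff F.smoothOpen.ι).mpr (hf _)
  | some i =>
    exact (i.1.pieceChart (i.1.take_mul_drop i.2)).hasSemistableChart trivial

end NodalFamily

end ModificationProperties

/-! ### Semi-stable curves are nodal families. -/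

section NodalFamilies

variable {X S : Scheme.{u}} {f : X ⟶ S}

lemma StandardAlgebra.finitePresentation (R : Type u) [CommRing R] (r q : ℕ) (a : R) :
    Algebra.FinitePresentation R (StandardAlgebra R r q a) :=
  Algebra.FinitePresentation.quotient (Submodule.fg_span_singleton _)

lemma IsWeaklyStrictlySemistable.locallyOfFinitePresentation {r : ℕ}
    (hf : IsWeaklyStrictlySemistable r f) : LocallyOfFinitePresentation f := by
  choose U V hV q a g hxU hxV hq hqr hg h using hf
  have hU : ⨆ x, U x = ⊤ := top_le_iff.mp fun x _ => TopologicalSpace.Opens.mem_iSup.mpr ⟨x, hxU x⟩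
  have := HasRingHomProperty.instIsZariskiLocalAtSource (P := @LocallyOfFinitePresentation.{u})
  refine (IsZariskiLocalAtSource.iff_of_openCover (P := @LocallyOfFinitePresentation.{u})
    (X.openCoverOfIsOpenCover U hU)).mpr fun x => ?_
  have h1 : LocallyOfFinitePresentation (Spec.map (CommRingCat.ofHom
      (algebraMap Γ(S, V x) (StandardAlgebra Γ(S, V x) r (q x) (a x))))) :=
    (HasRingHomProperty.Spec_iff (P := @LocallyOfFinitePresentation)).mpr
      (RingHom.finitePresentation_algebraMap.mpr (StandardAlgebra.finitePresentation ..))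
  have := hg x
  have h2 : LocallyOfFinitePresentation ((U x).ι ≫ f) := by
    rw [← h x]
    infer_instance
  exact h2

/-- The ring homomorphism of a semi-stable chart. -/
lemma exists_chart_of_etale {U : X.Opens} {V : S.Opens} (hV : IsAffineOpen V) {A : Type u} [CommRing A]
    {α : Γ(S, V) →+* A} {g : U.toScheme ⟶ Spec (CommRingCat.of A)} [Etale g]
    (h : g ≫ Spec.map (CommRingCat.ofHom α) ≫ hV.fromSpec = U.ι ≫ f) :
    ∃ (hle : U ≤ f ⁻¹ᵁ V) (θ : A →+* Γ(X, U)), θ.comp α = (f.appLE V U hle).hom ∧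
      IsEtaleChart U θ := by
  have hle : U ≤ f ⁻¹ᵁ V := by
    intro x hx
    have h1 : hV.fromSpec ((g ≫ Spec.map (CommRingCat.ofHom α)) ⟨x, hx⟩) = f x := congr($h ⟨x, hx⟩)
    have h2 : f x ∈ Set.range hV.fromSpec := ⟨_, h1⟩
    rwa [hV.range_fromSpec] at h2
  obtain ⟨θ, rfl⟩ := exists_eq_specHom g
  refine ⟨hle, θ, ?_, ‹_›⟩
  apply specHom_injective
  rw [← cancel_mono hV.fromSpec, specHom_fromSpec, ← h, ← specHom_comp, Category.assoc]

/-- In relative dimension one, `q = 1` eliminates `T₁` and leaves an affine line, and `q = 2` is the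
node. -/
lemma IsWeaklyStrictlySemistable.isCurvePoint_or (hf : IsWeaklyStrictlySemistable 1 f) (x : X) :
    IsCurvePoint (f.stalkMap x).hom ∨ ∃ c : NodeChart f, x ∈ c.U := by
  obtain ⟨U, V, hV, q, a, g, hxU, hxV, hq, hqr, hg, h⟩ := hf x
  obtain ⟨hle, θ, hθ, het⟩ := exists_chart_of_etale hV h
  obtain rfl | rfl : q = 1 ∨ q = 2 := by omega
  · left
    obtain ⟨e⟩ := StandardAlgebra.nonempty_equiv_polynomial Γ(S, V) a
    refine isCurvePoint_stalkMap hV hle (θ := θ.comp (e : _ →+* _)) ?_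
      (het.comp (RingHom.Etale.of_bijective e.bijective)) hxU
    rw [← hθ, RingHom.comp_assoc]
    congr 1
    ext r
    exact e.commutes r
  · exact Or.inr ⟨⟨U, V, hV, hle, a, θ, hθ, het⟩, hxU⟩

lemma IsWeaklyStrictlySemistable.nodalFamily (hf : IsWeaklyStrictlySemistable 1 f)
    (hS : IsRegularScheme S) {D : S.IdealSheafData} (hD : IsSNCDivisor D)
    (hsmooth : Smooth (f ∣_ openCompl D)) : NodalFamily f D :=
  ⟨hS, hD, hf.locallyOfFinitePresentation, hsmooth, hf.isCurvePoint_or⟩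

end NodalFamilies

end SemistableCurve

end

theorem mainTheorem5 {S X : Scheme.{u}} [IsNoetherian S]
    (hS : SemistableCurve.IsRegularScheme S)
    (D : S.IdealSheafData) (hD : SemistableCurve.IsSNCDivisor D)
    (f : X ⟶ S) (hf : SemistableCurve.IsWeaklyStrictlySemistable 1 f)
    (hsmooth : Smooth (f ∣_ SemistableCurve.openCompl D)) :
    ∃ (X' : Scheme.{u}) (π : X' ⟶ X),
      SemistableCurve.IsProperModification π ∧
      IsIso (π ∣_ (f ⁻¹ᵁ SemistableCurve.openCompl D)) ∧
      SemistableCurve.IsRegularScheme X' ∧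
      SemistableCurve.IsWeaklyStrictlySemistable 1 (π ≫ f) ∧
      SemistableCurve.IsSNCDivisor (D.comap (π ≫ f)) :=
  have F := hf.nodalFamily hS hD hsmooth
  ⟨F.modification, F.proj, F.isProperModification_proj, F.isIso_proj_openCompl,
    F.isRegularScheme_modification, F.isWeaklyStrictlySemistable_proj hf, F.isSNCDivisor_comap_proj⟩
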